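/- Let $N,n\ge 1$ be integers, $\mathbf a=(a_1,\dots,a_N)$ a vector of positive integers, $p\in(1,\infty)$ and $q\in[1,p]$. For a multi-index $\alpha\in\mathbb Z_{\ge 0}^N$ write $\langle\alpha,\mathbf a^{-1}\rangle=\sum_i \alpha_i/a_i$, let $m$ be the number of $\alpha$ with $\langle\alpha,\mathbf a^{-1}\rangle=1$, and for $u$ with values in $\mathbb R^n$ let $\nabla_{\mathbf a}u=(\partial^\alpha u)_{\langle\alpha,\mathbf a^{-1}\rangle=1}$, with values in $\mathbb R^{n\times m}$ (with the Euclidean norm $|\cdot|$). For $U\subset\mathbb R^N$ open, $W^{\mathbf a,p}(U)$ is the space of $u\in L^p(U;\mathbb R^n)$ whose weak derivatives $\partial^\alpha u$, $\langle\alpha,\mathbf a^{-1}\rangle\le 1$, lie in $L^p(U;\mathbb R^n)$, with norm $\|u\|_{W^{\mathbf a,p}(U)}=\sum_{\langle\alpha,\mathbf a^{-1}\rangle\le1}\|\partial^\alpha u\|_{L^p(U)}$; $W^{\mathbf a,p}_0(U)$ is the closure of $C_c^\infty(U;\mathbb R^n)$ in it; and for $g\in W^{\mathbf a,p}(\mathbb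 R^N)$ put $W^{\mathbf a,p}_g(\Omega)=\{g+\phi:\phi\in W^{\mathbf a,p}_0(\Omega)\}$. Let $F:\mathbb R^{n\times m}\to\mathbb R$ be continuous with $|F(X)|\le C(|X|^p+1)$ for some $C>0$ and all $X$, and let $I(u,\Omega)=\int_\Omega F(\nabla_{\mathbf a}u)\,dx$. We say that $I(\cdot,\Omega)$ is - *$L^q$ coercive on $W^{\mathbf a,p}_g(\Omega)$* if $I(u_j,\Omega)\to\infty$ for every sequence $u_j\in W^{\mathbf a,p}_g(\Omega)$ with $\|\nabla_{\mathbf a}u_j\|_{L^q(\Omega)}\to\infty$; - *$L^q$ mean coercive on $W^{\mathbf a,p}_g(\Omega)$* if there are $C_1,C_2>0$ with $I(u,\Omega)\ge C_1\|\nabla_{\mathbf a}u\|_{L^q(\Omega)}^q-C_2$ for all $u\in W^{\mathbf a,p}_g(\Omega)$. A sequence $u_j\in W^{\mathbf a,p}_g(\Omega)$ is *minimising* if $I(u_j,\Omega)\to\inf_{W^{\mathbf a,p}_g(\Omega)}I(\cdot,\Omega)\in[-\infty,\infty)$. A function $G:\mathbb R^{n\times m}\to\mathbb R$ is *$\mathbf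 a$-quasiconvex at $X_0$* if, with $Q=(-1,1)^N$, $G(X_0)\le\frac1{|Q|}\int_Q G(X_0+\nabla_{\mathbf a}\phi)\,dx$ for all $\phi\in C_c^\infty(Q;\mathbb R^n)$. Then the following are equivalent: (a) For every bounded open Lipschitz set $\Omega\subset\mathbb R^N$ and every $g\in W^{\mathbf a,p}(\mathbb R^N)$, $I(\cdot,\Omega)$ is $L^q$ coercive on $W^{\mathbf a,p}_g(\Omega)$. (b) There are a non-empty bounded open Lipschitz set $\Omega\subset\mathbb R^N$ and $g\in W^{\mathbf a,p}(\mathbb R^N)$ such that $I(\cdot,\Omega)$ is $L^q$ coercive on $W^{\mathbf a,p}_g(\Omega)$. (c) For every bounded open Lipschitz set $\Omega\subset\mathbb R^N$ and every $g\in W^{\mathbf a,p}(\mathbb R^N)$, $I(\cdot,\Omega)$ is $L^q$ mean coercive on $W^{\mathbf a,p}_g(\Omega)$. (d) There are a non-empty bounded open Lipschitz set $\Omega\subset\mathbb R^N$ and $g\in W^{\mathbf a,p}(\mathbb R^N)$ such that $I(\cdot,\Omega)$ is $L^q$ mean coercive on $W^{\mathbf a,p}_g(\Omega)$. (e) For every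 bounded open Lipschitz set $\Omega\subset\mathbb R^N$ and every $g\in W^{\mathbf a,p}(\mathbb R^N)$, every minimising sequence of $I(\cdot,\Omega)$ in $W^{\mathbf a,p}_g(\Omega)$ is bounded in $W^{\mathbf a,q}(\Omega)$. (f) There are a non-empty bounded open Lipschitz set $\Omega\subset\mathbb R^N$ and $g\in W^{\mathbf a,p}(\mathbb R^N)$ such that every minimising sequence of $I(\cdot,\Omega)$ in $W^{\mathbf a,p}_g(\Omega)$ is bounded in $W^{\mathbf a,q}(\Omega)$. (g) There are $c>0$ and $X_0\in\mathbb R^{n\times m}$ such that $X\mapsto F(X)-c|X|^q$ is $\mathbf a$-quasiconvex at $X_0$. -/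

import Mathlib

open MeasureTheory Filter Topology
open scoped ENNReal ContDiff

noncomputable section

namespace MixedSmoothness

/-- The weighted order `⟨α, a⁻¹⟩ = ∑ i, α i / a i` of a multi-index. -/
def weight {N : ℕ} (a α : Fin N → ℕ) : ℚ := ∑ i, (α i : ℚ) / (a i : ℚ)

/-- The multi-indices with `⟨α, a⁻¹⟩ ≤ 1`; see `mem_lowIdx`. -/
def lowIdx {N : ℕ} (a : Fin N → ℕ) : Finset (Fin N → ℕ) :=
  (Finset.Iic a).filter fun α => weight a α ≤ 1

/-- The multi-indices with `⟨α, a⁻¹⟩ = 1`; see `mem_topIdx`. -/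
def topIdx {N : ℕ} (a : Fin N → ℕ) : Finset (Fin N → ℕ) :=
  (Finset.Iic a).filter fun α => weight a α = 1

lemma le_of_weight_le_one {N : ℕ} {a α : Fin N → ℕ} (ha : ∀ i, 1 ≤ a i)
    (h : weight a α ≤ 1) : α ≤ a := by
  intro i
  have hi : (α i : ℚ) / (a i : ℚ) ≤ 1 :=
    (Finset.single_le_sum (f := fun j => (α j : ℚ) / (a j : ℚ))
      (fun j _ => by positivity) (Finset.mem_univ i)).trans h
  have hpos : (0 : ℚ) < a i := by exact_mod_cast ha i
  rw [div_le_one hpos] at hi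
  exact_mod_cast hi

lemma mem_lowIdx {N : ℕ} {a α : Fin N → ℕ} (ha : ∀ i, 1 ≤ a i) :
    α ∈ lowIdx a ↔ weight a α ≤ 1 := by
  simp only [lowIdx, Finset.mem_filter, Finset.mem_Iic, and_iff_right_iff_imp]
  exact le_of_weight_le_one ha

lemma mem_topIdx {N : ℕ} {a α : Fin N → ℕ} (ha : ∀ i, 1 ≤ a i) :
    α ∈ topIdx a ↔ weight a α = 1 := by
  simp only [topIdx, Finset.mem_filter, Finset.mem_Iic, and_iff_right_iff_imp]
  exact fun h => le_of_weight_le_one ha h.le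

/-- The space `ℝ^{n × m}`, `m = #{α : ⟨α, a⁻¹⟩ = 1}`, of values of `a`-gradients: families of
columns in `ℝ^n` indexed by the multi-indices of weight one, with the Euclidean (Frobenius)
norm. -/
abbrev GradSpace {N : ℕ} (a : Fin N → ℕ) (n : ℕ) : Type :=
  PiLp 2 fun _ : topIdx a => EuclideanSpace ℝ (Fin n)

/-- The classical derivative `∂^α f = ∂₁^{α₁} ⋯ ∂_N^{α_N} f`. -/
def pderiv {N : ℕ} {V : Type*} [NormedAddCommGroup V] [NormedSpace ℝ V] (α : Fin N → ℕ)
    (f : EuclideanSpace ℝ (Fin N) → V) : EuclideanSpace ℝ (Fin N) → V :=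
  (List.finRange N).foldr
    (fun i h => (fun k x => fderiv ℝ k x (EuclideanSpace.single i (1 : ℝ)))^[α i] h) f

/-- `φ ∈ C_c^∞(U; V)`. -/
structure IsTestFunction {N : ℕ} {V : Type*} [NormedAddCommGroup V] [NormedSpace ℝ V]
    (U : Set (EuclideanSpace ℝ (Fin N))) (φ : EuclideanSpace ℝ (Fin N) → V) : Prop where
  smooth : ContDiff ℝ ∞ φ
  compact : HasCompactSupport φ
  support : tsupport φ ⊆ U

/-- `v` is the weak (distributional) derivative `∂^α u` on the open set `U`. -/
structure HasWeakDeriv {N n : ℕ} (U : Set (EuclideanSpace ℝ (Fin N))) (α : Fin N → ℕ)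
    (u v : EuclideanSpace ℝ (Fin N) → EuclideanSpace ℝ (Fin n)) : Prop where
  left : LocallyIntegrableOn u U
  right : LocallyIntegrableOn v U
  parts : ∀ φ : EuclideanSpace ℝ (Fin N) → ℝ, IsTestFunction U φ →
    ∫ x in U, pderiv α φ x • u x = (-1 : ℝ) ^ (∑ i, α i) • ∫ x in U, φ x • v x

open Classical in
/-- The weak derivative `∂^α u` on `U`, unique up to null subsets of `U`
(the value is `0` if it does not exist). -/
def weakDeriv {N n : ℕ} (U : Set (EuclideanSpace ℝ (Fin N))) (α : Fin N → ℕ)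
    (u : EuclideanSpace ℝ (Fin N) → EuclideanSpace ℝ (Fin n)) :
    EuclideanSpace ℝ (Fin N) → EuclideanSpace ℝ (Fin n) :=
  if h : ∃ v, HasWeakDeriv U α u v then h.choose else 0

/-- `u ∈ W^{a,p}(U; ℝ^n)`: all weak derivatives `∂^α u` with `⟨α, a⁻¹⟩ ≤ 1` (among them
`u` itself) exist and lie in `L^p(U)`. Only the values of `u` on `U` matter. -/
def MemW {N n : ℕ} (a : Fin N → ℕ) (p : ℝ) (U : Set (EuclideanSpace ℝ (Fin N)))
    (u : EuclideanSpace ℝ (Fin N) → EuclideanSpace ℝ (Fin n)) : Prop :=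
  ∀ α ∈ lowIdx a, ∃ v, HasWeakDeriv U α u v ∧ MemLp v (ENNReal.ofReal p) (volume.restrict U)

/-- The norm `∑_{⟨α, a⁻¹⟩ ≤ 1} ‖∂^α u‖_{L^p(U)}`. -/
def wNorm {N n : ℕ} (a : Fin N → ℕ) (p : ℝ) (U : Set (EuclideanSpace ℝ (Fin N)))
    (u : EuclideanSpace ℝ (Fin N) → EuclideanSpace ℝ (Fin n)) : ℝ≥0∞ :=
  ∑ α ∈ lowIdx a, eLpNorm (weakDeriv U α u) (ENNReal.ofReal p) (volume.restrict U)

/-- `φ ∈ W₀^{a,p}(U; ℝ^n)`: the closure of `C_c^∞(U; ℝ^n)` in the norm of `W^{a,p}(U; ℝ^n)`. -/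
def MemWZero {N n : ℕ} (a : Fin N → ℕ) (p : ℝ) (U : Set (EuclideanSpace ℝ (Fin N)))
    (φ : EuclideanSpace ℝ (Fin N) → EuclideanSpace ℝ (Fin n)) : Prop :=
  MemW a p U φ ∧ ∀ ε : ℝ≥0∞, 0 < ε → ∃ ψ : EuclideanSpace ℝ (Fin N) → EuclideanSpace ℝ (Fin n),
    IsTestFunction U ψ ∧ wNorm a p U (φ - ψ) < ε

/-- The Dirichlet class `W_g^{a,p}(Ω) = {g + φ : φ ∈ W₀^{a,p}(Ω)}`. -/
def dirichletClass {N n : ℕ} (a : Fin N → ℕ) (p : ℝ) (Ω : Set (EuclideanSpace ℝ (Fin N)))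
    (g : EuclideanSpace ℝ (Fin N) → EuclideanSpace ℝ (Fin n)) :
    Set (EuclideanSpace ℝ (Fin N) → EuclideanSpace ℝ (Fin n)) :=
  {u | ∃ φ, MemWZero a p Ω φ ∧ u = g + φ}

/-- The weak `a`-gradient `∇_a u = (∂^α u)_{⟨α, a⁻¹⟩ = 1}` on `U`. -/
def aGrad {N n : ℕ} (a : Fin N → ℕ) (U : Set (EuclideanSpace ℝ (Fin N)))
    (u : EuclideanSpace ℝ (Fin N) → EuclideanSpace ℝ (Fin n))
    (x : EuclideanSpace ℝ (Fin N)) : GradSpace a n :=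
  WithLp.toLp 2 fun α => weakDeriv U (α : Fin N → ℕ) u x

/-- The classical `a`-gradient of a smooth function. -/
def smoothAGrad {N n : ℕ} (a : Fin N → ℕ)
    (u : EuclideanSpace ℝ (Fin N) → EuclideanSpace ℝ (Fin n))
    (x : EuclideanSpace ℝ (Fin N)) : GradSpace a n :=
  WithLp.toLp 2 fun α => pderiv (α : Fin N → ℕ) u x

/-- The functional `I(u, Ω) = ∫_Ω F(∇_a u) dx`. -/
def energy {N n : ℕ} (a : Fin N → ℕ) (F : GradSpace a n → ℝ)
    (Ω : Set (EuclideanSpace ℝ (Fin N)))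
    (u : EuclideanSpace ℝ (Fin N) → EuclideanSpace ℝ (Fin n)) : ℝ :=
  ∫ x in Ω, F (aGrad a Ω u x)

/-- `‖∇_a u‖_{L^q(Ω)}` (finite for `u ∈ W^{a,p}(Ω)`, `q ≤ p`, `Ω` bounded). -/
def gradNorm {N n : ℕ} (a : Fin N → ℕ) (q : ℝ) (Ω : Set (EuclideanSpace ℝ (Fin N)))
    (u : EuclideanSpace ℝ (Fin N) → EuclideanSpace ℝ (Fin n)) : ℝ :=
  (eLpNorm (aGrad a Ω u) (ENNReal.ofReal q) (volume.restrict Ω)).toReal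

/-- `L^q` coercivity of `I(·, Ω)` on `W_g^{a,p}(Ω)`. -/
def IsCoercive {N n : ℕ} (a : Fin N → ℕ) (p q : ℝ) (F : GradSpace a n → ℝ)
    (Ω : Set (EuclideanSpace ℝ (Fin N)))
    (g : EuclideanSpace ℝ (Fin N) → EuclideanSpace ℝ (Fin n)) : Prop :=
  ∀ u : ℕ → EuclideanSpace ℝ (Fin N) → EuclideanSpace ℝ (Fin n),
    (∀ j, u j ∈ dirichletClass a p Ω g) →
    Tendsto (fun j => gradNorm a q Ω (u j)) atTop atTop →
    Tendsto (fun j => energy a F Ω (u j)) atTop atTop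

/-- `L^q` mean coercivity of `I(·, Ω)` on `W_g^{a,p}(Ω)`. -/
def IsMeanCoercive {N n : ℕ} (a : Fin N → ℕ) (p q : ℝ) (F : GradSpace a n → ℝ)
    (Ω : Set (EuclideanSpace ℝ (Fin N)))
    (g : EuclideanSpace ℝ (Fin N) → EuclideanSpace ℝ (Fin n)) : Prop :=
  ∃ C₁ C₂ : ℝ, 0 < C₁ ∧ 0 < C₂ ∧
    ∀ u ∈ dirichletClass a p Ω g, C₁ * gradNorm a q Ω u ^ q - C₂ ≤ energy a F Ω u

/-- `(u_j)` is a minimising sequence of `I(·, Ω)` in `W_g^{a,p}(Ω)`; the infimum may be `-∞`. -/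
def IsMinimisingSeq {N n : ℕ} (a : Fin N → ℕ) (p : ℝ) (F : GradSpace a n → ℝ)
    (Ω : Set (EuclideanSpace ℝ (Fin N)))
    (g : EuclideanSpace ℝ (Fin N) → EuclideanSpace ℝ (Fin n))
    (u : ℕ → EuclideanSpace ℝ (Fin N) → EuclideanSpace ℝ (Fin n)) : Prop :=
  (∀ j, u j ∈ dirichletClass a p Ω g) ∧
    Tendsto (fun j => (energy a F Ω (u j) : EReal)) atTop
      (𝓝 (⨅ v ∈ dirichletClass a p Ω g, (energy a F Ω v : EReal)))

/-- All minimising sequences of `I(·, Ω)` in `W_g^{a,p}(Ω)` are bounded in `W^{a,q}(Ω)`. -/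
def MinimisingSeqsBounded {N n : ℕ} (a : Fin N → ℕ) (p q : ℝ) (F : GradSpace a n → ℝ)
    (Ω : Set (EuclideanSpace ℝ (Fin N)))
    (g : EuclideanSpace ℝ (Fin N) → EuclideanSpace ℝ (Fin n)) : Prop :=
  ∀ u, IsMinimisingSeq a p F Ω g u → ∃ M : ℝ, ∀ j, wNorm a q Ω (u j) ≤ ENNReal.ofReal M

/-- The unit cube `Q = (-1, 1)^N`. -/
def unitCube (N : ℕ) : Set (EuclideanSpace ℝ (Fin N)) := {x | ∀ i, |x i| < 1}

/-- `G` is `a`-quasiconvex at the point `X₀`. -/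
def IsQuasiconvexAt {N n : ℕ} (a : Fin N → ℕ) (G : GradSpace a n → ℝ)
    (X₀ : GradSpace a n) : Prop :=
  ∀ φ : EuclideanSpace ℝ (Fin N) → EuclideanSpace ℝ (Fin n), IsTestFunction (unitCube N) φ →
    G X₀ ≤ ⨍ x in unitCube N, G (X₀ + smoothAGrad a φ x)

/-- A bounded open set with Lipschitz boundary: near each boundary point and for a suitable unit
vector `e`, the set is the part above the graph, in the direction `e`, of a Lipschitz function
`γ` of the component `y - ⟪e, y⟫ e` orthogonal to `e`. -/
structure IsBoundedLipschitz {N : ℕ} (Ω : Set (EuclideanSpace ℝ (Fin N))) : Prop where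
  bounded : Bornology.IsBounded Ω
  isOpen : IsOpen Ω
  lipschitz : ∀ x ∈ frontier Ω, ∃ e : EuclideanSpace ℝ (Fin N), ‖e‖ = 1 ∧
    ∃ (K : NNReal) (γ : EuclideanSpace ℝ (Fin N) → ℝ), LipschitzWith K γ ∧
      ∀ᶠ y in 𝓝 x, y ∈ Ω ↔ γ (y - inner ℝ e y • e) < inner ℝ e y

end MixedSmoothness

end

/-! Write `E(u)` for the energy `I(u, Ω)` and `D(u)` for `∫_Ω |∇_a u|^q`. The heart of the matter is
a cycle: quasiconvexity of `F - c|·|^q` at one point gives mean coercivity for all domains and data,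
hence coercivity, hence bounded minimising sequences; and bounded minimising sequences for a single
domain and datum give back the quasiconvexity.

From quasiconvexity to mean coercivity (`IsQuasiconvexAt.isMeanCoercive`): by anisotropic scaling
the inequality at `X₀` holds on a large box containing `Ω`. Up to a small error a competitor is a
test function on `Ω` plus a smooth `f` near `g`. Outside `Ω` a cut-off joins `f` to a polynomial `P`
with constant gradient `X₀`, so that the result can be tested. On `Ω` the tested field is close to
`∇_a u`, and outside it is bounded in `L^p` by the data. Hence `E - cD` is bounded below uniformly
in `u`.

From coercivity to bounded minimising sequences: on `W₀^{a,p}(Ω)` the `L^q` norm of the `a`-gradient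
controls all derivatives of weight at most one. Poincaré's inequality in one coordinate bounds the
function, and `exists_seminorm_derivProd_le` interpolates the intermediate derivatives between the
function and its pure derivatives `∂_i^{a_i}`, which are components of the `a`-gradient. The
interpolation uses only averages of translates and therefore includes `q = 1`.

From bounded minimising sequences to quasiconvexity
(`MinimisingSeqsBounded.exists_isQuasiconvexAt`): suppose that `F - c|·|^q` is nowhere quasiconvex,
for every `c > 0`. The tool is `exists_test_insertion`: rescaled bumps are placed in the cells of a
fine grid, which changes two integrals of the gradient simultaneously by controlled amounts. If `E`
were unbounded below, large bumps inserted into a competitor of very low energy would make `D` large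
and keep `E` low, giving an unbounded minimising sequence. So `E` is bounded below. As long as `D ≤
M`, violations of quasiconvexity allow `E - cD` to be lowered by a fixed amount while `D` grows by
at most one (`exists_decrease`). This cannot go on forever, so `D` crosses `M`, and then `E` has
risen by at most `c(|M| + 1)`. Taking `M = j` and `c = (j + 1)⁻²` yields a minimising sequence with
`D → ∞`. -/

noncomputable section

namespace MixedSmoothness

/-! ### Classical partial derivatives and a Leibniz bound -/

section PartialDerivatives

variable {N : ℕ} {V : Type*} [NormedAddCommGroup V] [NormedSpace ℝ V]

/-- The first order partial derivative `∂_i f`. -/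
def partialD (i : Fin N) (f : EuclideanSpace ℝ (Fin N) → V) : EuclideanSpace ℝ (Fin N) → V :=
  fun x => fderiv ℝ f x (EuclideanSpace.single i (1 : ℝ))

/-- Every multi-index is reached by adding one derivative at a time, in any order. The rules for
`pderiv` thus reduce to those for a single `partialD`, although `pderiv` fixes an order of
differentiation. -/
theorem multiIndex_induction {P : (Fin N → ℕ) → Prop} (zero : P 0)
    (step : ∀ α i, P α → P (α + Pi.single i 1)) (α : Fin N → ℕ) : P α := by
  induction hk : ∑ i, α i generalizing α with
  | zero =>
    have : α = 0 := by
      funext i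
      simpa using (Finset.sum_eq_zero_iff.1 hk) i (Finset.mem_univ i)
    exact this ▸ zero
  | succ k ih =>
    obtain ⟨i, hi⟩ : ∃ i, α i ≠ 0 := by
      by_contra! h
      simp [h] at hk
    have hα : α = (α - Pi.single i 1) + Pi.single i 1 := by
      funext j
      by_cases hj : j = i
      · subst hj; simp; omega
      · simp [hj]
    have hs : ∑ j, (α - Pi.single i 1 : Fin N → ℕ) j = k := by
      have h2 : ∑ j, α j = ∑ j, (α - Pi.single i 1 : Fin N → ℕ) j + 1 := by
        conv_lhs => rw [hα]
        simp [Finset.sum_add_distrib]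
      omega
    rw [hα]
    exact step _ i (ih _ hs)

theorem contDiff_partialD {f : EuclideanSpace ℝ (Fin N) → V} (hf : ContDiff ℝ ∞ f) (i : Fin N) :
    ContDiff ℝ ∞ (partialD i f) :=
  (hf.fderiv_right (m := ∞) (by norm_cast)).clm_apply contDiff_const

theorem contDiff_partialD_iterate {f : EuclideanSpace ℝ (Fin N) → V} (hf : ContDiff ℝ ∞ f)
    (i : Fin N) (k : ℕ) : ContDiff ℝ ∞ ((partialD i)^[k] f) := by
  induction k with
  | zero => simpa using hf
  | succ k ih => rw [Function.iterate_succ_apply']; exact contDiff_partialD ih i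

theorem partialD_comm {f : EuclideanSpace ℝ (Fin N) → V} (hf : ContDiff ℝ ∞ f) (i j : Fin N) :
    partialD i (partialD j f) = partialD j (partialD i f) := by
  funext x
  have hd : Differentiable ℝ (fderiv ℝ f) :=
    (hf.fderiv_right (m := ∞) (by norm_cast)).differentiable (by simp)
  have key : ∀ v w : EuclideanSpace ℝ (Fin N), fderiv ℝ (fun y => fderiv ℝ f y v) x w =
      fderiv ℝ (fderiv ℝ f) x w v := by
    intro v w
    rw [fderiv_clm_apply (hd x) (differentiableAt_const v)]
    simp
  have hsymm : IsSymmSndFDerivAt ℝ f x :=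
    (hf.contDiffAt (x := x)).isSymmSndFDerivAt (by simp; norm_cast)
  unfold partialD
  rw [key, key]
  exact hsymm _ _

theorem partialD_iterate_comm {f : EuclideanSpace ℝ (Fin N) → V} (hf : ContDiff ℝ ∞ f)
    (i j : Fin N) (k : ℕ) :
    (partialD j)^[k] (partialD i f) = partialD i ((partialD j)^[k] f) := by
  induction k with
  | zero => rfl
  | succ k ih =>
    rw [Function.iterate_succ_apply', Function.iterate_succ_apply', ih,
      partialD_comm (contDiff_partialD_iterate hf j k)]

theorem pderiv_eq_foldr (α : Fin N → ℕ) (f : EuclideanSpace ℝ (Fin N) → V) :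
    pderiv α f = (List.finRange N).foldr (fun i h => (partialD i)^[α i] h) f := rfl

theorem contDiff_foldr_partialD {f : EuclideanSpace ℝ (Fin N) → V} (hf : ContDiff ℝ ∞ f)
    (α : Fin N → ℕ) (l : List (Fin N)) :
    ContDiff ℝ ∞ (l.foldr (fun i h => (partialD i)^[α i] h) f) := by
  induction l with
  | nil => simpa using hf
  | cons j l ih => exact contDiff_partialD_iterate ih j _

theorem contDiff_pderiv {f : EuclideanSpace ℝ (Fin N) → V} (hf : ContDiff ℝ ∞ f)
    (α : Fin N → ℕ) : ContDiff ℝ ∞ (pderiv α f) :=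
  contDiff_foldr_partialD hf α _

/-- The extra derivative enters at the position of `i` in the list and is moved to the front by the
symmetry of second derivatives. `Nodup` ensures that it enters only once. -/
theorem foldr_partialD_add_single {f : EuclideanSpace ℝ (Fin N) → V} (hf : ContDiff ℝ ∞ f)
    (α : Fin N → ℕ) (i : Fin N) (l : List (Fin N)) (hl : l.Nodup) :
    l.foldr (fun j h => (partialD j)^[(α + Pi.single i 1 : Fin N → ℕ) j] h) f =
      if i ∈ l then partialD i (l.foldr (fun j h => (partialD j)^[α j] h) f)
      else l.foldr (fun j h => (partialD j)^[α j] h) f := by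
  induction l with
  | nil => simp
  | cons j l ih =>
    obtain ⟨hjl, hl'⟩ := List.nodup_cons.1 hl
    simp only [List.foldr_cons, ih hl']
    by_cases hij : i = j
    · subst hij
      simp [hjl, Function.iterate_succ_apply']
    · have h1 : (α + Pi.single i 1 : Fin N → ℕ) j = α j := by simp [Ne.symm hij]
      rw [h1]
      by_cases hil : i ∈ l
      · simp only [hil, if_true, List.mem_cons, or_true]
        exact partialD_iterate_comm (contDiff_foldr_partialD hf α l) i j _
      · simp [hil, hij]

@[simp] theorem pderiv_zero_index (f : EuclideanSpace ℝ (Fin N) → V) : pderiv 0 f = f := by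
  rw [pderiv_eq_foldr]
  simp

theorem pderiv_add_single {f : EuclideanSpace ℝ (Fin N) → V} (hf : ContDiff ℝ ∞ f)
    (α : Fin N → ℕ) (i : Fin N) :
    pderiv (α + Pi.single i 1) f = partialD i (pderiv α f) := by
  have := foldr_partialD_add_single hf α i (List.finRange N) (List.nodup_finRange N)
  simpa [pderiv_eq_foldr] using this

theorem pderiv_partialD {f : EuclideanSpace ℝ (Fin N) → V} (hf : ContDiff ℝ ∞ f)
    (α : Fin N → ℕ) (i : Fin N) : pderiv α (partialD i f) = partialD i (pderiv α f) := by
  induction α using multiIndex_induction with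
  | zero => simp
  | step α j ih =>
    rw [pderiv_add_single (contDiff_partialD hf i), ih, pderiv_add_single hf,
      partialD_comm (contDiff_pderiv hf α)]

theorem pderiv_add_single' {f : EuclideanSpace ℝ (Fin N) → V} (hf : ContDiff ℝ ∞ f)
    (α : Fin N → ℕ) (i : Fin N) :
    pderiv (α + Pi.single i 1) f = pderiv α (partialD i f) := by
  rw [pderiv_partialD hf, pderiv_add_single hf]

theorem partialD_add {f g : EuclideanSpace ℝ (Fin N) → V} (hf : ContDiff ℝ ∞ f)
    (hg : ContDiff ℝ ∞ g) (i : Fin N) : partialD i (f + g) = partialD i f + partialD i g := by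
  funext x
  simp only [partialD, Pi.add_apply]
  rw [fderiv_add (hf.differentiable (by simp) x) (hg.differentiable (by simp) x)]
  rfl

theorem pderiv_add {f g : EuclideanSpace ℝ (Fin N) → V} (hf : ContDiff ℝ ∞ f)
    (hg : ContDiff ℝ ∞ g) (α : Fin N → ℕ) : pderiv α (f + g) = pderiv α f + pderiv α g := by
  induction α using multiIndex_induction with
  | zero => simp
  | step α j ih =>
    rw [pderiv_add_single (f := f + g) (hf.add hg), ih, pderiv_add_single hf, pderiv_add_single hg,
      partialD_add (contDiff_pderiv hf α) (contDiff_pderiv hg α)]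

theorem partialD_const_smul {f : EuclideanSpace ℝ (Fin N) → V} (hf : ContDiff ℝ ∞ f) (c : ℝ)
    (i : Fin N) : partialD i (c • f) = c • partialD i f := by
  funext x
  simp only [partialD, Pi.smul_apply]
  rw [fderiv_const_smul (hf.differentiable (by simp) x)]
  rfl

theorem pderiv_const_smul {f : EuclideanSpace ℝ (Fin N) → V} (hf : ContDiff ℝ ∞ f) (c : ℝ)
    (α : Fin N → ℕ) : pderiv α (c • f) = c • pderiv α f := by
  induction α using multiIndex_induction with
  | zero => simp
  | step α j ih =>
    rw [pderiv_add_single (f := c • f) (hf.const_smul c), ih, pderiv_add_single hf,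
      partialD_const_smul (contDiff_pderiv hf α)]

theorem pderiv_sub {f g : EuclideanSpace ℝ (Fin N) → V} (hf : ContDiff ℝ ∞ f)
    (hg : ContDiff ℝ ∞ g) (α : Fin N → ℕ) : pderiv α (f - g) = pderiv α f - pderiv α g := by
  have h1 : f - g = f + (-1 : ℝ) • g := by funext x; simp [sub_eq_add_neg]
  have h2 : ContDiff ℝ ∞ ((-1 : ℝ) • g) := hg.const_smul (-1 : ℝ)
  rw [h1, pderiv_add hf h2, pderiv_const_smul hg]
  funext x; simp [sub_eq_add_neg]

theorem pderiv_zero (α : Fin N → ℕ) :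
    pderiv α (0 : EuclideanSpace ℝ (Fin N) → V) = 0 := by
  have := pderiv_const_smul (f := (0 : EuclideanSpace ℝ (Fin N) → V)) contDiff_const 0 α
  simpa using this

theorem pderiv_sum {ι : Type*} (s : Finset ι) {f : ι → EuclideanSpace ℝ (Fin N) → V}
    (hf : ∀ k ∈ s, ContDiff ℝ ∞ (f k)) (α : Fin N → ℕ) :
    pderiv α (∑ k ∈ s, f k) = ∑ k ∈ s, pderiv α (f k) := by
  classical
  induction s using Finset.induction_on with
  | empty => simp [pderiv_zero]
  | insert k s hk ih =>
    have h2 : ContDiff ℝ ∞ (∑ k ∈ s, f k) := by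
      have := ContDiff.sum (𝕜 := ℝ) (n := ∞) (f := f) (s := s)
        fun k hk => hf k (Finset.mem_insert_of_mem hk)
      convert this using 1
      funext x; simp
    rw [Finset.sum_insert hk, Finset.sum_insert hk,
      pderiv_add (hf k (Finset.mem_insert_self _ _)) h2,
      ih fun j hj => hf j (Finset.mem_insert_of_mem hj)]

theorem partialD_congr_nhds {f g : EuclideanSpace ℝ (Fin N) → V} {x : EuclideanSpace ℝ (Fin N)}
    (h : f =ᶠ[𝓝 x] g) (i : Fin N) : partialD i f =ᶠ[𝓝 x] partialD i g := by
  filter_upwards [h.fderiv (𝕜 := ℝ)] with y hy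
  simp [partialD, hy]

theorem pderiv_congr_nhds {f g : EuclideanSpace ℝ (Fin N) → V} (hf : ContDiff ℝ ∞ f)
    (hg : ContDiff ℝ ∞ g) {x : EuclideanSpace ℝ (Fin N)} (h : f =ᶠ[𝓝 x] g) (α : Fin N → ℕ) :
    pderiv α f =ᶠ[𝓝 x] pderiv α g := by
  induction α using multiIndex_induction with
  | zero => simpa using h
  | step α j ih =>
    rw [pderiv_add_single hf, pderiv_add_single hg]
    exact partialD_congr_nhds ih j

theorem tsupport_partialD_subset (f : EuclideanSpace ℝ (Fin N) → V) (i : Fin N) :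
    tsupport (partialD i f) ⊆ tsupport f :=
  tsupport_fderiv_apply_subset ℝ _

theorem tsupport_pderiv_subset {f : EuclideanSpace ℝ (Fin N) → V} (hf : ContDiff ℝ ∞ f)
    (α : Fin N → ℕ) : tsupport (pderiv α f) ⊆ tsupport f := by
  induction α using multiIndex_induction with
  | zero => simp
  | step α j ih =>
    rw [pderiv_add_single hf]
    exact (tsupport_partialD_subset _ j).trans ih

theorem IsTestFunction.pderiv {U : Set (EuclideanSpace ℝ (Fin N))}
    {f : EuclideanSpace ℝ (Fin N) → V} (hf : IsTestFunction U f) (α : Fin N → ℕ) :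
    IsTestFunction U (MixedSmoothness.pderiv α f) where
  smooth := contDiff_pderiv hf.smooth α
  compact := hf.compact.of_isClosed_subset (isClosed_tsupport _)
    (tsupport_pderiv_subset hf.smooth α)
  support := (tsupport_pderiv_subset hf.smooth α).trans hf.support

theorem IsTestFunction.partialD {U : Set (EuclideanSpace ℝ (Fin N))}
    {f : EuclideanSpace ℝ (Fin N) → V} (hf : IsTestFunction U f) (i : Fin N) :
    IsTestFunction U (MixedSmoothness.partialD i f) where
  smooth := contDiff_partialD hf.smooth i
  compact := hf.compact.of_isClosed_subset (isClosed_tsupport _)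
    (tsupport_partialD_subset f i)
  support := (tsupport_partialD_subset f i).trans hf.support

theorem IsTestFunction.zero (U : Set (EuclideanSpace ℝ (Fin N))) :
    IsTestFunction U (0 : EuclideanSpace ℝ (Fin N) → V) where
  smooth := contDiff_const
  compact := HasCompactSupport.zero
  support := by simp [tsupport]

theorem IsTestFunction.add {U : Set (EuclideanSpace ℝ (Fin N))}
    {f g : EuclideanSpace ℝ (Fin N) → V} (hf : IsTestFunction U f) (hg : IsTestFunction U g) :
    IsTestFunction U (f + g) where
  smooth := hf.smooth.add hg.smooth
  compact := hf.compact.add hg.compact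
  support := (tsupport_add f g).trans (Set.union_subset hf.support hg.support)

theorem IsTestFunction.const_smul {U : Set (EuclideanSpace ℝ (Fin N))}
    {f : EuclideanSpace ℝ (Fin N) → V} (hf : IsTestFunction U f) (c : ℝ) :
    IsTestFunction U (c • f) where
  smooth := hf.smooth.const_smul c
  compact := hf.compact.smul_left (f := fun _ => c)
  support := (closure_mono (Function.support_const_smul_subset c f)).trans hf.support

theorem IsTestFunction.sum {ι : Type*} {U : Set (EuclideanSpace ℝ (Fin N))} (s : Finset ι)
    {f : ι → EuclideanSpace ℝ (Fin N) → V} (hf : ∀ k ∈ s, IsTestFunction U (f k)) :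
    IsTestFunction U (∑ k ∈ s, f k) := by
  classical
  induction s using Finset.induction_on with
  | empty => simpa using IsTestFunction.zero U
  | insert k s hk ih =>
    rw [Finset.sum_insert hk]
    exact (hf k (Finset.mem_insert_self _ _)).add (ih fun j hj => hf j (Finset.mem_insert_of_mem hj))

theorem IsTestFunction.mono {U U' : Set (EuclideanSpace ℝ (Fin N))}
    {f : EuclideanSpace ℝ (Fin N) → V} (hf : IsTestFunction U f) (h : U ⊆ U') :
    IsTestFunction U' f :=
  ⟨hf.smooth, hf.compact, hf.support.trans h⟩

/-- The map `x ↦ (b_i + s_i x_i)_i`. -/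
def diagAffine (b : EuclideanSpace ℝ (Fin N)) (s : Fin N → ℝ) (x : EuclideanSpace ℝ (Fin N)) :
    EuclideanSpace ℝ (Fin N) := WithLp.toLp 2 fun i => b i + s i * x i

@[simp] theorem diagAffine_apply (b : EuclideanSpace ℝ (Fin N)) (s : Fin N → ℝ)
    (x : EuclideanSpace ℝ (Fin N)) (i : Fin N) : diagAffine b s x i = b i + s i * x i := rfl

theorem contDiff_diagAffine (b : EuclideanSpace ℝ (Fin N)) (s : Fin N → ℝ) :
    ContDiff ℝ ∞ (diagAffine b s) := by
  rw [contDiff_euclidean]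
  intro i
  simp only [diagAffine_apply]
  fun_prop

theorem partialD_comp_diagAffine {f : EuclideanSpace ℝ (Fin N) → V} (hf : ContDiff ℝ ∞ f)
    (b : EuclideanSpace ℝ (Fin N)) (s : Fin N → ℝ) (i : Fin N) :
    partialD i (f ∘ diagAffine b s) = s i • (partialD i f ∘ diagAffine b s) := by
  funext x
  have h1 : HasFDerivAt f (fderiv ℝ f (diagAffine b s x)) (diagAffine b s x) :=
    (hf.differentiable (by simp) _).hasFDerivAt
  have hd : DifferentiableAt ℝ (diagAffine b s) x :=
    (contDiff_diagAffine b s).differentiable (by simp) x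
  have h3 : fderiv ℝ (diagAffine b s) x (EuclideanSpace.single i 1) =
      s i • EuclideanSpace.single i (1 : ℝ) := by
    ext j
    have h4 : HasFDerivAt (fun y => diagAffine b s y j)
        ((EuclideanSpace.proj j : EuclideanSpace ℝ (Fin N) →L[ℝ] ℝ).comp
          (fderiv ℝ (diagAffine b s) x)) x :=
      (EuclideanSpace.proj j : EuclideanSpace ℝ (Fin N) →L[ℝ] ℝ).hasFDerivAt.comp x hd.hasFDerivAt
    have h5 : HasFDerivAt (fun y => diagAffine b s y j)
        (s j • (EuclideanSpace.proj j : EuclideanSpace ℝ (Fin N) →L[ℝ] ℝ)) x := by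
      simp only [diagAffine_apply]
      exact (((EuclideanSpace.proj j :
        EuclideanSpace ℝ (Fin N) →L[ℝ] ℝ).hasFDerivAt (x := x)).const_mul (s j)).const_add (b j)
    have h6 := congrArg (fun L => L (EuclideanSpace.single i (1 : ℝ))) (h4.unique h5)
    simp at h6
    rw [h6]
    by_cases hij : j = i
    · subst hij; simp
    · simp [hij]
  have h2 := h1.comp x hd.hasFDerivAt
  simp only [partialD, Pi.smul_apply, Function.comp_apply]
  rw [h2.fderiv, ContinuousLinearMap.comp_apply, h3, map_smul]

theorem pderiv_comp_diagAffine {f : EuclideanSpace ℝ (Fin N) → V} (hf : ContDiff ℝ ∞ f)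
    (b : EuclideanSpace ℝ (Fin N)) (s : Fin N → ℝ) (α : Fin N → ℕ) :
    pderiv α (f ∘ diagAffine b s) = (∏ i, s i ^ α i) • (pderiv α f ∘ diagAffine b s) := by
  induction α using multiIndex_induction with
  | zero => simp
  | step α j ih =>
    have hc : ContDiff ℝ ∞ (pderiv α f ∘ diagAffine b s) :=
      (contDiff_pderiv hf α).comp (contDiff_diagAffine b s)
    rw [pderiv_add_single (hf.comp (contDiff_diagAffine b s)), ih, partialD_const_smul hc,
      partialD_comp_diagAffine (contDiff_pderiv hf α), pderiv_add_single hf, smul_smul]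
    congr 1
    simp only [Pi.add_apply, pow_add, Finset.prod_mul_distrib]
    congr 1
    rw [Finset.prod_eq_single j] <;> simp +contextual

/-- Pointwise Leibniz bound for the product with a fixed test function. -/
theorem exists_norm_pderiv_smul_le (α : Fin N → ℕ) :
    ∀ η : EuclideanSpace ℝ (Fin N) → ℝ, IsTestFunction Set.univ η →
    ∃ C : ℝ, 0 ≤ C ∧ ∀ f : EuclideanSpace ℝ (Fin N) → V, ContDiff ℝ ∞ f →
      ∀ x, ‖pderiv α (fun y => η y • f y) x‖ ≤ C * ∑ β ∈ Finset.Iic α, ‖pderiv β f x‖ := by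
  induction α using multiIndex_induction with
  | zero =>
    intro η hη
    obtain ⟨C, hC⟩ := hη.compact.exists_bound_of_continuous hη.smooth.continuous
    refine ⟨max C 0, le_max_right _ _, fun f hf x => ?_⟩
    have : Finset.Iic (0 : Fin N → ℕ) = {0} := by
      ext β; simp
    rw [this]
    simp only [pderiv_zero_index, Finset.sum_singleton, norm_smul]
    gcongr
    exact (hC x).trans (le_max_left _ _)
  | step α i ih =>
    intro η hη
    -- By the product rule the new derivative falls on `f` or on `η`, so the induction hypothesis is
    -- also needed for `∂_i η`; this is why `η` is quantified after `α`.
    obtain ⟨C₁, hC₁, h₁⟩ := ih η hη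
    obtain ⟨C₂, hC₂, h₂⟩ := ih (partialD i η) (hη.partialD i)
    refine ⟨C₁ + C₂, by positivity, fun f hf x => ?_⟩
    have hηf : ContDiff ℝ ∞ (fun y => η y • f y) := hη.smooth.smul hf
    have hprod : partialD i (fun y => η y • f y) =
        (fun y => η y • partialD i f y) + fun y => partialD i η y • f y := by
      funext y
      simp only [partialD, Pi.add_apply]
      rw [fderiv_fun_smul (hη.smooth.differentiable (by simp) y) (hf.differentiable (by simp) y)]
      simp
    have hs₁ : ContDiff ℝ ∞ (fun y => η y • partialD i f y) :=
      hη.smooth.smul (contDiff_partialD hf i)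
    have hs₂ : ContDiff ℝ ∞ (fun y => partialD i η y • f y) :=
      (contDiff_partialD hη.smooth i).smul hf
    rw [pderiv_add_single' hηf, hprod, pderiv_add hs₁ hs₂]
    refine (norm_add_le _ _).trans ?_
    rw [add_mul]
    refine add_le_add ((h₁ _ (contDiff_partialD hf i) x).trans ?_) ((h₂ f hf x).trans ?_)
    · gcongr
      calc ∑ β ∈ Finset.Iic α, ‖pderiv β (partialD i f) x‖
          = ∑ β ∈ (Finset.Iic α).image (fun β => β + Pi.single i 1), ‖pderiv β f x‖ := by
            rw [Finset.sum_image fun _ _ _ _ h => by simpa using h]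
            exact Finset.sum_congr rfl fun β _ => by rw [pderiv_add_single' hf]
        _ ≤ _ := by
            refine Finset.sum_le_sum_of_subset_of_nonneg ?_ fun _ _ _ => norm_nonneg _
            intro β hβ
            simp only [Finset.mem_image, Finset.mem_Iic] at hβ ⊢
            obtain ⟨γ, hγ, rfl⟩ := hβ
            gcongr
    · gcongr
      exact le_self_add

end PartialDerivatives

/-! ### Polynomials with prescribed constant `a`-gradient -/

section Monomials

variable {N : ℕ} {V : Type*} [NormedAddCommGroup V] [NormedSpace ℝ V]

/-- The normalised monomial `x^α / α!`. -/
def monomialFn (α : Fin N → ℕ) (x : EuclideanSpace ℝ (Fin N)) : ℝ :=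
  ∏ i, x i ^ α i / ((α i).factorial : ℝ)

theorem contDiff_monomialFn (α : Fin N → ℕ) : ContDiff ℝ ∞ (monomialFn α) := by
  unfold monomialFn
  refine contDiff_prod fun i _ => ?_
  have : ContDiff ℝ ∞ fun x : EuclideanSpace ℝ (Fin N) => x i :=
    (EuclideanSpace.proj i : EuclideanSpace ℝ (Fin N) →L[ℝ] ℝ).contDiff
  exact (this.pow _).div_const _

theorem partialD_monomialFn (α : Fin N → ℕ) (i : Fin N) :
    partialD i (monomialFn α) = if α i = 0 then 0 else monomialFn (α - Pi.single i 1) := by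
  funext x
  have hd : DifferentiableAt ℝ (monomialFn α) x :=
    (contDiff_monomialFn α).differentiable (by simp) x
  set c : ℝ := ∏ j ∈ Finset.univ.erase i, x j ^ α j / ((α j).factorial : ℝ) with hc
  have h1 : ∀ t : ℝ, monomialFn α (x + t • EuclideanSpace.single i (1 : ℝ)) =
      (x i + t) ^ α i / ((α i).factorial : ℝ) * c := by
    intro t
    unfold monomialFn
    rw [← Finset.mul_prod_erase _ _ (Finset.mem_univ i)]
    congr 1
    · simp
    · refine Finset.prod_congr rfl fun j hj => ?_
      have : j ≠ i := Finset.ne_of_mem_erase hj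
      simp [this]
  have h2 : HasDerivAt (fun t : ℝ => (x i + t) ^ α i / ((α i).factorial : ℝ) * c)
      (((α i : ℝ) * (x i + 0) ^ (α i - 1) * 1) / ((α i).factorial : ℝ) * c) 0 :=
    ((((hasDerivAt_id (0 : ℝ)).const_add (x i)).pow (α i)).div_const _).mul_const c
  have h3 : partialD i (monomialFn α) x =
      ((α i : ℝ) * (x i + 0) ^ (α i - 1) * 1) / ((α i).factorial : ℝ) * c := by
    unfold partialD
    rw [← hd.lineDeriv_eq_fderiv, lineDeriv]
    simp only [h1]
    exact h2.deriv
  rw [h3]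
  by_cases h0 : α i = 0
  · simp [h0]
  · rw [if_neg h0]
    unfold monomialFn
    rw [← Finset.mul_prod_erase _ _ (Finset.mem_univ i)]
    congr 1
    · obtain ⟨k, hk⟩ := Nat.exists_eq_succ_of_ne_zero h0
      simp only [hk, Pi.sub_apply, Pi.single_eq_same, Nat.succ_eq_add_one, Nat.add_sub_cancel,
        Nat.factorial_succ]
      have : (k.factorial : ℝ) ≠ 0 := by positivity
      push_cast
      field_simp
      simp
    · refine Finset.prod_congr rfl fun j hj => ?_
      have : j ≠ i := Finset.ne_of_mem_erase hj
      simp [this]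

open Classical in
theorem pderiv_monomialFn (α β : Fin N → ℕ) :
    pderiv β (monomialFn α) = if β ≤ α then monomialFn (α - β) else 0 := by
  induction β using multiIndex_induction with
  | zero =>
    have : (0 : Fin N → ℕ) ≤ α := fun i => Nat.zero_le _
    simp [this]
  | step β i ih =>
    rw [pderiv_add_single (contDiff_monomialFn α), ih]
    by_cases h : β ≤ α
    · rw [if_pos h, partialD_monomialFn]
      by_cases h0 : (α - β) i = 0
      · have : ¬ (β + Pi.single i 1 ≤ α) := by
          intro h'
          have := h' i
          simp only [Pi.add_apply, Pi.single_eq_same, Pi.sub_apply] at this h0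
          omega
        rw [if_pos h0, if_neg this]
      · have : β + Pi.single i 1 ≤ α := by
          intro j
          have := h j
          by_cases hj : j = i
          · subst hj
            simp only [Pi.add_apply, Pi.single_eq_same, Pi.sub_apply] at h0 ⊢
            omega
          · simpa [hj] using this
        rw [if_neg h0, if_pos this]
        congr 1
        funext j
        simp only [Pi.sub_apply, Pi.add_apply]
        omega
    · have : ¬ (β + Pi.single i 1 ≤ α) := fun h' => h (le_self_add.trans h')
      rw [if_neg h, if_neg this]
      funext x
      simp [partialD]

theorem pderiv_smul_const {f : EuclideanSpace ℝ (Fin N) → ℝ} (hf : ContDiff ℝ ∞ f) (v : V)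
    (α : Fin N → ℕ) : pderiv α (fun x => f x • v) = fun x => pderiv α f x • v := by
  induction α using multiIndex_induction with
  | zero => simp
  | step α i ih =>
    have hs : ContDiff ℝ ∞ (fun x => f x • v) := hf.smul contDiff_const
    rw [pderiv_add_single hs, ih, pderiv_add_single hf]
    funext x
    simp only [partialD]
    rw [fderiv_smul_const ((contDiff_pderiv hf α).differentiable (by simp) x)]
    simp

theorem weight_lt_weight {a α β : Fin N → ℕ} (ha : ∀ i, 1 ≤ a i) (h : β ≤ α) (hne : β ≠ α) :
    weight a β < weight a α := by
  have hpos : ∀ i, (0 : ℚ) < a i := fun i => by exact_mod_cast ha i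
  obtain ⟨i, hi⟩ := Function.ne_iff.1 hne
  refine Finset.sum_lt_sum (fun j _ => ?_) ⟨i, Finset.mem_univ i, ?_⟩
  · exact div_le_div_of_nonneg_right (by exact_mod_cast h j) (hpos j).le
  · exact div_lt_div_of_pos_right (by exact_mod_cast lt_of_le_of_ne (h i) hi) (hpos i)

theorem weight_mono {a α β : Fin N → ℕ} (h : β ≤ α) : weight a β ≤ weight a α :=
  Finset.sum_le_sum fun j _ =>
    div_le_div_of_nonneg_right (by exact_mod_cast h j) (Nat.cast_nonneg _)

/-- A polynomial whose `a`-gradient is the constant `X`. -/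
theorem exists_smoothAGrad_eq_const {n : ℕ} {a : Fin N → ℕ} (ha : ∀ i, 1 ≤ a i)
    (X : GradSpace a n) : ∃ P : EuclideanSpace ℝ (Fin N) → EuclideanSpace ℝ (Fin n),
      ContDiff ℝ ∞ P ∧ ∀ x, smoothAGrad a P x = X := by
  have hs : ∀ α : topIdx a, ContDiff ℝ ∞ fun x => monomialFn (α : Fin N → ℕ) x • X α :=
    fun α => (contDiff_monomialFn (α : Fin N → ℕ)).smul contDiff_const
  refine ⟨∑ α : topIdx a, fun x => monomialFn (α : Fin N → ℕ) x • X α, ?_, fun x => ?_⟩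
  · have h := ContDiff.sum (𝕜 := ℝ) (n := ∞) (s := (Finset.univ : Finset (topIdx a)))
      (f := fun (α : topIdx a) x => monomialFn (α : Fin N → ℕ) x • X α) fun α _ => hs α
    convert h using 1
    funext x; simp
  · have hcomp : ∀ β : topIdx a, pderiv (β : Fin N → ℕ)
        (∑ α : topIdx a, fun x => monomialFn (α : Fin N → ℕ) x • X α) x = X β := by
      intro β
      rw [pderiv_sum _ fun α _ => hs α]
      simp only [Finset.sum_apply, pderiv_smul_const (contDiff_monomialFn _), pderiv_monomialFn]
      rw [Finset.sum_eq_single β]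
      · simp [monomialFn]
      · intro α _ hαβ
        -- Distinct multi-indices of equal weight are not comparable, so `∂^β` kills every monomial
        -- of weight one except `x^β / β!`, which it maps to `1`.
        have h1 : ¬ ((β : Fin N → ℕ) ≤ α) := by
          intro hle
          have h2 := weight_lt_weight ha hle fun h => hαβ (Subtype.ext h.symm)
          rw [(mem_topIdx ha).1 α.2, (mem_topIdx ha).1 β.2] at h2
          exact lt_irrefl _ h2
        rw [if_neg h1]
        simp
      · simp
    unfold smoothAGrad
    ext β : 1
    exact hcomp β

end Monomials

/-! ### Weak derivatives -/

section WeakDerivatives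

variable {N n : ℕ} {U Ω : Set (EuclideanSpace ℝ (Fin N))} {α : Fin N → ℕ}
  {u v u' v' : EuclideanSpace ℝ (Fin N) → EuclideanSpace ℝ (Fin n)}

theorem IsTestFunction.eq_zero_of_notMem {V : Type*} [NormedAddCommGroup V] [NormedSpace ℝ V]
    {φ : EuclideanSpace ℝ (Fin N) → V} (hφ : IsTestFunction U φ) {x : EuclideanSpace ℝ (Fin N)}
    (hx : x ∉ U) : φ x = 0 :=
  image_eq_zero_of_notMem_tsupport fun h => hx (hφ.support h)

theorem IsTestFunction.integrableOn_smul {φ : EuclideanSpace ℝ (Fin N) → ℝ}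
    (hφ : IsTestFunction U φ) (hu : LocallyIntegrableOn u U) :
    Integrable (fun x => φ x • u x) := by
  have h1 : IntegrableOn u (tsupport φ) := hu.integrableOn_compact_subset hφ.support hφ.compact
  have h2 : IntegrableOn (fun x => φ x • u x) (tsupport φ) :=
    h1.continuousOn_smul hφ.smooth.continuous.continuousOn hφ.compact
  refine (integrableOn_iff_integrable_of_support_subset ?_).1 h2
  exact (Function.support_smul_subset_left φ u).trans (subset_tsupport φ)

theorem IsTestFunction.setIntegral_smul {φ : EuclideanSpace ℝ (Fin N) → ℝ}
    (hφ : IsTestFunction U φ) (u : EuclideanSpace ℝ (Fin N) → EuclideanSpace ℝ (Fin n)) :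
    ∫ x in U, φ x • u x = ∫ x, φ x • u x :=
  setIntegral_eq_integral_of_forall_compl_eq_zero fun x hx => by
    rw [hφ.eq_zero_of_notMem hx, zero_smul]

/-- Test functions vanish off `U`, so both integrals may be taken over the whole space. In this
form, passing to a smaller set only shrinks the class of test functions. -/
theorem hasWeakDeriv_iff : HasWeakDeriv U α u v ↔
    LocallyIntegrableOn u U ∧ LocallyIntegrableOn v U ∧
      ∀ φ : EuclideanSpace ℝ (Fin N) → ℝ, IsTestFunction U φ →
        ∫ x, pderiv α φ x • u x = (-1 : ℝ) ^ (∑ i, α i) • ∫ x, φ x • v x := by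
  constructor
  · rintro ⟨h1, h2, h3⟩
    refine ⟨h1, h2, fun φ hφ => ?_⟩
    rw [← hφ.setIntegral_smul, ← (hφ.pderiv α).setIntegral_smul, h3 φ hφ]
  · rintro ⟨h1, h2, h3⟩
    refine ⟨h1, h2, fun φ hφ => ?_⟩
    rw [hφ.setIntegral_smul, (hφ.pderiv α).setIntegral_smul, h3 φ hφ]

theorem HasWeakDeriv.unique (hU : IsOpen U) (h : HasWeakDeriv U α u v)
    (h' : HasWeakDeriv U α u v') : v =ᵐ[volume.restrict U] v' := by
  have key : ∀ᵐ x ∂(volume : Measure (EuclideanSpace ℝ (Fin N))), x ∈ U → (v - v') x = 0 := by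
    refine hU.ae_eq_zero_of_integral_contDiff_smul_eq_zero (h.right.sub h'.right) ?_
    intro φ h1 h2 h3
    have hφ : IsTestFunction U φ := ⟨h1, h2, h3⟩
    simp only [Pi.sub_apply, smul_sub]
    rw [integral_sub (hφ.integrableOn_smul h.right) (hφ.integrableOn_smul h'.right)]
    have e1 := (hasWeakDeriv_iff.1 h).2.2 φ hφ
    have e2 := (hasWeakDeriv_iff.1 h').2.2 φ hφ
    rw [e1] at e2
    rw [smul_right_injective _ (by positivity : ((-1 : ℝ) ^ (∑ i, α i)) ≠ 0) e2, sub_self]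
  rw [Filter.EventuallyEq, ae_restrict_iff' hU.measurableSet]
  filter_upwards [key] with x hx hxU
  simpa [sub_eq_zero] using hx hxU

theorem HasWeakDeriv.weakDeriv_ae_eq (hU : IsOpen U) (h : HasWeakDeriv U α u v) :
    weakDeriv U α u =ᵐ[volume.restrict U] v := by
  have hex : ∃ v, HasWeakDeriv U α u v := ⟨v, h⟩
  unfold weakDeriv
  rw [dif_pos hex]
  exact hex.choose_spec.unique hU h

theorem HasWeakDeriv.add (h : HasWeakDeriv U α u v) (h' : HasWeakDeriv U α u' v') :
    HasWeakDeriv U α (u + u') (v + v') := by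
  rw [hasWeakDeriv_iff]
  refine ⟨h.left.add h'.left, h.right.add h'.right, fun φ hφ => ?_⟩
  simp only [Pi.add_apply, smul_add]
  rw [integral_add ((hφ.pderiv α).integrableOn_smul h.left)
      ((hφ.pderiv α).integrableOn_smul h'.left),
    integral_add (hφ.integrableOn_smul h.right) (hφ.integrableOn_smul h'.right),
    (hasWeakDeriv_iff.1 h).2.2 φ hφ, (hasWeakDeriv_iff.1 h').2.2 φ hφ, smul_add]

theorem HasWeakDeriv.sub (h : HasWeakDeriv U α u v) (h' : HasWeakDeriv U α u' v') :
    HasWeakDeriv U α (u - u') (v - v') := by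
  rw [hasWeakDeriv_iff]
  refine ⟨h.left.sub h'.left, h.right.sub h'.right, fun φ hφ => ?_⟩
  simp only [Pi.sub_apply, smul_sub]
  rw [integral_sub ((hφ.pderiv α).integrableOn_smul h.left)
      ((hφ.pderiv α).integrableOn_smul h'.left),
    integral_sub (hφ.integrableOn_smul h.right) (hφ.integrableOn_smul h'.right),
    (hasWeakDeriv_iff.1 h).2.2 φ hφ, (hasWeakDeriv_iff.1 h').2.2 φ hφ, smul_sub]

theorem HasWeakDeriv.mono (h : HasWeakDeriv U α u v) (hΩ : Ω ⊆ U) : HasWeakDeriv Ω α u v := by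
  rw [hasWeakDeriv_iff]
  exact ⟨h.left.mono_set hΩ, h.right.mono_set hΩ,
    fun φ hφ => (hasWeakDeriv_iff.1 h).2.2 φ (hφ.mono hΩ)⟩

/-- Integration by parts, one derivative and one sign at a time. The functions are quantified after
`α` because the induction hypothesis is applied to `∂_i f`. -/
theorem integral_pderiv_smul (α : Fin N → ℕ) :
    ∀ φ : EuclideanSpace ℝ (Fin N) → ℝ, IsTestFunction Set.univ φ →
    ∀ f : EuclideanSpace ℝ (Fin N) → EuclideanSpace ℝ (Fin n), ContDiff ℝ ∞ f →
      ∫ x, pderiv α φ x • f x = (-1 : ℝ) ^ (∑ i, α i) • ∫ x, φ x • pderiv α f x := by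
  have hintg : ∀ φ : EuclideanSpace ℝ (Fin N) → ℝ, IsTestFunction Set.univ φ →
      ∀ f : EuclideanSpace ℝ (Fin N) → EuclideanSpace ℝ (Fin n), ContDiff ℝ ∞ f →
      Integrable fun x => φ x • f x := fun φ hφ f hf =>
    hφ.integrableOn_smul ((hf.continuous.locallyIntegrable).locallyIntegrableOn _)
  induction α using multiIndex_induction with
  | zero => intro φ _ f _; simp
  | step α i ih =>
    intro φ hφ f hf
    have hpφ := hφ.pderiv α
    have hparts := integral_smul_fderiv_eq_neg_fderiv_smul_of_integrable (μ := volume)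
      (f := pderiv α φ) (g := f) (v := EuclideanSpace.single i (1 : ℝ))
      (hintg _ (hpφ.partialD i) f hf) (hintg _ hpφ _ (contDiff_partialD hf i)) (hintg _ hpφ f hf)
      (fun x _ => hpφ.smooth.differentiable (by simp) x)
      (fun x _ => hf.differentiable (by simp) x)
    have h1 := ih φ hφ _ (contDiff_partialD hf i)
    rw [pderiv_add_single hφ.smooth, pderiv_add_single' hf]
    change ∫ x, fderiv ℝ (pderiv α φ) x (EuclideanSpace.single i (1 : ℝ)) • f x = _
    rw [eq_neg_iff_add_eq_zero.2 ((add_comm _ _).trans (eq_neg_iff_add_eq_zero.1 hparts))]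
    change -∫ x, pderiv α φ x • partialD i f x = _
    rw [h1]
    simp [Finset.sum_add_distrib, pow_add]

theorem hasWeakDeriv_of_contDiff {f : EuclideanSpace ℝ (Fin N) → EuclideanSpace ℝ (Fin n)}
    (hf : ContDiff ℝ ∞ f) (U : Set (EuclideanSpace ℝ (Fin N))) (α : Fin N → ℕ) :
    HasWeakDeriv U α f (pderiv α f) := by
  rw [hasWeakDeriv_iff]
  exact ⟨hf.continuous.locallyIntegrable.locallyIntegrableOn _,
    (contDiff_pderiv hf α).continuous.locallyIntegrable.locallyIntegrableOn _,
    fun φ hφ => integral_pderiv_smul α φ (hφ.mono (Set.subset_univ _)) f hf⟩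

end WeakDerivatives

/-! ### Minkowski's inequality for averages -/

section Averages

theorem eLpNorm_ofReal_eq {Z W : Type*} [MeasurableSpace Z] [NormedAddCommGroup W] {p : ℝ}
    (hp : 0 < p) (κ : Measure Z) (g : Z → W) :
    eLpNorm g (ENNReal.ofReal p) κ = (∫⁻ z, ‖g z‖ₑ ^ p ∂κ) ^ (1 / p) := by
  rw [eLpNorm_eq_lintegral_rpow_enorm_toReal (by simpa using hp) ENNReal.ofReal_ne_top,
    ENNReal.toReal_ofReal hp.le]

/-- Minkowski's inequality for averages: the `L^p` norm of an average of functions is at most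
an essential bound of their `L^p` norms. -/
theorem eLpNorm_integral_le_of_ae_le {X Y W : Type*} [MeasurableSpace X] [MeasurableSpace Y]
    [NormedAddCommGroup W] [NormedSpace ℝ W] {μ : Measure X} [SFinite μ] {ν : Measure Y}
    [IsProbabilityMeasure ν] {p : ℝ} (hp : 1 ≤ p) {f : X → Y → W}
    (hf : AEStronglyMeasurable (Function.uncurry f) (μ.prod ν)) {C : ℝ≥0∞}
    (h : ∀ᵐ y ∂ν, eLpNorm (fun x => f x y) (ENNReal.ofReal p) μ ≤ C) :
    eLpNorm (fun x => ∫ y, f x y ∂ν) (ENNReal.ofReal p) μ ≤ C := by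
  have hp0 : 0 < p := by linarith
  have hpow : ∀ A B : ℝ≥0∞, A ^ (1 / p) ≤ B ↔ A ≤ B ^ p := by
    intro A B
    rw [one_div, ENNReal.rpow_inv_le_iff hp0]
  rw [eLpNorm_ofReal_eq hp0, hpow]
  have hsec : ∀ᵐ x ∂μ, AEStronglyMeasurable (fun y => f x y) ν := hf.prodMk_left
  -- Jensen's inequality for the probability measure `ν`, in the form of the monotonicity of
  -- `L^p(ν)` norms in `p`, followed by Tonelli's theorem.
  calc ∫⁻ x, ‖∫ y, f x y ∂ν‖ₑ ^ p ∂μ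
      ≤ ∫⁻ x, ∫⁻ y, ‖f x y‖ₑ ^ p ∂ν ∂μ := by
        refine lintegral_mono_ae ?_
        filter_upwards [hsec] with x hx
        have h1 : ‖∫ y, f x y ∂ν‖ₑ ≤ eLpNorm (fun y => f x y) 1 ν := by
          rw [eLpNorm_one_eq_lintegral_enorm]
          exact enorm_integral_le_lintegral_enorm _
        have h2 : eLpNorm (fun y => f x y) 1 ν ≤ eLpNorm (fun y => f x y) (ENNReal.ofReal p) ν :=
          eLpNorm_le_eLpNorm_of_exponent_le (by simpa using ENNReal.ofReal_le_ofReal hp) hx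
        have h3 := h1.trans h2
        rwa [eLpNorm_ofReal_eq hp0, ← ENNReal.rpow_le_rpow_iff hp0, ← ENNReal.rpow_mul,
          one_div_mul_cancel hp0.ne', ENNReal.rpow_one] at h3
    _ = ∫⁻ y, ∫⁻ x, ‖f x y‖ₑ ^ p ∂μ ∂ν := by
        refine lintegral_lintegral_swap ?_
        exact hf.enorm.pow_const p
    _ ≤ ∫⁻ _, C ^ p ∂ν := by
        refine lintegral_mono_ae ?_
        filter_upwards [h] with y hy
        rwa [eLpNorm_ofReal_eq hp0, hpow] at hy
    _ = C ^ p := by simp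

end Averages

/-! ### Mollification and density of smooth functions -/

section Mollification

variable {N n : ℕ}

/-- Translations act continuously on `L^p` for finite `p`; this is continuity at `0` of the orbit
map of `v`. -/
theorem exists_eLpNorm_translate_sub_le {W : Type*} [NormedAddCommGroup W] [NormedSpace ℝ W]
    {p : ℝ} (hp : 1 ≤ p)
    {v : EuclideanSpace ℝ (Fin N) → W} (hv : MemLp v (ENNReal.ofReal p)) {ε : ℝ≥0∞} (hε : 0 < ε) :
    ∃ δ > 0, ∀ y : EuclideanSpace ℝ (Fin N), ‖y‖ < δ →
      eLpNorm (fun x => v (x - y) - v x) (ENNReal.ofReal p) ≤ ε := by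
  have : Fact (1 ≤ ENNReal.ofReal p) := ⟨by simpa using ENNReal.ofReal_le_ofReal hp⟩
  have : Fact (ENNReal.ofReal p ≠ ⊤) := ⟨ENNReal.ofReal_ne_top⟩
  have hcont : Continuous fun y : EuclideanSpace ℝ (Fin N) =>
      DomAddAct.mk (-y) +ᵥ hv.toLp v := by
    have h1 : Continuous fun y : EuclideanSpace ℝ (Fin N) => DomAddAct.mk (-y) :=
      DomAddAct.continuous_mk.comp continuous_neg
    exact h1.vadd continuous_const
  have h0 := hcont.tendsto 0
  rw [EMetric.tendsto_nhds] at h0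
  obtain ⟨δ, hδ, h⟩ := Metric.eventually_nhds_iff.1 (h0 ε hε)
  refine ⟨δ, hδ, fun y hy => ?_⟩
  have h2 := (h (y := y) (by simpa using hy)).le
  rw [DomAddAct.mk_vadd_toLp, DomAddAct.mk_vadd_toLp, Lp.edist_toLp_toLp] at h2
  have h3 : (fun x => v (x - y) - v x) =
      (fun x => v (-y +ᵥ x)) - fun x => v (-(0 : EuclideanSpace ℝ (Fin N)) +ᵥ x) := by
    funext x
    simp [sub_eq_add_neg, add_comm]
  rw [h3]
  exact h2

open scoped Convolution

/-- The mollification `x ↦ ∫ ρ (x - y) v y dy`. -/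
def mollify (ρ : EuclideanSpace ℝ (Fin N) → ℝ)
    (v : EuclideanSpace ℝ (Fin N) → EuclideanSpace ℝ (Fin n)) :
    EuclideanSpace ℝ (Fin N) → EuclideanSpace ℝ (Fin n) :=
  v ⋆[(ContinuousLinearMap.lsmul ℝ ℝ).flip, volume] ρ

theorem mollify_apply (ρ : EuclideanSpace ℝ (Fin N) → ℝ)
    (v : EuclideanSpace ℝ (Fin N) → EuclideanSpace ℝ (Fin n)) (x : EuclideanSpace ℝ (Fin N)) :
    mollify ρ v x = ∫ y, ρ (x - y) • v y := rfl

theorem mollify_apply' (ρ : EuclideanSpace ℝ (Fin N) → ℝ)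
    (v : EuclideanSpace ℝ (Fin N) → EuclideanSpace ℝ (Fin n)) (x : EuclideanSpace ℝ (Fin N)) :
    mollify ρ v x = ∫ y, ρ y • v (x - y) := by
  rw [mollify_apply, ← integral_sub_left_eq_self (fun y => ρ y • v (x - y)) volume x]
  simp

theorem contDiff_mollify {ρ : EuclideanSpace ℝ (Fin N) → ℝ} (hρ : IsTestFunction Set.univ ρ)
    {v : EuclideanSpace ℝ (Fin N) → EuclideanSpace ℝ (Fin n)} (hv : LocallyIntegrable v) :
    ContDiff ℝ ∞ (mollify ρ v) :=
  hρ.compact.contDiff_convolution_right _ hv hρ.smooth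

theorem partialD_mollify {ρ : EuclideanSpace ℝ (Fin N) → ℝ} (hρ : IsTestFunction Set.univ ρ)
    {v : EuclideanSpace ℝ (Fin N) → EuclideanSpace ℝ (Fin n)} (hv : LocallyIntegrable v)
    (i : Fin N) : partialD i (mollify ρ v) = mollify (partialD i ρ) v := by
  funext x
  have h1 := hρ.compact.hasFDerivAt_convolution_right (μ := volume)
    (ContinuousLinearMap.lsmul ℝ ℝ).flip hv (hρ.smooth.of_le (by exact_mod_cast le_top)) x
  unfold partialD mollify
  rw [h1.fderiv, convolution_precompR_apply _ hv (hρ.compact.fderiv ℝ)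
    (hρ.smooth.continuous_fderiv (by simp))]

theorem pderiv_mollify {ρ : EuclideanSpace ℝ (Fin N) → ℝ} (hρ : IsTestFunction Set.univ ρ)
    {v : EuclideanSpace ℝ (Fin N) → EuclideanSpace ℝ (Fin n)} (hv : LocallyIntegrable v)
    (α : Fin N → ℕ) : pderiv α (mollify ρ v) = mollify (pderiv α ρ) v := by
  induction α using multiIndex_induction with
  | zero => simp
  | step α i ih =>
    rw [pderiv_add_single (contDiff_mollify hρ hv), ih, partialD_mollify (hρ.pderiv α) hv,
      pderiv_add_single hρ.smooth]

theorem IsTestFunction.comp_reflect {ρ : EuclideanSpace ℝ (Fin N) → ℝ}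
    (hρ : IsTestFunction Set.univ ρ) (x : EuclideanSpace ℝ (Fin N)) :
    IsTestFunction Set.univ (ρ ∘ diagAffine x fun _ => -1) where
  smooth := hρ.smooth.comp (contDiff_diagAffine _ _)
  compact := by
    have h : (diagAffine x fun _ => -1) = ⇑(Homeomorph.subLeft x) := by
      funext y; ext i; simp [sub_eq_add_neg]
    rw [h]
    exact hρ.compact.comp_homeomorph _
  support := Set.subset_univ _

/-- For fixed `x`, `y ↦ ρ (x - y)` is an admissible test function; the sign from the reflection
cancels the sign in the definition of the weak derivative. -/
theorem HasWeakDeriv.pderiv_mollify {ρ : EuclideanSpace ℝ (Fin N) → ℝ}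
    (hρ : IsTestFunction Set.univ ρ) {α : Fin N → ℕ}
    {u v : EuclideanSpace ℝ (Fin N) → EuclideanSpace ℝ (Fin n)}
    (h : HasWeakDeriv Set.univ α u v) : pderiv α (mollify ρ u) = mollify ρ v := by
  rw [MixedSmoothness.pderiv_mollify hρ (locallyIntegrableOn_univ.1 h.left)]
  funext x
  have h1 := (hasWeakDeriv_iff.1 h).2.2 _ (hρ.comp_reflect x)
  rw [pderiv_comp_diagAffine hρ.smooth] at h1
  have hx : ∀ y, diagAffine x (fun _ => -1) y = x - y := by
    intro y; ext i; simp [sub_eq_add_neg]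
  simp only [Pi.smul_apply, Function.comp_apply, hx, smul_assoc, integral_smul,
    Finset.prod_pow_eq_pow_sum] at h1
  rw [mollify_apply, mollify_apply]
  exact smul_right_injective _ (by positivity : ((-1 : ℝ) ^ (∑ i, α i)) ≠ 0) h1

/-- Let the mollifier be the density of a probability measure. Then `mollify ρ v - v` is an average
of the increments `v (x - y) - v x` with `‖y‖ < rOut`, and Minkowski's inequality for averages
reduces the claim to the continuity of translations. -/
theorem exists_eLpNorm_mollify_sub_le {p : ℝ} (hp : 1 ≤ p)
    {v : EuclideanSpace ℝ (Fin N) → EuclideanSpace ℝ (Fin n)}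
    (hv : MemLp v (ENNReal.ofReal p)) {ε : ℝ≥0∞} (hε : 0 < ε) :
    ∃ δ > 0, ∀ ρ : ContDiffBump (0 : EuclideanSpace ℝ (Fin N)), ρ.rOut < δ →
      eLpNorm (mollify (ρ.normed volume) v - v) (ENNReal.ofReal p) ≤ ε := by
  obtain ⟨δ, hδ, h⟩ := exists_eLpNorm_translate_sub_le hp hv hε
  refine ⟨δ, hδ, fun ρ hρ => ?_⟩
  have hloc : LocallyIntegrable v :=
    hv.locallyIntegrable (by simpa using ENNReal.ofReal_le_ofReal hp)
  set r : EuclideanSpace ℝ (Fin N) → ℝ := ρ.normed volume with hr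
  have hrm : Measurable r := ρ.continuous_normed.measurable
  have hrnn : ∀ y, 0 ≤ r y := ρ.nonneg_normed
  set ν : Measure (EuclideanSpace ℝ (Fin N)) := volume.withDensity fun y => ENNReal.ofReal (r y)
    with hν
  have hνint : ∀ f : EuclideanSpace ℝ (Fin N) → EuclideanSpace ℝ (Fin n),
      ∫ y, f y ∂ν = ∫ y, r y • f y := by
    intro f
    rw [hν, integral_withDensity_eq_integral_toReal_smul (by fun_prop) (by simp)]
    simp [ENNReal.toReal_ofReal, hrnn]
  have : IsProbabilityMeasure ν := by
    constructor
    rw [hν, withDensity_apply _ MeasurableSet.univ, Measure.restrict_univ,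
      ← ofReal_integral_eq_lintegral_ofReal ρ.integrable_normed (Eventually.of_forall hrnn),
      ρ.integral_normed]
    simp
  have hform : mollify r v - v = fun x => ∫ y, (v (x - y) - v x) ∂ν := by
    funext x
    have hi : Integrable fun y => r y • v (x - y) := by
      have h1 := (ρ.hasCompactSupport_normed (μ := volume)).convolutionExists_left
        (ContinuousLinearMap.lsmul ℝ ℝ) ρ.continuous_normed hloc x
      exact h1
    have hi2 : Integrable fun y => r y • v x := ρ.integrable_normed.smul_const (v x)
    rw [hνint]
    simp only [smul_sub]
    rw [integral_sub hi hi2, integral_smul_const, ρ.integral_normed, one_smul, Pi.sub_apply,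
      mollify_apply']
  rw [hform]
  refine eLpNorm_integral_le_of_ae_le hp ?_ ?_
  · have habs : ν ≪ volume := withDensity_absolutelyContinuous _ _
    have hm1 : AEStronglyMeasurable
        (fun z : EuclideanSpace ℝ (Fin N) × EuclideanSpace ℝ (Fin N) => v (z.1 - z.2))
        (volume.prod ν) := by
      have h2 : AEStronglyMeasurable
          (fun z : EuclideanSpace ℝ (Fin N) × EuclideanSpace ℝ (Fin N) => v (z.1 - z.2))
          (volume.prod volume) :=
        hv.1.comp_quasiMeasurePreserving (quasiMeasurePreserving_sub volume volume)
      exact h2.mono_ac (Measure.AbsolutelyContinuous.rfl.prod habs)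
    exact hm1.sub hv.1.comp_fst
  · have hball : ∀ᵐ y ∂ν, y ∈ Metric.ball (0 : EuclideanSpace ℝ (Fin N)) ρ.rOut := by
      rw [hν, ae_withDensity_iff (by fun_prop)]
      refine Eventually.of_forall fun y hy => ?_
      rw [← ρ.support_normed_eq (μ := volume)]
      intro h0
      apply hy
      simp [hr, h0]
    filter_upwards [hball] with y hy
    exact h y (by simpa using (Metric.mem_ball.1 hy).trans hρ)

theorem zero_mem_lowIdx (a : Fin N → ℕ) : (0 : Fin N → ℕ) ∈ lowIdx a := by
  rw [lowIdx, Finset.mem_filter, Finset.mem_Iic]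
  exact ⟨fun i => Nat.zero_le _, by simp [weight]⟩

/-- Smooth functions are dense in `W^{a,p}(ℝ^N)`. -/
theorem MemW.exists_contDiff_approx {a : Fin N → ℕ} {p : ℝ} (hp : 1 ≤ p)
    {g : EuclideanSpace ℝ (Fin N) → EuclideanSpace ℝ (Fin n)} (hg : MemW a p Set.univ g)
    {ε : ℝ≥0∞} (hε : 0 < ε) :
    ∃ f : EuclideanSpace ℝ (Fin N) → EuclideanSpace ℝ (Fin n), ContDiff ℝ ∞ f ∧
      ∀ α ∈ lowIdx a, MemLp (pderiv α f) (ENNReal.ofReal p) ∧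
        eLpNorm (pderiv α f - weakDeriv Set.univ α g) (ENNReal.ofReal p) ≤ ε := by
  choose! v hv hvp using hg
  have hp0 : ∀ α ∈ lowIdx a, MemLp (v α) (ENNReal.ofReal p) := fun α hα => by
    simpa using hvp α hα
  -- A single radius must serve all derivatives at once. The bound `1` in the minimum makes the
  -- differences, and hence the mollified derivatives, elements of `L^p` even when `ε` is infinite.
  have hδ : ∀ α, ∃ δ > 0, α ∈ lowIdx a → ∀ ρ : ContDiffBump (0 : EuclideanSpace ℝ (Fin N)),
      ρ.rOut < δ → eLpNorm (mollify (ρ.normed volume) (v α) - v α) (ENNReal.ofReal p) ≤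
        min ε 1 := by
    intro α
    by_cases hα : α ∈ lowIdx a
    · obtain ⟨δ, h1, h2⟩ := exists_eLpNorm_mollify_sub_le hp (hp0 α hα)
        (ε := min ε 1) (lt_min hε one_pos)
      exact ⟨δ, h1, fun _ => h2⟩
    · exact ⟨1, one_pos, fun h => absurd h hα⟩
  choose δ hδ0 hδ using hδ
  obtain ⟨r, hr0, hr⟩ : ∃ r > 0, ∀ α ∈ lowIdx a, r < δ α := by
    have h1 : ∀ᶠ r in 𝓝[>] (0 : ℝ), ∀ α ∈ lowIdx a, r < δ α := by
      rw [Filter.eventually_all_finset]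
      intro α _
      exact (eventually_lt_nhds (hδ0 α)).filter_mono nhdsWithin_le_nhds
    obtain ⟨r, h2, h3⟩ := (h1.and self_mem_nhdsWithin).exists
    exact ⟨r, h3, h2⟩
  let ρ : ContDiffBump (0 : EuclideanSpace ℝ (Fin N)) := ⟨r / 2, r, by positivity, by linarith⟩
  have hρ : IsTestFunction Set.univ (ρ.normed volume) :=
    ⟨ρ.contDiff_normed, ρ.hasCompactSupport_normed, Set.subset_univ _⟩
  have hgl : LocallyIntegrable g := locallyIntegrableOn_univ.1 (hv 0 (zero_mem_lowIdx a)).left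
  refine ⟨mollify (ρ.normed volume) g, contDiff_mollify hρ hgl, fun α hα => ?_⟩
  rw [(hv α hα).pderiv_mollify hρ]
  have hle := hδ α hα ρ (hr α hα)
  have hae : weakDeriv Set.univ α g =ᵐ[volume] v α := by
    simpa using (hv α hα).weakDeriv_ae_eq isOpen_univ
  have hmem : MemLp (mollify (ρ.normed volume) (v α)) (ENNReal.ofReal p) := by
    have hc : AEStronglyMeasurable (mollify (ρ.normed volume) (v α)) volume :=
      (contDiff_mollify hρ (locallyIntegrableOn_univ.1 (hv α hα).right)).continuous.aestronglyMeasurable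
    have h1 : MemLp (mollify (ρ.normed volume) (v α) - v α) (ENNReal.ofReal p) :=
      ⟨hc.sub (hp0 α hα).1, hle.trans_lt ((min_le_right _ _).trans_lt ENNReal.one_lt_top)⟩
    simpa using h1.add (hp0 α hα)
  refine ⟨hmem, ?_⟩
  rw [eLpNorm_congr_ae (EventuallyEq.rfl.sub hae)]
  exact hle.trans (min_le_left _ _)

end Mollification

/-! ### Abstract anisotropic interpolation -/

section Interpolation

variable {X : Type*} [AddCommGroup X] [Module ℝ X]

theorem commute_list_prod_right {M ι : Type*} [Monoid M] {x : M} {s : ι → M} (l : List ι)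
    (h : ∀ i, Commute x (s i)) : Commute x (l.map s).prod := by
  induction l with
  | nil => simp
  | cons i l ih => rw [List.map_cons, List.prod_cons]; exact (h i).mul_right ih

/-- The smoothing operator `1 - (1 - B^k)^k` built from an averaging operator `B`; it reproduces
functions up to an error of order `k`. -/
def smoothOp (B : Module.End ℝ X) (k : ℕ) : Module.End ℝ X := 1 - (1 - B ^ k) ^ k

theorem commute_smoothOp {B T : Module.End ℝ X} (h : Commute T B) (k : ℕ) :
    Commute T (smoothOp B k) :=
  (Commute.one_right T).sub_right (((Commute.one_right T).sub_right (h.pow_right k)).pow_right k)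

theorem seminorm_pow_apply_le (ν : Seminorm ℝ X) {T : Module.End ℝ X} {c : ℝ} (hc : 0 ≤ c)
    (hT : ∀ f, ν (T f) ≤ c * ν f) (k : ℕ) (f : X) : ν ((T ^ k) f) ≤ c ^ k * ν f := by
  induction k with
  | zero => simp
  | succ k ih =>
    rw [pow_succ', Module.End.mul_apply]
    calc ν (T ((T ^ k) f)) ≤ c * ν ((T ^ k) f) := hT _
      _ ≤ c * (c ^ k * ν f) := by gcongr
      _ = c ^ (k + 1) * ν f := by ring

section OneDirection

variable {ν : Seminorm ℝ X} {D B : Module.End ℝ X} {h : ℝ}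

theorem seminorm_pow_le (hB : ∀ f, ν (B f) ≤ ν f) (k : ℕ) (f : X) : ν ((B ^ k) f) ≤ ν f := by
  simpa using seminorm_pow_apply_le ν zero_le_one (fun f => by simpa using hB f) k f

theorem seminorm_one_sub_pow_le (hB : ∀ f, ν (B f) ≤ ν f) (k : ℕ) (f : X) :
    ν ((1 - B ^ k) f) ≤ 2 * ν f := by
  have h1 : (1 - B ^ k) f = f - (B ^ k) f := rfl
  rw [h1]
  have := map_sub_le_add ν f ((B ^ k) f)
  linarith [seminorm_pow_le hB k f]

theorem seminorm_one_sub_pow_le_deriv (hB : ∀ f, ν (B f) ≤ ν f)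
    (hI : ∀ f, ν (f - B f) ≤ h * ν (D f)) (k : ℕ) (f : X) :
    ν ((1 - B ^ k) f) ≤ k * h * ν (D f) := by
  induction k with
  | zero => simp
  | succ k ih =>
    have h1 : (1 - B ^ (k + 1)) f = (1 - B ^ k) f + (B ^ k) (f - B f) := by
      have : (1 - B ^ (k + 1)) = (1 - B ^ k) + B ^ k * (1 - B) := by
        rw [pow_succ]; noncomm_ring
      rw [this]; rfl
    rw [h1]
    refine (map_add_le_add ν _ _).trans ?_
    have := (seminorm_pow_le hB k (f - B f)).trans (hI f)
    push_cast
    linarith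

/-- The error is `(1 - B^k)^k f`. Each of the `k` factors gains `k h` at the price of one
derivative, which commutes with the remaining factors. -/
theorem seminorm_sub_smoothOp_le (hDB : Commute D B) (hh : 0 ≤ h) (hB : ∀ f, ν (B f) ≤ ν f)
    (hI : ∀ f, ν (f - B f) ≤ h * ν (D f)) (k : ℕ) (f : X) :
    ν (f - smoothOp B k f) ≤ (k * h) ^ k * ν ((D ^ k) f) := by
  have h1 : f - smoothOp B k f = ((1 - B ^ k) ^ k) f := by
    simp [smoothOp]
  rw [h1]
  have hcomm : Commute D (1 - B ^ k) := (Commute.one_right D).sub_right (hDB.pow_right k)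
  have key : ∀ j : ℕ, ν (((1 - B ^ k) ^ j) f) ≤ (k * h) ^ j * ν ((D ^ j) f) := by
    intro j
    induction j generalizing f with
    | zero => simp
    | succ j ih =>
      rw [pow_succ, Module.End.mul_apply, pow_succ D]
      refine (ih ((1 - B ^ k) f) ?_).trans ?_
      · simp [smoothOp]
      have h2 : (D ^ j) ((1 - B ^ k) f) = (1 - B ^ k) ((D ^ j) f) := by
        rw [← Module.End.mul_apply, (hcomm.pow_left j).eq, Module.End.mul_apply]
      rw [h2, pow_succ, mul_assoc]
      gcongr
      refine (seminorm_one_sub_pow_le_deriv hB hI k _).trans (le_of_eq ?_)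
      rw [← Module.End.mul_apply, ← pow_succ', pow_succ]
  exact key k

/-- Each derivative is paired with one average: `D B` has norm at most `2 / h`, and the averages
left over are contractions. -/
theorem seminorm_pow_mul_pow_le (hDB : Commute D B) (hh : 0 < h) (hB : ∀ f, ν (B f) ≤ ν f)
    (hS : ∀ f, ν (D (B f)) ≤ 2 / h * ν f) {j k : ℕ} (hjk : j ≤ k) (f : X) :
    ν ((D ^ j) ((B ^ k) f)) ≤ (2 / h) ^ j * ν f := by
  have h1 : D ^ j * B ^ k = (D * B) ^ j * B ^ (k - j) := by
    rw [hDB.mul_pow, mul_assoc, ← pow_add, Nat.add_sub_cancel' hjk]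
  rw [← Module.End.mul_apply, h1, Module.End.mul_apply]
  refine (seminorm_pow_apply_le ν (by positivity) (fun f => hS f) j _).trans ?_
  gcongr
  exact seminorm_pow_le hB _ f

/-- By the geometric sum `B^k` is a factor of `smoothOp B k`, so there are enough averages to absorb
up to `k` derivatives; the cofactor has norm at most `2^k`. -/
theorem seminorm_pow_smoothOp_le (hDB : Commute D B) (hh : 0 < h) (hB : ∀ f, ν (B f) ≤ ν f)
    (hS : ∀ f, ν (D (B f)) ≤ 2 / h * ν f) {j k : ℕ} (hjk : j ≤ k) (f : X) :
    ν ((D ^ j) (smoothOp B k f)) ≤ 4 ^ k * h⁻¹ ^ j * ν f := by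
  have h1 : smoothOp B k = B ^ k * ∑ i ∈ Finset.range k, (1 - B ^ k) ^ i := by
    have := mul_neg_geom_sum (1 - B ^ k) k
    rw [smoothOp, ← this]
    congr 1
    noncomm_ring
  have h2 : ν ((∑ i ∈ Finset.range k, (1 - B ^ k) ^ i) f) ≤ 2 ^ k * ν f := by
    rw [LinearMap.sum_apply]
    refine (Finset.le_sum_of_subadditive ν (map_zero ν).le (map_add_le_add ν) _ _).trans ?_
    calc ∑ i ∈ Finset.range k, ν (((1 - B ^ k) ^ i) f)
        ≤ ∑ i ∈ Finset.range k, 2 ^ i * ν f :=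
          Finset.sum_le_sum fun i _ => seminorm_pow_apply_le ν (by norm_num)
            (fun f => seminorm_one_sub_pow_le hB k f) i f
      _ = (2 ^ k - 1) * ν f := by
          rw [← Finset.sum_mul, geom_sum_eq (by norm_num)]
          norm_num
      _ ≤ 2 ^ k * ν f := by
          gcongr
          linarith
  rw [h1, Module.End.mul_apply]
  refine (seminorm_pow_mul_pow_le hDB hh hB hS hjk _).trans ?_
  calc (2 / h) ^ j * ν ((∑ i ∈ Finset.range k, (1 - B ^ k) ^ i) f)
      ≤ (2 / h) ^ j * (2 ^ k * ν f) := by gcongr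
    _ = 2 ^ j * 2 ^ k * h⁻¹ ^ j * ν f := by
        rw [div_eq_mul_inv, mul_pow]; ring
    _ ≤ 2 ^ k * 2 ^ k * h⁻¹ ^ j * ν f := by
        gcongr
        norm_num
    _ = 4 ^ k * h⁻¹ ^ j * ν f := by
        rw [← mul_pow]; norm_num

end OneDirection

section AllDirections

variable {N : ℕ} {ν : Seminorm ℝ X} {D : Fin N → Module.End ℝ X}
  {B : Fin N → ℝ → Module.End ℝ X} {a : Fin N → ℕ}

/-- The anisotropic smoothing operator at scale `t`. -/
def anisoSmooth (B : Fin N → ℝ → Module.End ℝ X) (a : Fin N → ℕ) (l : List (Fin N)) (t : ℝ) :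
    Module.End ℝ X :=
  (l.map fun i => smoothOp (B i (t ^ ((a i : ℝ)⁻¹))) (a i)).prod

/-- The operator `∏_{i ∈ l} D_i^{α_i}`. -/
def derivProd (D : Fin N → Module.End ℝ X) (l : List (Fin N)) (α : Fin N → ℕ) : Module.End ℝ X :=
  (l.map fun i => D i ^ α i).prod

theorem commute_anisoSmooth {T : Module.End ℝ X} (h : ∀ i s, Commute T (B i s))
    (l : List (Fin N)) (t : ℝ) : Commute T (anisoSmooth B a l t) :=
  commute_list_prod_right l fun i => commute_smoothOp (h i _) _

/-- The directions are treated one by one: the smoothing factor of direction `i` is commuted past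
the other derivatives until it meets `D_i^{α_i}`, which it can absorb because `α_i ≤ a_i`. -/
theorem seminorm_derivProd_anisoSmooth_le (hDB : ∀ i j s, Commute (D i) (B j s))
    (hB : ∀ i s f, 0 < s → ν (B i s f) ≤ ν f)
    (hS : ∀ i s f, 0 < s → ν (D i (B i s f)) ≤ 2 / s * ν f) {t : ℝ} (ht : 0 < t)
    {α : Fin N → ℕ} (hα : ∀ i, α i ≤ a i) (l : List (Fin N)) (f : X) :
    ν (derivProd D l α (anisoSmooth B a l t f)) ≤
      (l.map fun i => (4 : ℝ) ^ a i).prod * (l.map fun i => (t ^ ((a i : ℝ)⁻¹))⁻¹ ^ α i).prod *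
        ν f := by
  induction l with
  | nil => simp [derivProd, anisoSmooth]
  | cons i l ih =>
    have hti : 0 < t ^ ((a i : ℝ)⁻¹) := by positivity
    set s := smoothOp (B i (t ^ ((a i : ℝ)⁻¹))) (a i) with hs
    have h1 : anisoSmooth B a (i :: l) t = s * anisoSmooth B a l t := by
      simp [anisoSmooth, hs]
    have h2 : derivProd D (i :: l) α = D i ^ α i * derivProd D l α := by
      simp [derivProd]
    have hcomm : Commute s (derivProd D l α) :=
      commute_list_prod_right l fun j =>
        ((commute_smoothOp (hDB j i _) (a i)).pow_left (α j)).symm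
    have h3 : derivProd D (i :: l) α (anisoSmooth B a (i :: l) t f) =
        (D i ^ α i) (s (derivProd D l α (anisoSmooth B a l t f))) := by
      rw [h1, h2, ← Module.End.mul_apply, ← Module.End.mul_apply, ← Module.End.mul_apply,
        mul_assoc (D i ^ α i), ← mul_assoc (derivProd D l α), ← hcomm.eq]
      simp only [mul_assoc]
      rfl
    rw [h3]
    refine (seminorm_pow_smoothOp_le (hDB i i _) hti (fun f => hB i _ f hti)
      (fun f => hS i _ f hti) (hα i) _).trans ?_
    rw [List.map_cons, List.prod_cons, List.map_cons, List.prod_cons]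
    calc _ ≤ 4 ^ a i * (t ^ ((a i : ℝ)⁻¹))⁻¹ ^ α i * ((l.map fun i => (4 : ℝ) ^ a i).prod *
          (l.map fun i => (t ^ ((a i : ℝ)⁻¹))⁻¹ ^ α i).prod * ν f) := by gcongr
      _ = _ := by ring

/-- Telescoping, `f - s S f = (f - s f) + s (f - S f)`. The length `t^{1/a_i}` in direction `i` is
chosen so that every direction contributes an error of order `t`. -/
theorem seminorm_sub_anisoSmooth_le (hDB : ∀ i j s, Commute (D i) (B j s))
    (ha : ∀ i, 1 ≤ a i) (hB : ∀ i s f, 0 < s → ν (B i s f) ≤ ν f)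
    (hS : ∀ i s f, 0 < s → ν (D i (B i s f)) ≤ 2 / s * ν f)
    (hI : ∀ i s f, 0 < s → ν (f - B i s f) ≤ s * ν (D i f)) {t : ℝ} (ht : 0 < t)
    (l : List (Fin N)) (f : X) :
    ν (f - anisoSmooth B a l t f) ≤
      (l.map fun i => (4 : ℝ) ^ a i).prod * (t * (l.map fun i => (a i : ℝ) ^ a i *
        ν ((D i ^ a i) f)).sum) := by
  induction l with
  | nil => simp [anisoSmooth]
  | cons i l ih =>
    have hti : 0 < t ^ ((a i : ℝ)⁻¹) := by positivity
    have hai : (a i : ℝ) ≠ 0 := by have := ha i; positivity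
    set s := smoothOp (B i (t ^ ((a i : ℝ)⁻¹))) (a i) with hs
    have h1 : f - anisoSmooth B a (i :: l) t f =
        (f - s f) + s (f - anisoSmooth B a l t f) := by
      have : anisoSmooth B a (i :: l) t = s * anisoSmooth B a l t := by
        simp [anisoSmooth, hs]
      rw [this, Module.End.mul_apply, map_sub]
      abel
    have h2 : ν (f - s f) ≤ t * ((a i : ℝ) ^ a i * ν ((D i ^ a i) f)) := by
      refine (seminorm_sub_smoothOp_le (hDB i i _) hti.le (fun f => hB i _ f hti)
        (fun f => hI i _ f hti) (a i) f).trans (le_of_eq ?_)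
      rw [mul_pow, ← Real.rpow_natCast (t ^ ((a i : ℝ)⁻¹)), ← Real.rpow_mul ht.le,
        inv_mul_cancel₀ hai, Real.rpow_one]
      ring
    have h3 : ν (s (f - anisoSmooth B a l t f)) ≤ 4 ^ a i * ν (f - anisoSmooth B a l t f) := by
      simpa using seminorm_pow_smoothOp_le (j := 0) (hDB i i _) hti (fun f => hB i _ f hti)
        (fun f => hS i _ f hti) (Nat.zero_le (a i)) (f - anisoSmooth B a l t f)
    have h4 : (1 : ℝ) ≤ 4 ^ a i := one_le_pow₀ (by norm_num)
    have h5 : (1 : ℝ) ≤ (l.map fun i => (4 : ℝ) ^ a i).prod :=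
      List.one_le_prod fun x hx => by
        obtain ⟨j, _, rfl⟩ := List.mem_map.1 hx
        exact one_le_pow₀ (by norm_num)
    have h6 : (1 : ℝ) ≤ 4 ^ a i * (l.map fun i => (4 : ℝ) ^ a i).prod := by nlinarith
    rw [h1, List.map_cons, List.prod_cons, List.map_cons, List.sum_cons]
    refine (map_add_le_add ν _ _).trans ?_
    have h7 : 0 ≤ t * ((a i : ℝ) ^ a i * ν ((D i ^ a i) f)) := by positivity
    calc ν (f - s f) + ν (s (f - anisoSmooth B a l t f))
        ≤ 4 ^ a i * (l.map fun i => (4 : ℝ) ^ a i).prod *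
            (t * ((a i : ℝ) ^ a i * ν ((D i ^ a i) f))) +
          4 ^ a i * ((l.map fun i => (4 : ℝ) ^ a i).prod *
            (t * (l.map fun i => (a i : ℝ) ^ a i * ν ((D i ^ a i) f)).sum)) := by
          refine add_le_add (h2.trans (le_mul_of_one_le_left h7 h6)) (h3.trans ?_)
          gcongr
      _ = _ := by ring

/-- Abstract anisotropic interpolation: a mixed derivative of weighted order less than one is
controlled by the function and its pure derivatives of weighted order one. -/
theorem exists_seminorm_derivProd_le (hBB : ∀ i j s r, Commute (B i s) (B j r))
    (hDB : ∀ i j s, Commute (D i) (B j s))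
    (ha : ∀ i, 1 ≤ a i) (hB : ∀ i s f, 0 < s → ν (B i s f) ≤ ν f)
    (hS : ∀ i s f, 0 < s → ν (D i (B i s f)) ≤ 2 / s * ν f)
    (hI : ∀ i s f, 0 < s → ν (f - B i s f) ≤ s * ν (D i f))
    {α : Fin N → ℕ} (hα : ∑ i, (α i : ℝ) / a i < 1) :
    ∃ C : ℝ, 0 ≤ C ∧ ∀ f, ν (derivProd D (List.finRange N) α f) ≤
      C * (ν f + ∑ i, ν ((D i ^ a i) f)) := by
  set l := List.finRange N with hl
  set Dα := derivProd D l α with hDα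
  set S : ℝ → Module.End ℝ X := anisoSmooth B a l with hSdef
  set w : ℝ := ∑ i, (α i : ℝ) / a i with hw
  set A : X → ℝ := fun f => ∑ i, ν ((D i ^ a i) f) with hA
  have hA0 : ∀ f, 0 ≤ A f := fun f => Finset.sum_nonneg fun i _ => apply_nonneg ν _
  have hapos : ∀ i, (0 : ℝ) < a i := fun i => by exact_mod_cast ha i
  have hαa : ∀ i, α i ≤ a i := by
    intro i
    have h1 : (α i : ℝ) / a i ≤ w :=
      Finset.single_le_sum (f := fun j => (α j : ℝ) / a j) (fun j _ => by positivity)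
        (Finset.mem_univ i)
    have h2 := (div_lt_one (hapos i)).1 (h1.trans_lt hα)
    exact_mod_cast h2.le
  have hprod : ∀ g : Fin N → ℝ, (l.map g).prod = ∏ i, g i := fun g => by
    rw [hl, ← List.ofFn_eq_map, List.prod_ofFn]
  have hsum : ∀ g : Fin N → ℝ, (l.map g).sum = ∑ i, g i := fun g => by
    rw [hl, ← List.ofFn_eq_map, List.sum_ofFn]
  set P : ℝ := ∏ i, (4 : ℝ) ^ a i with hP
  have hP0 : 0 ≤ P := by positivity
  have hbound : ∀ t f, 0 < t → ν (S t f) ≤ P * ν f := by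
    intro t f ht
    have := seminorm_derivProd_anisoSmooth_le (α := 0) hDB hB hS ht
      (fun i => Nat.zero_le (a i)) l f
    simpa [derivProd, hprod] using this
  have hderiv : ∀ t f, 0 < t → ν (Dα (S t f)) ≤ P * t ^ (-w) * ν f := by
    intro t f ht
    have h1 := seminorm_derivProd_anisoSmooth_le hDB hB hS ht hαa l f
    rw [hprod, hprod] at h1
    have h2 : ∏ i, (t ^ ((a i : ℝ)⁻¹))⁻¹ ^ α i = t ^ (-w) := by
      rw [hw, ← Finset.sum_neg_distrib, Real.rpow_sum_of_pos ht]
      refine Finset.prod_congr rfl fun i _ => ?_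
      rw [← Real.rpow_neg ht.le, ← Real.rpow_natCast, ← Real.rpow_mul ht.le]
      congr 1
      field_simp
    rwa [h2] at h1
  obtain ⟨K, hK0, happrox⟩ : ∃ K : ℝ, 0 ≤ K ∧ ∀ t f, 0 < t → ν (f - S t f) ≤ K * t * A f := by
    refine ⟨P * ∑ i, (a i : ℝ) ^ a i, by positivity, fun t f ht => ?_⟩
    have h1 := seminorm_sub_anisoSmooth_le hDB ha hB hS hI ht l f
    rw [hprod, hsum] at h1
    refine h1.trans ?_
    have h2 : ∑ i, (a i : ℝ) ^ a i * ν ((D i ^ a i) f) ≤ (∑ i, (a i : ℝ) ^ a i) * A f := by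
      rw [Finset.sum_mul]
      refine Finset.sum_le_sum fun i _ => ?_
      gcongr
      exact Finset.single_le_sum (f := fun j => ν ((D j ^ a j) f))
        (fun j _ => apply_nonneg ν _) (Finset.mem_univ i)
    calc P * (t * ∑ i, (a i : ℝ) ^ a i * ν ((D i ^ a i) f))
        ≤ P * (t * ((∑ i, (a i : ℝ) ^ a i) * A f)) := by gcongr
      _ = _ := by ring
  have hSD : ∀ t, Commute Dα (S t) := fun t =>
    commute_anisoSmooth (fun i s => Commute.symm <| commute_list_prod_right l fun j =>
      ((hDB j i s).pow_left _).symm) l t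
  have hSS : ∀ t t', Commute (S t) (S t') := fun t t' =>
    commute_anisoSmooth (fun i s => Commute.symm <| commute_anisoSmooth
      (fun j r => hBB i j s r) l t) l t'
  -- Dyadic scales. Consecutive terms `D^α S² f` differ by a multiple of `r^{j+1}` with `r =
  -- 2^{-(1-w)}`; this is summable because `w < 1`.
  set τ : ℕ → ℝ := fun j => (1 / 2 : ℝ) ^ j with hτ
  have hτ0 : ∀ j, 0 < τ j := fun j => by positivity
  set r : ℝ := (1 / 2 : ℝ) ^ (1 - w) with hr
  have hr0 : 0 ≤ r := by positivity
  have hr1 : r < 1 := Real.rpow_lt_one (by norm_num) (by norm_num) (by linarith)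
  have hstep : ∀ j f, ν (Dα (S (τ (j + 1)) (S (τ (j + 1)) f)) - Dα (S (τ j) (S (τ j) f))) ≤
      8 * P * K * A f * r ^ (j + 1) := by
    intro j f
    set s := τ (j + 1) with hs
    set t := τ j with ht
    have hst : t = 2 * s := by
      simp only [hs, ht, hτ, pow_succ]; ring
    have hs0 : 0 < s := hτ0 _
    have ht0 : 0 < t := hτ0 _
    set g := S s f - S t f with hg
    -- The operators are squared in order to factor `S_s² - S_t² = (S_s + S_t)(S_s - S_t)`: the
    -- first factor takes the derivatives at cost `s^{-w}`, the second is small of order `s`.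
    have h1 : Dα (S s (S s f)) - Dα (S t (S t f)) = Dα (S s g) + Dα (S t g) := by
      have h2 : S s (S t f) = S t (S s f) := by
        rw [← Module.End.mul_apply, (hSS s t).eq, Module.End.mul_apply]
      rw [hg, map_sub (S s), map_sub (S t), h2, map_sub Dα, map_sub Dα]
      abel
    have hgν : ν g ≤ 4 * K * s * A f := by
      have h3 : g = (f - S t f) - (f - S s f) := by rw [hg]; abel
      rw [h3]
      refine (map_sub_le_add ν _ _).trans ?_
      have h4 := happrox t f ht0
      have h5 := happrox s f hs0
      have h6 : 0 ≤ K * s * A f := mul_nonneg (mul_nonneg hK0 hs0.le) (hA0 f)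
      rw [hst] at h4
      rw [hst]
      nlinarith
    have htw : t ^ (-w) ≤ s ^ (-w) := by
      apply Real.rpow_le_rpow_of_nonpos hs0 (by linarith)
      have : 0 ≤ w := Finset.sum_nonneg fun i _ => by positivity
      linarith
    rw [h1]
    refine (map_add_le_add ν _ _).trans ?_
    have hsw : s ^ (-w) * s = r ^ (j + 1) := by
      rw [hr, ← Real.rpow_natCast, ← Real.rpow_mul (by norm_num)]
      have : s ^ (-w) * s = s ^ (1 - w) := by
        rw [Real.rpow_sub hs0, Real.rpow_one, Real.rpow_neg hs0.le]; field_simp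
      rw [this, hs, hτ]
      simp only
      rw [← Real.rpow_natCast, ← Real.rpow_mul (by norm_num), mul_comm]
    calc ν (Dα (S s g)) + ν (Dα (S t g))
        ≤ P * s ^ (-w) * ν g + P * t ^ (-w) * ν g := add_le_add (hderiv s g hs0) (hderiv t g ht0)
      _ ≤ P * s ^ (-w) * (4 * K * s * A f) + P * s ^ (-w) * (4 * K * s * A f) := by gcongr
      _ = 8 * P * K * A f * (s ^ (-w) * s) := by ring
      _ = _ := by rw [hsw]
  have hiter : ∀ J f, ν (Dα (S (τ J) (S (τ J) f))) ≤
      P * P * ν f + ∑ j ∈ Finset.range J, 8 * P * K * A f * r ^ (j + 1) := by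
    intro J f
    induction J with
    | zero =>
      simp only [Finset.range_zero, Finset.sum_empty, add_zero]
      have h1 := hderiv (τ 0) (S (τ 0) f) (hτ0 0)
      have h2 : τ 0 ^ (-w) = 1 := by simp [hτ]
      rw [h2, mul_one] at h1
      refine h1.trans ?_
      rw [mul_assoc]
      gcongr
      exact hbound _ _ (hτ0 0)
    | succ J ih =>
      rw [Finset.sum_range_succ]
      have h1 := hstep J f
      have h2 : Dα (S (τ (J + 1)) (S (τ (J + 1)) f)) = Dα (S (τ J) (S (τ J) f)) +
          (Dα (S (τ (J + 1)) (S (τ (J + 1)) f)) - Dα (S (τ J) (S (τ J) f))) := by abel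
      rw [h2]
      refine (map_add_le_add ν _ _).trans ?_
      linarith
  have hgeom : ∀ J, ∑ j ∈ Finset.range J, r ^ (j + 1) ≤ (1 - r)⁻¹ := by
    intro J
    calc ∑ j ∈ Finset.range J, r ^ (j + 1) ≤ ∑ j ∈ Finset.range J, r ^ j :=
          Finset.sum_le_sum fun j _ => pow_le_pow_of_le_one hr0 hr1.le (Nat.le_succ j)
      _ ≤ (1 - r)⁻¹ := by
          rw [← tsum_geometric_of_lt_one hr0 hr1]
          exact (summable_geometric_of_lt_one hr0 hr1).sum_le_tsum _ fun j _ => by positivity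
  have h1r : 0 < 1 - r := by linarith
  refine ⟨P * P + 8 * P * K * (1 - r)⁻¹, by positivity, fun f => ?_⟩
  -- The term `A (Dα f)` may involve derivatives that the desired bound does not control. It is
  -- finite and carries the factor `τ J`, so it disappears as `J → ∞`.
  have hmain : ∀ J, ν (Dα f) ≤ (1 + P) * (K * τ J * A (Dα f)) +
      (P * P + 8 * P * K * (1 - r)⁻¹) * (ν f + A f) := by
    intro J
    have h2 : Dα (S (τ J) (S (τ J) f)) = S (τ J) (S (τ J) (Dα f)) := by
      rw [← Module.End.mul_apply, ← Module.End.mul_apply, ← Module.End.mul_apply,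
        ← Module.End.mul_apply, (hSD (τ J)).eq, mul_assoc, (hSD (τ J)).eq, ← mul_assoc]
    set g := Dα f with hg
    set T := S (τ J) with hT
    have h3 : g = ((g - T g) + T (g - T g)) + Dα (T (T f)) := by
      rw [h2, map_sub]; abel
    have h4 : ν g ≤ ν (g - T g) + ν (T (g - T g)) + ν (Dα (T (T f))) := by
      conv_lhs => rw [h3]
      refine (map_add_le_add ν _ _).trans ?_
      gcongr
      exact map_add_le_add ν _ _
    have h5 := happrox (τ J) g (hτ0 J)
    have h6 := hbound (τ J) (g - T g) (hτ0 J)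
    have h7 := hiter J f
    rw [← Finset.mul_sum] at h7
    have h8 : 8 * P * K * A f * ∑ j ∈ Finset.range J, r ^ (j + 1) ≤
        8 * P * K * A f * (1 - r)⁻¹ := by
      have := hA0 f
      gcongr
      exact hgeom J
    have h9 : 0 ≤ P * P * A f := mul_nonneg (by positivity) (hA0 f)
    have h10 : 0 ≤ 8 * P * K * (1 - r)⁻¹ * ν f := by positivity
    have h11 : P * ν (g - T g) ≤ P * (K * τ J * A g) := by gcongr
    nlinarith
  have hlim : Tendsto (fun J => (1 + P) * (K * τ J * A (Dα f)) +
      (P * P + 8 * P * K * (1 - r)⁻¹) * (ν f + A f)) atTop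
      (𝓝 ((1 + P) * (K * 0 * A (Dα f)) +
      (P * P + 8 * P * K * (1 - r)⁻¹) * (ν f + A f))) := by
    have hτl : Tendsto τ atTop (𝓝 0) :=
      tendsto_pow_atTop_nhds_zero_of_lt_one (by norm_num) (by norm_num)
    exact (((hτl.const_mul K).mul_const _).const_mul _).add_const _
  have := ge_of_tendsto' hlim hmain
  simpa using this

end AllDirections

end Interpolation

/-! ### Averages over segments -/

section TranslationAverages

variable {N n : ℕ}

/-- The average `x ↦ ∫ f (x - y) dμ(y)` of the translates of `f`. -/
def translateAvg (μ : Measure (EuclideanSpace ℝ (Fin N)))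
    (f : EuclideanSpace ℝ (Fin N) → EuclideanSpace ℝ (Fin n)) :
    EuclideanSpace ℝ (Fin N) → EuclideanSpace ℝ (Fin n) := fun x => ∫ y, f (x - y) ∂μ

variable {μ κ : Measure (EuclideanSpace ℝ (Fin N))}
  {f g : EuclideanSpace ℝ (Fin N) → EuclideanSpace ℝ (Fin n)}

theorem IsTestFunction.exists_bound (hf : IsTestFunction Set.univ f) : ∃ C, ∀ x, ‖f x‖ ≤ C :=
  hf.compact.exists_bound_of_continuous hf.smooth.continuous

theorem IsTestFunction.integrable_translate [IsFiniteMeasure μ] (hf : IsTestFunction Set.univ f)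
    (x : EuclideanSpace ℝ (Fin N)) : Integrable (fun y => f (x - y)) μ := by
  obtain ⟨C, hC⟩ := hf.exists_bound
  exact Integrable.of_bound
    (hf.smooth.continuous.comp (continuous_const.sub continuous_id)).aestronglyMeasurable C
    (Eventually.of_forall fun y => hC _)

theorem IsTestFunction.translateAvg [IsFiniteMeasure μ] {R : ℝ} (hR : ∀ᵐ y ∂μ, ‖y‖ ≤ R)
    (hf : IsTestFunction Set.univ f) :
    IsTestFunction Set.univ (MixedSmoothness.translateAvg μ f) where
  smooth := by
    have h1 : MixedSmoothness.translateAvg μ f = MeasureTheory.convolution (fun _ => (1 : ℝ)) f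
        (ContinuousLinearMap.lsmul ℝ ℝ) μ := by
      funext x
      simp [MixedSmoothness.translateAvg, MeasureTheory.convolution]
    rw [h1]
    exact hf.compact.contDiff_convolution_right _ (integrable_const _).locallyIntegrable hf.smooth
  compact := by
    obtain ⟨r, hr⟩ := hf.compact.isBounded.subset_closedBall 0
    refine HasCompactSupport.of_support_subset_isCompact
      (isCompact_closedBall (0 : EuclideanSpace ℝ (Fin N)) (r + R)) fun x hx => ?_
    by_contra hxR
    apply hx
    refine integral_eq_zero_of_ae ?_
    filter_upwards [hR] with y hy
    refine image_eq_zero_of_notMem_tsupport fun h => hxR ?_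
    have h2 : ‖x - y‖ ≤ r := by simpa using hr h
    have h3 : ‖x‖ ≤ ‖x - y‖ + ‖y‖ := by simpa using norm_add_le (x - y) y
    simp only [Metric.mem_closedBall, dist_zero_right]
    linarith
  support := Set.subset_univ _

theorem partialD_translateAvg [IsFiniteMeasure μ] (hf : IsTestFunction Set.univ f) (i : Fin N) :
    partialD i (translateAvg μ f) = translateAvg μ (partialD i f) := by
  funext x
  obtain ⟨C, hC⟩ := (hf.compact.fderiv ℝ).exists_bound_of_continuous
    (hf.smooth.continuous_fderiv (by simp))
  have hcf : Continuous fun y => fderiv ℝ f (x - y) :=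
    (hf.smooth.continuous_fderiv (by simp)).comp (continuous_const.sub continuous_id)
  have h1 : HasFDerivAt (translateAvg μ f) (∫ y, fderiv ℝ f (x - y) ∂μ) x := by
    refine hasFDerivAt_integral_of_dominated_of_fderiv_le (𝕜 := ℝ) (bound := fun _ => C)
      (F := fun x y => f (x - y)) (F' := fun x y => fderiv ℝ f (x - y))
      Filter.univ_mem (Eventually.of_forall fun z => (hf.integrable_translate z).1)
      (hf.integrable_translate x) hcf.aestronglyMeasurable ?_ (integrable_const C) ?_
    · exact Eventually.of_forall fun y z _ => hC _
    · refine Eventually.of_forall fun y z _ => ?_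
      have h0 : HasFDerivAt (fun w => w - y) (ContinuousLinearMap.id ℝ _) z :=
        (hasFDerivAt_id z).sub_const y
      exact ((hf.smooth.differentiable (by simp) (z - y)).hasFDerivAt).comp z h0
  have h2 : Integrable (fun y => fderiv ℝ f (x - y)) μ :=
    Integrable.of_bound hcf.aestronglyMeasurable C (Eventually.of_forall fun y => hC _)
  simp only [partialD]
  rw [h1.fderiv, ContinuousLinearMap.integral_apply h2]
  rfl

theorem translateAvg_comm [IsFiniteMeasure μ] [IsFiniteMeasure κ]
    (hf : IsTestFunction Set.univ f) :
    translateAvg μ (translateAvg κ f) = translateAvg κ (translateAvg μ f) := by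
  funext x
  obtain ⟨C, hC⟩ := hf.exists_bound
  have h1 : Integrable (Function.uncurry fun y z => f (x - y - z)) (μ.prod κ) := by
    refine Integrable.of_bound (Continuous.aestronglyMeasurable ?_) C
      (Eventually.of_forall fun y => hC _)
    exact hf.smooth.continuous.comp
      ((continuous_const.sub continuous_fst).sub continuous_snd)
  simp only [translateAvg]
  rw [integral_integral_swap h1]
  simp only [sub_right_comm]

theorem eLpNorm_translate {q : ℝ≥0∞} (hf : Continuous f) (y : EuclideanSpace ℝ (Fin N)) :
    eLpNorm (fun x => f (x - y)) q volume = eLpNorm f q volume :=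
  eLpNorm_comp_measurePreserving hf.aestronglyMeasurable (measurePreserving_sub_right volume y)

theorem eLpNorm_translateAvg_le [IsProbabilityMeasure μ] {q : ℝ} (hq : 1 ≤ q)
    (hf : Continuous f) :
    eLpNorm (translateAvg μ f) (ENNReal.ofReal q) volume ≤ eLpNorm f (ENNReal.ofReal q) volume := by
  refine eLpNorm_integral_le_of_ae_le hq ?_ ?_
  · exact (hf.comp (continuous_fst.sub continuous_snd)).aestronglyMeasurable
  · exact Eventually.of_forall fun y => (eLpNorm_translate hf y).le

/-- The uniform distribution on the segment from `0` to `h e_i`. -/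
def segmentMeasure (i : Fin N) (h : ℝ) : Measure (EuclideanSpace ℝ (Fin N)) :=
  (volume.restrict (Set.Ioc (0 : ℝ) 1)).map fun s => (h * s) • EuclideanSpace.single i (1 : ℝ)

theorem isProbabilityMeasure_restrict_Ioc :
    IsProbabilityMeasure (volume.restrict (Set.Ioc (0 : ℝ) 1)) := ⟨by simp⟩

theorem continuous_segment (i : Fin N) (h : ℝ) :
    Continuous fun s : ℝ => (h * s) • (EuclideanSpace.single i (1 : ℝ) :
      EuclideanSpace ℝ (Fin N)) := by fun_prop

instance (i : Fin N) (h : ℝ) : IsProbabilityMeasure (segmentMeasure i h) :=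
  have := isProbabilityMeasure_restrict_Ioc
  Measure.isProbabilityMeasure_map (continuous_segment i h).aemeasurable

theorem ae_segmentMeasure_norm_le (i : Fin N) (h : ℝ) :
    ∀ᵐ y ∂(segmentMeasure i h), ‖y‖ ≤ |h| := by
  rw [segmentMeasure, ae_map_iff (continuous_segment i h).aemeasurable
    (measurableSet_le measurable_norm measurable_const)]
  filter_upwards [ae_restrict_mem measurableSet_Ioc] with s hs
  rw [norm_smul, norm_mul, Real.norm_eq_abs, Real.norm_eq_abs, abs_of_pos hs.1]
  simp only [PiLp.norm_single, norm_one, mul_one]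
  nlinarith [abs_nonneg h, hs.2]

theorem translateAvg_segmentMeasure (hf : Continuous f) (i : Fin N) (h : ℝ)
    (x : EuclideanSpace ℝ (Fin N)) :
    translateAvg (segmentMeasure i h) f x =
      ∫ s in Set.Ioc (0 : ℝ) 1, f (x - (h * s) • EuclideanSpace.single i (1 : ℝ)) := by
  rw [translateAvg, segmentMeasure, integral_map (continuous_segment i h).aemeasurable]
  exact (hf.comp (continuous_const.sub continuous_id)).aestronglyMeasurable

/-- The fundamental theorem of calculus along a segment. It makes the derivative of an average a
difference quotient, the source of the smoothing bound `2 / h`. -/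
theorem smul_translateAvg_partialD (hf : IsTestFunction Set.univ f) (i : Fin N) (h : ℝ)
    (x : EuclideanSpace ℝ (Fin N)) :
    h • translateAvg (segmentMeasure i h) (partialD i f) x =
      f x - f (x - h • EuclideanSpace.single i (1 : ℝ)) := by
  have hcont := (contDiff_partialD hf.smooth i).continuous
  rw [translateAvg_segmentMeasure hcont, ← integral_smul,
    ← intervalIntegral.integral_of_le zero_le_one]
  set e : EuclideanSpace ℝ (Fin N) := EuclideanSpace.single i (1 : ℝ) with he
  have hderiv : ∀ s ∈ Set.uIcc (0 : ℝ) 1,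
      HasDerivAt (fun s => -f (x - (h * s) • e)) (h • partialD i f (x - (h * s) • e)) s := by
    intro s _
    have h1 : HasDerivAt (fun s : ℝ => x - (h * s) • e) (-(h • e)) s := by
      have := ((((hasDerivAt_id s).const_mul h).smul_const e).const_sub x)
      simpa using this
    have h2 := ((hf.smooth.differentiable (by simp) (x - (h * s) • e)).hasFDerivAt).comp_hasDerivAt
      s h1
    refine h2.neg.congr_deriv ?_
    simp [partialD, he]
  have hintg : IntervalIntegrable (fun s => h • partialD i f (x - (h * s) • e)) volume 0 1 := by
    apply Continuous.intervalIntegrable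
    fun_prop
  rw [intervalIntegral.integral_eq_sub_of_hasDerivAt hderiv hintg]
  rw [mul_one, mul_zero, zero_smul, sub_zero]
  abel

variable {q : ℝ}

theorem eLpNorm_sub_translate_le (hq : 1 ≤ q) (hf : IsTestFunction Set.univ f) (i : Fin N)
    (h : ℝ) :
    eLpNorm (fun x => f x - f (x - h • EuclideanSpace.single i (1 : ℝ))) (ENNReal.ofReal q) volume ≤
      ENNReal.ofReal |h| * eLpNorm (partialD i f) (ENNReal.ofReal q) volume := by
  have h1 : (fun x => f x - f (x - h • EuclideanSpace.single i (1 : ℝ))) =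
      h • translateAvg (segmentMeasure i h) (partialD i f) := by
    funext x
    rw [Pi.smul_apply, smul_translateAvg_partialD hf]
  rw [h1, eLpNorm_const_smul, ← ofReal_norm, Real.norm_eq_abs]
  gcongr
  exact eLpNorm_translateAvg_le hq (contDiff_partialD hf.smooth i).continuous

/-- The left side is an average over `s ∈ (0, 1]` of increments of `f` of length `h s ≤ h`. -/
theorem eLpNorm_sub_translateAvg_le (hq : 1 ≤ q) (hf : IsTestFunction Set.univ f) (i : Fin N)
    {h : ℝ} (hh : 0 < h) :
    eLpNorm (f - translateAvg (segmentMeasure i h) f) (ENNReal.ofReal q) volume ≤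
      ENNReal.ofReal h * eLpNorm (partialD i f) (ENNReal.ofReal q) volume := by
  have := isProbabilityMeasure_restrict_Ioc
  have hcont := hf.smooth.continuous
  have h1 : f - translateAvg (segmentMeasure i h) f = fun x => ∫ s in Set.Ioc (0 : ℝ) 1,
      (f x - f (x - (h * s) • EuclideanSpace.single i (1 : ℝ))) := by
    funext x
    have hc : Continuous fun s : ℝ => f (x - (h * s) • EuclideanSpace.single i (1 : ℝ)) :=
      hcont.comp (continuous_const.sub (continuous_segment i h))
    rw [Pi.sub_apply, translateAvg_segmentMeasure hcont, integral_sub (integrable_const _)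
      ((hc.integrableOn_Icc).mono_set Set.Ioc_subset_Icc_self)]
    simp
  rw [h1]
  refine eLpNorm_integral_le_of_ae_le hq ?_ ?_
  · apply Continuous.aestronglyMeasurable
    simp only [Function.uncurry_def]
    fun_prop
  · filter_upwards [ae_restrict_mem measurableSet_Ioc] with s hs
    refine (eLpNorm_sub_translate_le hq hf i (h * s)).trans ?_
    gcongr
    rw [abs_of_pos (mul_pos hh hs.1)]
    nlinarith [hs.2]

end TranslationAverages

/-! ### Interpolation and Poincaré inequalities for test functions -/

section TestFunctionSpace

variable {N n : ℕ} {q : ℝ}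

/-- The space `C_c^∞(ℝ^N; ℝ^n)`. -/
def testSpace (N n : ℕ) : Submodule ℝ (EuclideanSpace ℝ (Fin N) → EuclideanSpace ℝ (Fin n)) where
  carrier := {f | IsTestFunction Set.univ f}
  add_mem' hf hg := hf.add hg
  zero_mem' := IsTestFunction.zero _
  smul_mem' c _ hf := hf.const_smul c

/-- Partial differentiation on the space of test functions. -/
def testD (i : Fin N) : Module.End ℝ (testSpace N n) where
  toFun f := ⟨partialD i f, f.2.partialD i⟩
  map_add' f g := Subtype.ext (partialD_add f.2.smooth g.2.smooth i)
  map_smul' c f := Subtype.ext (partialD_const_smul f.2.smooth c i)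

/-- Averaging over segments on the space of test functions. -/
def testAvg (i : Fin N) (h : ℝ) : Module.End ℝ (testSpace N n) where
  toFun f := ⟨translateAvg (segmentMeasure i h) f,
    f.2.translateAvg (ae_segmentMeasure_norm_le i h)⟩
  map_add' f g := Subtype.ext <| funext fun x =>
    integral_add (f.2.integrable_translate x) (g.2.integrable_translate x)
  map_smul' c f := Subtype.ext <| funext fun x => integral_smul c fun y => f.1 (x - y)

theorem IsTestFunction.memLp {V : Type*} [NormedAddCommGroup V] [NormedSpace ℝ V]
    {U : Set (EuclideanSpace ℝ (Fin N))} {f : EuclideanSpace ℝ (Fin N) → V}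
    (hf : IsTestFunction U f) (r : ℝ≥0∞) : MemLp f r volume :=
  hf.smooth.continuous.memLp_of_hasCompactSupport hf.compact

/-- The `L^q` seminorm on the space of test functions. -/
def testSeminorm (N n : ℕ) {q : ℝ} (hq : 1 ≤ q) : Seminorm ℝ (testSpace N n) :=
  Seminorm.of (fun f => (eLpNorm f.1 (ENNReal.ofReal q) volume).toReal)
    (fun f g => by
      have hf := f.2.memLp (ENNReal.ofReal q)
      have hg := g.2.memLp (ENNReal.ofReal q)
      rw [← ENNReal.toReal_add hf.2.ne hg.2.ne]
      refine ENNReal.toReal_mono (ENNReal.add_ne_top.2 ⟨hf.2.ne, hg.2.ne⟩) ?_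
      exact eLpNorm_add_le hf.1 hg.1 (by simpa using ENNReal.ofReal_le_ofReal hq))
    (fun c f => by
      change (eLpNorm (c • f.1) (ENNReal.ofReal q) volume).toReal = _
      rw [eLpNorm_const_smul, ENNReal.toReal_mul, toReal_enorm])

theorem testSeminorm_apply (hq : 1 ≤ q) (f : testSpace N n) :
    testSeminorm N n hq f = (eLpNorm f.1 (ENNReal.ofReal q) volume).toReal := rfl

theorem derivProd_testD (α : Fin N → ℕ) (f : testSpace N n) :
    (derivProd testD (List.finRange N) α f).1 = pderiv α f.1 := by
  have hpow : ∀ (i : Fin N) (k : ℕ) (g : testSpace N n),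
      ((testD i ^ k) g).1 = (partialD i)^[k] g.1 := by
    intro i k g
    induction k with
    | zero => rfl
    | succ k ih =>
      rw [pow_succ', Module.End.mul_apply, Function.iterate_succ_apply', ← ih]
      rfl
  rw [pderiv_eq_foldr]
  induction List.finRange N with
  | nil => simp [derivProd]
  | cons i l ih =>
    rw [List.foldr_cons, ← ih, ← hpow]
    simp [derivProd]

/-- The abstract interpolation for `∂_i` and the averages over segments in direction `e_i`. These
averages contract `L^q` and commute with each other and with derivatives. -/
theorem exists_testSeminorm_pderiv_le (hq : 1 ≤ q) {a α : Fin N → ℕ} (ha : ∀ i, 1 ≤ a i)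
    (hα : weight a α < 1) :
    ∃ C : ℝ, 0 ≤ C ∧ ∀ f : testSpace N n,
      testSeminorm N n hq (derivProd testD (List.finRange N) α f) ≤
        C * (testSeminorm N n hq f + ∑ i, testSeminorm N n hq ((testD i ^ a i) f)) := by
  refine exists_seminorm_derivProd_le (B := testAvg) ?_ ?_ ha ?_ ?_ ?_ ?_
  · intro i j s r
    refine LinearMap.ext fun f => Subtype.ext ?_
    exact translateAvg_comm f.2
  · intro i j s
    refine LinearMap.ext fun f => Subtype.ext ?_
    exact partialD_translateAvg f.2 i
  · intro i s f _
    exact ENNReal.toReal_mono (f.2.memLp _).2.ne (eLpNorm_translateAvg_le hq f.2.smooth.continuous)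
  · intro i s f hs
    have hfin : eLpNorm f.1 (ENNReal.ofReal q) volume ≠ ⊤ := (f.2.memLp _).2.ne
    have h1 : (testD i (testAvg i s f)).1 =
        s⁻¹ • (f.1 - fun x => f.1 (x - s • EuclideanSpace.single i (1 : ℝ))) := by
      change partialD i (translateAvg (segmentMeasure i s) f.1) = _
      rw [partialD_translateAvg f.2]
      funext x
      rw [Pi.smul_apply, Pi.sub_apply, ← smul_translateAvg_partialD f.2, inv_smul_smul₀ hs.ne']
    have hc : Continuous fun x => f.1 (x - s • EuclideanSpace.single i (1 : ℝ)) :=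
      f.2.smooth.continuous.comp (continuous_id.sub continuous_const)
    have h2 : eLpNorm (f.1 - fun x => f.1 (x - s • EuclideanSpace.single i (1 : ℝ)))
        (ENNReal.ofReal q) volume ≤ 2 * eLpNorm f.1 (ENNReal.ofReal q) volume := by
      refine (eLpNorm_sub_le f.2.smooth.continuous.aestronglyMeasurable hc.aestronglyMeasurable
        (by simpa using ENNReal.ofReal_le_ofReal hq)).trans ?_
      rw [eLpNorm_translate f.2.smooth.continuous, two_mul]
    rw [testSeminorm_apply, testSeminorm_apply, h1, eLpNorm_const_smul, ENNReal.toReal_mul,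
      toReal_enorm, Real.norm_eq_abs, abs_of_pos (inv_pos.2 hs)]
    have h3 := ENNReal.toReal_mono (ENNReal.mul_ne_top (by simp) hfin) h2
    rw [ENNReal.toReal_mul] at h3
    calc _ ≤ s⁻¹ * ((2 : ℝ≥0∞).toReal * (eLpNorm f.1 (ENNReal.ofReal q) volume).toReal) := by
          gcongr
      _ = _ := by simp; ring
  · intro i s f hs
    have h1 := eLpNorm_sub_translateAvg_le hq f.2 i hs
    have h2 := ENNReal.toReal_mono
      (ENNReal.mul_ne_top ENNReal.ofReal_ne_top ((f.2.partialD i).memLp _).2.ne) h1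
    rw [ENNReal.toReal_mul, ENNReal.toReal_ofReal hs.le] at h2
    exact h2
  · have h1 : ((weight a α : ℚ) : ℝ) < 1 := by exact_mod_cast hα
    simpa [weight] using h1

theorem exists_eLpNorm_pderiv_le (hq : 1 ≤ q) {a α : Fin N → ℕ} (ha : ∀ i, 1 ≤ a i)
    (hα : weight a α < 1) :
    ∃ C : ℝ, ∀ f : EuclideanSpace ℝ (Fin N) → EuclideanSpace ℝ (Fin n),
      IsTestFunction Set.univ f →
      eLpNorm (pderiv α f) (ENNReal.ofReal q) volume ≤ ENNReal.ofReal C *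
        (eLpNorm f (ENNReal.ofReal q) volume +
          ∑ i, eLpNorm (pderiv (Pi.single i (a i)) f) (ENNReal.ofReal q) volume) := by
  obtain ⟨C, hC, h⟩ := exists_testSeminorm_pderiv_le (n := n) hq ha hα
  refine ⟨C, fun f hf => ?_⟩
  have h1 := h ⟨f, hf⟩
  have hpow : ∀ i : Fin N, ((testD i ^ a i) (⟨f, hf⟩ : testSpace N n)).1 =
      pderiv (Pi.single i (a i)) f := by
    intro i
    rw [← derivProd_testD (Pi.single i (a i)) (⟨f, hf⟩ : testSpace N n)]
    have : ∀ l : List (Fin N), l.Nodup → derivProd testD l (Pi.single i (a i)) =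
        if i ∈ l then (testD i ^ a i : Module.End ℝ (testSpace N n)) else 1 := by
      intro l hl
      induction l with
      | nil => simp [derivProd]
      | cons j l ih =>
        obtain ⟨hjl, hl'⟩ := List.nodup_cons.1 hl
        have h2 : derivProd testD (j :: l) (Pi.single i (a i)) =
            (testD j ^ (Pi.single i (a i) : Fin N → ℕ) j : Module.End ℝ (testSpace N n)) *
              derivProd testD l (Pi.single i (a i)) := by simp [derivProd]
        rw [h2, ih hl']
        by_cases hij : i = j
        · subst hij; simp [hjl]
        · simp [hij, Ne.symm hij]
    rw [this _ (List.nodup_finRange N)]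
    simp
  simp only [testSeminorm_apply, derivProd_testD, hpow] at h1
  have hfin : ∀ β, eLpNorm (pderiv β f) (ENNReal.ofReal q) volume ≠ ⊤ := fun β =>
    ((hf.pderiv β).memLp _).2.ne
  have hfin0 : eLpNorm f (ENNReal.ofReal q) volume ≠ ⊤ := (hf.memLp _).2.ne
  rw [← ENNReal.ofReal_toReal (hfin α)]
  refine (ENNReal.ofReal_le_ofReal h1).trans (le_of_eq ?_)
  rw [ENNReal.ofReal_mul hC, ENNReal.ofReal_add ENNReal.toReal_nonneg
    (Finset.sum_nonneg fun i _ => ENNReal.toReal_nonneg), ENNReal.ofReal_toReal hfin0,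
    ENNReal.ofReal_sum_of_nonneg fun i _ => ENNReal.toReal_nonneg]
  congr 2
  exact Finset.sum_congr rfl fun i _ => ENNReal.ofReal_toReal (hfin _)

/-- Poincaré's inequality in one coordinate direction. -/
theorem exists_eLpNorm_le_partialD (hq : 1 ≤ q) {U : Set (EuclideanSpace ℝ (Fin N))}
    (hU : Bornology.IsBounded U) (i : Fin N) :
    ∃ C : ℝ, ∀ f : EuclideanSpace ℝ (Fin N) → EuclideanSpace ℝ (Fin n), IsTestFunction U f →
      eLpNorm f (ENNReal.ofReal q) volume ≤
        ENNReal.ofReal C * eLpNorm (partialD i f) (ENNReal.ofReal q) volume := by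
  obtain ⟨r, hr⟩ := hU.subset_closedBall 0
  -- A shift longer than the diameter of `U` moves each point of `U` out of `U`, so there `f x`
  -- equals the increment `f x - f (x - h e_i)`.
  set h : ℝ := 2 * |r| + 1 with hh
  have hh0 : 0 < h := by positivity
  refine ⟨h, fun f hf => ?_⟩
  have h1 := eLpNorm_sub_translate_le hq (hf.mono (Set.subset_univ U)) i h
  rw [abs_of_pos hh0] at h1
  refine le_trans (eLpNorm_mono fun x => ?_) h1
  by_cases hx : x ∈ U
  · have h2 : x - h • EuclideanSpace.single i (1 : ℝ) ∉ U := by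
      intro h3
      have h4 : ‖x‖ ≤ r := by simpa using hr hx
      have h5 : ‖x - h • EuclideanSpace.single i (1 : ℝ)‖ ≤ r := by simpa using hr h3
      have h6 := norm_sub_norm_le (h • EuclideanSpace.single i (1 : ℝ)) x
      rw [norm_smul, Real.norm_eq_abs, abs_of_pos hh0, norm_sub_rev] at h6
      simp only [PiLp.norm_single, norm_one, mul_one] at h6
      have := le_abs_self r
      linarith
    rw [hf.eq_zero_of_notMem h2, sub_zero]
  · rw [hf.eq_zero_of_notMem hx]
    simp

theorem exists_eLpNorm_le_pderiv_single (hq : 1 ≤ q) {U : Set (EuclideanSpace ℝ (Fin N))}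
    (hU : Bornology.IsBounded U) (i : Fin N) (k : ℕ) :
    ∃ C : ℝ, ∀ f : EuclideanSpace ℝ (Fin N) → EuclideanSpace ℝ (Fin n), IsTestFunction U f →
      eLpNorm f (ENNReal.ofReal q) volume ≤
        ENNReal.ofReal C * eLpNorm (pderiv (Pi.single i k) f) (ENNReal.ofReal q) volume := by
  induction k with
  | zero => exact ⟨1, fun f hf => by simp⟩
  | succ k ih =>
    obtain ⟨C, hC⟩ := ih
    obtain ⟨C', hC'⟩ := exists_eLpNorm_le_partialD (n := n) hq hU i
    refine ⟨max C 0 * max C' 0, fun f hf => ?_⟩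
    refine (hC f hf).trans ?_
    rw [Pi.single_add, pderiv_add_single hf.smooth,
      ENNReal.ofReal_mul (le_max_right _ _), mul_assoc]
    refine mul_le_mul' (ENNReal.ofReal_le_ofReal (le_max_left _ _)) ?_
    refine (hC' _ (hf.pderiv _)).trans ?_
    gcongr
    exact le_max_left _ _

theorem single_mem_topIdx {a : Fin N → ℕ} (ha : ∀ i, 1 ≤ a i) (i : Fin N) :
    (Pi.single i (a i) : Fin N → ℕ) ∈ topIdx a := by
  rw [mem_topIdx ha, weight, Finset.sum_eq_single i]
  · have : (a i : ℚ) ≠ 0 := by have := ha i; positivity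
    simp [this]
  · intro j _ hj
    simp [hj]
  · simp

theorem norm_pderiv_le_norm_smoothAGrad {a α : Fin N → ℕ} (hα : α ∈ topIdx a)
    (f : EuclideanSpace ℝ (Fin N) → EuclideanSpace ℝ (Fin n)) (x : EuclideanSpace ℝ (Fin N)) :
    ‖pderiv α f x‖ ≤ ‖smoothAGrad a f x‖ :=
  PiLp.norm_apply_le (smoothAGrad a f x) ⟨α, hα⟩

/-- On a bounded set, the `L^q` norm of the `a`-gradient of a test function controls all the
derivatives of weighted order at most one. -/
theorem exists_eLpNorm_pderiv_le_smoothAGrad (hN : 1 ≤ N) (hq : 1 ≤ q) {a : Fin N → ℕ}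
    (ha : ∀ i, 1 ≤ a i) {U : Set (EuclideanSpace ℝ (Fin N))} (hU : Bornology.IsBounded U)
    {α : Fin N → ℕ} (hα : α ∈ lowIdx a) :
    ∃ C : ℝ, ∀ f : EuclideanSpace ℝ (Fin N) → EuclideanSpace ℝ (Fin n), IsTestFunction U f →
      eLpNorm (pderiv α f) (ENNReal.ofReal q) volume ≤
        ENNReal.ofReal C * eLpNorm (smoothAGrad a f) (ENNReal.ofReal q) volume := by
  -- Below order one the interpolation inequality applies; Poincaré's inequality in the first
  -- coordinate bounds `f` itself, and the `∂_i^{a_i} f` are components of the `a`-gradient. At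
  -- order one `∂^α f` is itself a component.
  rcases ((mem_lowIdx ha).1 hα).lt_or_eq with hlt | heq
  · obtain ⟨C₁, h₁⟩ := exists_eLpNorm_pderiv_le (n := n) hq ha hlt
    obtain ⟨C₂, h₂⟩ := exists_eLpNorm_le_pderiv_single (n := n) hq hU ⟨0, hN⟩ (a ⟨0, hN⟩)
    refine ⟨(ENNReal.ofReal C₁ * (ENNReal.ofReal C₂ + N)).toReal, fun f hf => ?_⟩
    rw [ENNReal.ofReal_toReal (by finiteness), mul_assoc]
    refine (h₁ f (hf.mono (Set.subset_univ U))).trans ?_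
    gcongr
    have h3 : ∀ i, eLpNorm (pderiv (Pi.single i (a i)) f) (ENNReal.ofReal q) volume ≤
        eLpNorm (smoothAGrad a f) (ENNReal.ofReal q) volume := fun i =>
      eLpNorm_mono fun x => norm_pderiv_le_norm_smoothAGrad (single_mem_topIdx ha i) f x
    rw [add_mul]
    refine add_le_add ((h₂ f hf).trans (by gcongr; exact h3 _)) ?_
    refine (Finset.sum_le_sum fun i _ => h3 i).trans ?_
    simp
  · refine ⟨1, fun f hf => ?_⟩
    rw [ENNReal.ofReal_one, one_mul]
    exact eLpNorm_mono fun x =>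
      norm_pderiv_le_norm_smoothAGrad ((mem_topIdx ha).2 heq) f x

end TestFunctionSpace

/-! ### Continuity of superposition operators on `L^p` -/

section Superposition

variable {W : Type*} [NormedAddCommGroup W]

theorem rpow_norm_add_le {p : ℝ} (hp : 1 ≤ p) (A B : W) :
    ‖A + B‖ ^ p ≤ 2 ^ (p - 1) * (‖A‖ ^ p + ‖B‖ ^ p) := by
  have h1 : ‖A + B‖ ^ p ≤ (‖A‖ + ‖B‖) ^ p := by
    gcongr
    exact norm_add_le A B
  have h2 := NNReal.rpow_add_le_mul_rpow_add_rpow ⟨‖A‖, norm_nonneg A⟩ ⟨‖B‖, norm_nonneg B⟩ hp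
  exact h1.trans (by exact_mod_cast h2)

/-- A continuous function of `p`-growth is uniformly continuous up to an error of order `|B|^p` on
`|B| > R` and a multiple of `|A - B|^p`, uniformly under bounded shifts. -/
theorem exists_abs_sub_le_of_growth [ProperSpace W] {p : ℝ} (hp : 1 ≤ p) {G : W → ℝ}
    (hG : Continuous G) {C : ℝ} (hC : 0 < C) (hgrowth : ∀ X, |G X| ≤ C * (‖X‖ ^ p + 1)) (K : ℝ) :
    ∃ C₁ : ℝ, 0 ≤ C₁ ∧ ∀ R ε : ℝ, 1 ≤ R → 0 < ε → ∃ C₂ : ℝ, 0 ≤ C₂ ∧ ∀ A B Z : W, ‖Z‖ ≤ K →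
      |G (A + Z) - G (B + Z)| ≤ ε + C₂ * ‖A - B‖ ^ p +
        C₁ * (if R < ‖B‖ then ‖B‖ ^ p else 0) := by
  have hp0 : 0 < p := by linarith
  set T : ℝ := 2 ^ (p - 1) with hT
  have hT0 : 0 < T := by positivity
  have hT1 : 1 ≤ T := Real.one_le_rpow (by norm_num) (by linarith)
  set κ : ℝ := |K| ^ p with hκ
  have hκ0 : 0 ≤ κ := by positivity
  have hcrude : ∀ A B Z : W, ‖Z‖ ≤ K → |G (A + Z) - G (B + Z)| ≤
      2 * C * T * T * (‖A - B‖ ^ p + ‖B‖ ^ p + κ + 1) := by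
    intro A B Z hZ
    have hZp : ‖Z‖ ^ p ≤ κ := by
      rw [hκ]; gcongr; exact hZ.trans (le_abs_self K)
    have h1 := rpow_norm_add_le hp A Z
    have h2 := rpow_norm_add_le hp B Z
    have h3 := rpow_norm_add_le hp (A - B) B
    rw [sub_add_cancel] at h3
    have h4 : |G (A + Z) - G (B + Z)| ≤ |G (A + Z)| + |G (B + Z)| := abs_sub _ _
    have h5 := hgrowth (A + Z)
    have h6 := hgrowth (B + Z)
    have hAB : 0 ≤ ‖A - B‖ ^ p := by positivity
    have hBp : 0 ≤ ‖B‖ ^ p := by positivity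
    have e1 : ‖A + Z‖ ^ p + 1 ≤ T * T * (‖A - B‖ ^ p + ‖B‖ ^ p + κ + 1) := by
      have : T * (‖A‖ ^ p + ‖Z‖ ^ p) ≤ T * (T * (‖A - B‖ ^ p + ‖B‖ ^ p) + κ) := by gcongr
      nlinarith [mul_nonneg hT0.le hκ0, mul_nonneg (sub_nonneg.2 hT1) (mul_nonneg hT0.le hκ0),
        mul_self_nonneg (T - 1)]
    have e2 : ‖B + Z‖ ^ p + 1 ≤ T * T * (‖A - B‖ ^ p + ‖B‖ ^ p + κ + 1) := by
      have h7 : T * (‖B‖ ^ p + ‖Z‖ ^ p) ≤ T * (‖B‖ ^ p + κ) := by gcongr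
      have h8 : T ≤ T * T := by nlinarith
      have h9 : T * (‖B‖ ^ p + κ) ≤ T * T * (‖B‖ ^ p + κ) := by gcongr
      have h10 : 0 ≤ T * T * ‖A - B‖ ^ p := by positivity
      nlinarith
    calc |G (A + Z) - G (B + Z)| ≤ C * (‖A + Z‖ ^ p + 1) + C * (‖B + Z‖ ^ p + 1) := by linarith
      _ ≤ C * (T * T * (‖A - B‖ ^ p + ‖B‖ ^ p + κ + 1)) +
          C * (T * T * (‖A - B‖ ^ p + ‖B‖ ^ p + κ + 1)) := by gcongr
      _ = _ := by ring
  set M : ℝ := 2 * C * T * T with hM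
  have hM0 : 0 ≤ M := by positivity
  -- `C₁` must not depend on `R`, which is later chosen to make `C₁` times the tail small. The value
  -- comes from `‖B‖^p + κ + 1 ≤ (κ + 2) ‖B‖^p` for `‖B‖ > R ≥ 1`.
  refine ⟨M * (κ + 2), by positivity, fun R ε hR hε => ?_⟩
  have huc : UniformContinuousOn G (Metric.closedBall 0 (R + 1 + |K|)) :=
    (isCompact_closedBall _ _).uniformContinuousOn_of_continuous hG.continuousOn
  obtain ⟨δ, hδ, hδG⟩ := Metric.uniformContinuousOn_iff.1 huc ε hε
  set d : ℝ := min δ 1 with hd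
  have hd0 : 0 < d := lt_min hδ one_pos
  refine ⟨M * (1 + (R ^ p + κ + 1) / d ^ p), by positivity, fun A B Z hZ => ?_⟩
  have hAB : 0 ≤ ‖A - B‖ ^ p := by positivity
  have hZK : ‖Z‖ ≤ |K| := hZ.trans (le_abs_self K)
  by_cases hBR : R < ‖B‖
  · rw [if_pos hBR]
    have h1 : 1 ≤ ‖B‖ ^ p := Real.one_le_rpow (by linarith) hp0.le
    have h2 : ‖A - B‖ ^ p ≤ (1 + (R ^ p + κ + 1) / d ^ p) * ‖A - B‖ ^ p :=
      le_mul_of_one_le_left hAB (by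
        have : 0 ≤ (R ^ p + κ + 1) / d ^ p := by positivity
        linarith)
    calc |G (A + Z) - G (B + Z)| ≤ M * (‖A - B‖ ^ p + ‖B‖ ^ p + κ + 1) := hcrude A B Z hZ
      _ ≤ M * ((1 + (R ^ p + κ + 1) / d ^ p) * ‖A - B‖ ^ p + (κ + 2) * ‖B‖ ^ p) :=
          mul_le_mul_of_nonneg_left (by nlinarith) hM0
      _ ≤ _ := by linarith
  -- For `‖B‖ ≤ R`, a small increment is covered by uniform continuity on a ball. For an increment
  -- of size at least `d` the growth bound suffices, its constants being absorbed by `‖A - B‖^p /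
  -- d^p ≥ 1`.
  · rw [if_neg hBR, mul_zero, add_zero]
    push Not at hBR
    by_cases hABd : ‖A - B‖ < d
    · have h1 : ‖A‖ ≤ ‖A - B‖ + ‖B‖ := by simpa using norm_add_le (A - B) B
      have h2 : ‖A - B‖ < 1 := hABd.trans_le (min_le_right _ _)
      have h3 := hδG (A + Z) (by
        rw [mem_closedBall_zero_iff]
        linarith [norm_add_le A Z]) (B + Z) (by
        rw [mem_closedBall_zero_iff]
        linarith [norm_add_le B Z]) (by
        rw [dist_eq_norm, add_sub_add_right_eq_sub]
        exact hABd.trans_le (min_le_left _ _))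
      rw [Real.dist_eq] at h3
      have : 0 ≤ M * (1 + (R ^ p + κ + 1) / d ^ p) * ‖A - B‖ ^ p := by positivity
      linarith
    · push Not at hABd
      have h1 : d ^ p ≤ ‖A - B‖ ^ p := by gcongr
      have h2 : ‖B‖ ^ p ≤ R ^ p := by gcongr
      have hdp : 0 < d ^ p := by positivity
      have h3 : R ^ p + κ + 1 ≤ (R ^ p + κ + 1) / d ^ p * ‖A - B‖ ^ p := by
        rw [div_mul_eq_mul_div, le_div_iff₀ hdp]
        gcongr
      calc |G (A + Z) - G (B + Z)| ≤ M * (‖A - B‖ ^ p + ‖B‖ ^ p + κ + 1) := hcrude A B Z hZ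
        _ ≤ M * ((1 + (R ^ p + κ + 1) / d ^ p) * ‖A - B‖ ^ p) := by
            gcongr
            linarith
        _ ≤ _ := by linarith

variable {Y : Type*} [MeasurableSpace Y] {μ : Measure Y}

theorem integral_norm_rpow_eq {p : ℝ} (hp : 1 ≤ p) {v : Y → W}
    (hv : MemLp v (ENNReal.ofReal p) μ) :
    ∫ x, ‖v x‖ ^ p ∂μ = (eLpNorm v (ENNReal.ofReal p) μ).toReal ^ p := by
  have hp0 : 0 < p := by linarith
  have h0 : 0 ≤ ∫ x, ‖v x‖ ^ p ∂μ := integral_nonneg fun x => by positivity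
  rw [hv.eLpNorm_eq_integral_rpow_norm (by simpa using hp0) ENNReal.ofReal_ne_top,
    ENNReal.toReal_ofReal hp0.le, ENNReal.toReal_ofReal (by positivity), ← Real.rpow_mul h0,
    inv_mul_cancel₀ hp0.ne', Real.rpow_one]

theorem integrable_norm_rpow_of_memLp {p : ℝ} (hp : 1 ≤ p) {v : Y → W}
    (hv : MemLp v (ENNReal.ofReal p) μ) : Integrable (fun x => ‖v x‖ ^ p) μ := by
  have hp0 : 0 < p := by linarith
  have := hv.integrable_norm_rpow (by simpa using hp0) ENNReal.ofReal_ne_top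
  rwa [ENNReal.toReal_ofReal hp0.le] at this

theorem integrable_comp_of_growth [IsFiniteMeasure μ] {p : ℝ} (hp : 1 ≤ p)
    {G : W → ℝ} (hG : Continuous G) {C : ℝ} (hgrowth : ∀ X, |G X| ≤ C * (‖X‖ ^ p + 1))
    {v : Y → W} (hv : MemLp v (ENNReal.ofReal p) μ) : Integrable (fun x => G (v x)) μ := by
  have h1 := integrable_norm_rpow_of_memLp hp hv
  refine ((h1.add (integrable_const 1)).const_mul C).mono'
    (hG.comp_aestronglyMeasurable hv.1) (Eventually.of_forall fun x => ?_)
  simpa using hgrowth (v x)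

theorem tendsto_integral_tail {p : ℝ} (hp : 1 ≤ p) {v : Y → W}
    (hv : MemLp v (ENNReal.ofReal p) μ) :
    Tendsto (fun R : ℕ => ∫ x, (if (R : ℝ) < ‖v x‖ then ‖v x‖ ^ p else 0) ∂μ) atTop (𝓝 0) := by
  have hintg := integrable_norm_rpow_of_memLp hp hv
  have h := tendsto_integral_of_dominated_convergence (μ := μ)
    (F := fun (R : ℕ) x => if (R : ℝ) < ‖v x‖ then ‖v x‖ ^ p else 0) (f := fun _ => 0)
    (fun x => ‖v x‖ ^ p) (fun R => ?_) hintg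
    (fun R => Eventually.of_forall fun x => ?_) (Eventually.of_forall fun x => ?_)
  · simpa using h
  · have hm : NullMeasurableSet {x | (R : ℝ) < ‖v x‖} μ :=
      nullMeasurableSet_lt aemeasurable_const hv.1.norm.aemeasurable
    have h2 := hintg.1.indicator₀ hm
    refine h2.congr (Eventually.of_forall fun x => ?_)
    simp only [Set.indicator_apply, Set.mem_ofPred_eq]
  · split_ifs
    · rw [Real.norm_of_nonneg (by positivity)]
    · simp; positivity
  · refine tendsto_const_nhds.congr' ?_
    obtain ⟨k, hk⟩ := exists_nat_ge ‖v x‖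
    filter_upwards [eventually_ge_atTop k] with R hR
    rw [if_neg]
    push Not
    exact hk.trans (by exact_mod_cast hR)

/-- Continuity of the superposition operator `v ↦ G ∘ (v + Z)` from `L^p` to `L^1`, uniformly with
respect to bounded shifts `Z`. -/
theorem exists_integral_abs_sub_le [ProperSpace W] [IsFiniteMeasure μ] {p : ℝ} (hp : 1 ≤ p)
    {G : W → ℝ} (hG : Continuous G) {C : ℝ} (hC : 0 < C)
    (hgrowth : ∀ X, |G X| ≤ C * (‖X‖ ^ p + 1)) (K : ℝ)
    {v : Y → W} (hv : MemLp v (ENNReal.ofReal p) μ) {ε : ℝ} (hε : 0 < ε) :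
    ∃ δ : ℝ, 0 < δ ∧ ∀ w Z : Y → W, MemLp w (ENNReal.ofReal p) μ → AEStronglyMeasurable Z μ →
      (∀ x, ‖Z x‖ ≤ K) → eLpNorm (w - v) (ENNReal.ofReal p) μ ≤ ENNReal.ofReal δ →
      |∫ x, G (w x + Z x) ∂μ - ∫ x, G (v x + Z x) ∂μ| ≤ ε := by
  have hp0 : 0 < p := by linarith
  obtain ⟨C₁, hC₁, hmain⟩ := exists_abs_sub_le_of_growth hp hG hC hgrowth K
  obtain ⟨R, hR1, hR⟩ : ∃ R : ℕ, 1 ≤ R ∧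
      C₁ * ∫ x, (if (R : ℝ) < ‖v x‖ then ‖v x‖ ^ p else 0) ∂μ ≤ ε / 3 := by
    have h1 : Tendsto (fun R : ℕ => C₁ * ∫ x, (if (R : ℝ) < ‖v x‖ then ‖v x‖ ^ p else 0) ∂μ)
        atTop (𝓝 0) := by simpa using (tendsto_integral_tail hp hv).const_mul C₁
    have h2 := h1.eventually (eventually_le_nhds (by positivity : (0 : ℝ) < ε / 3))
    obtain ⟨R, h3, h4⟩ := (h2.and (eventually_ge_atTop 1)).exists
    exact ⟨R, h4, h3⟩
  set m : ℝ := μ.real Set.univ with hm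
  have hm0 : 0 ≤ m := measureReal_nonneg
  obtain ⟨C₂, hC₂, hest⟩ := hmain R (ε / (3 * (m + 1))) (by exact_mod_cast hR1) (by positivity)
  -- This `δ` makes `C₂ ∫ ‖w - v‖^p` at most `ε / 3`. It depends on the bound `K` for the shifts,
  -- but not on the shift `Z`.
  refine ⟨(ε / (3 * (C₂ + 1))) ^ p⁻¹, by positivity, fun w Z hw hZ hZK hwv => ?_⟩
  have hZp : MemLp Z (ENNReal.ofReal p) μ :=
    MemLp.of_bound hZ K (Eventually.of_forall hZK)
  have hi1 : Integrable (fun x => G (w x + Z x)) μ :=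
    integrable_comp_of_growth hp hG hgrowth (hw.add hZp)
  have hi2 : Integrable (fun x => G (v x + Z x)) μ :=
    integrable_comp_of_growth hp hG hgrowth (hv.add hZp)
  have hd : MemLp (w - v) (ENNReal.ofReal p) μ := hw.sub hv
  have hi3 := integrable_norm_rpow_of_memLp hp hd
  have hi4 : Integrable (fun x => if (R : ℝ) < ‖v x‖ then ‖v x‖ ^ p else 0) μ := by
    have hm : NullMeasurableSet {x | (R : ℝ) < ‖v x‖} μ :=
      nullMeasurableSet_lt aemeasurable_const hv.1.norm.aemeasurable
    refine ((integrable_norm_rpow_of_memLp hp hv).indicator₀ hm).congr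
      (Eventually.of_forall fun x => ?_)
    simp only [Set.indicator_apply, Set.mem_ofPred_eq]
  have hi5 : Integrable (fun x => ε / (3 * (m + 1)) + C₂ * ‖(w - v) x‖ ^ p) μ :=
    (integrable_const _).add (hi3.const_mul _)
  have hdp : C₂ * ∫ x, ‖(w - v) x‖ ^ p ∂μ ≤ ε / 3 := by
    rw [integral_norm_rpow_eq hp hd]
    have h1 : (eLpNorm (w - v) (ENNReal.ofReal p) μ).toReal ≤ (ε / (3 * (C₂ + 1))) ^ p⁻¹ :=
      ENNReal.toReal_le_of_le_ofReal (by positivity) hwv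
    have h2 : (eLpNorm (w - v) (ENNReal.ofReal p) μ).toReal ^ p ≤ ε / (3 * (C₂ + 1)) := by
      calc _ ≤ ((ε / (3 * (C₂ + 1))) ^ p⁻¹) ^ p := by gcongr
        _ = ε / (3 * (C₂ + 1)) := by
          rw [← Real.rpow_mul (by positivity), inv_mul_cancel₀ hp0.ne', Real.rpow_one]
    calc _ ≤ C₂ * (ε / (3 * (C₂ + 1))) := by gcongr
      _ = ε / 3 * (C₂ / (C₂ + 1)) := by field_simp
      _ ≤ ε / 3 * 1 := by
          gcongr
          rw [div_le_one (by positivity)]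
          linarith
      _ = ε / 3 := mul_one _
  rw [← integral_sub hi1 hi2]
  refine (abs_integral_le_integral_abs).trans ?_
  calc ∫ x, |G (w x + Z x) - G (v x + Z x)| ∂μ
      ≤ ∫ x, ((ε / (3 * (m + 1)) + C₂ * ‖(w - v) x‖ ^ p) +
          C₁ * (if (R : ℝ) < ‖v x‖ then ‖v x‖ ^ p else 0)) ∂μ := by
        refine integral_mono (hi1.sub hi2).abs
          (hi5.add (hi4.const_mul _)) fun x => ?_
        exact hest (w x) (v x) (Z x) (hZK x)
    _ = m * (ε / (3 * (m + 1))) + C₂ * (∫ x, ‖(w - v) x‖ ^ p ∂μ) +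
          C₁ * ∫ x, (if (R : ℝ) < ‖v x‖ then ‖v x‖ ^ p else 0) ∂μ := by
        rw [integral_add hi5 (hi4.const_mul _),
          integral_add (integrable_const _) (hi3.const_mul _), integral_const_mul,
          integral_const_mul, integral_const, smul_eq_mul]
    _ ≤ ε / 3 + ε / 3 + ε / 3 := by
        have : m * (ε / (3 * (m + 1))) ≤ ε / 3 := by
          rw [mul_div_assoc', div_le_div_iff₀ (by positivity) (by positivity)]
          nlinarith
        linarith
    _ = ε := by ring

end Superposition

/-! ### Sobolev classes, Dirichlet classes and their Poincaré inequality -/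

section SobolevClasses

variable {N n : ℕ} {a : Fin N → ℕ} {p q : ℝ} {U Ω : Set (EuclideanSpace ℝ (Fin N))}
  {u v g φ ψ : EuclideanSpace ℝ (Fin N) → EuclideanSpace ℝ (Fin n)} {α : Fin N → ℕ}

theorem one_le_ofReal (hp : 1 ≤ p) : 1 ≤ ENNReal.ofReal p := by
  simpa using ENNReal.ofReal_le_ofReal hp

theorem topIdx_subset_lowIdx (a : Fin N → ℕ) : topIdx a ⊆ lowIdx a := by
  intro α hα
  rw [topIdx, Finset.mem_filter] at hα
  rw [lowIdx, Finset.mem_filter]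
  exact ⟨hα.1, hα.2.le⟩

theorem MemW.hasWeakDeriv (h : MemW a p U u) (hα : α ∈ lowIdx a) :
    HasWeakDeriv U α u (weakDeriv U α u) := by
  have hex : ∃ v, HasWeakDeriv U α u v := (h α hα).imp fun v hv => hv.1
  unfold weakDeriv
  rw [dif_pos hex]
  exact hex.choose_spec

theorem MemW.memLp_weakDeriv (hU : IsOpen U) (h : MemW a p U u) (hα : α ∈ lowIdx a) :
    MemLp (weakDeriv U α u) (ENNReal.ofReal p) (volume.restrict U) := by
  obtain ⟨v, hv, hvp⟩ := h α hα
  exact hvp.ae_eq (hv.weakDeriv_ae_eq hU).symm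

theorem MemW.add (hu : MemW a p U u) (hv : MemW a p U v) : MemW a p U (u + v) := by
  intro α hα
  obtain ⟨u', h1, h2⟩ := hu α hα
  obtain ⟨v', h3, h4⟩ := hv α hα
  exact ⟨u' + v', h1.add h3, h2.add h4⟩

theorem MemW.sub (hu : MemW a p U u) (hv : MemW a p U v) : MemW a p U (u - v) := by
  intro α hα
  obtain ⟨u', h1, h2⟩ := hu α hα
  obtain ⟨v', h3, h4⟩ := hv α hα
  exact ⟨u' - v', h1.sub h3, h2.sub h4⟩

theorem MemW.mono (hu : MemW a p U u) (h : Ω ⊆ U) : MemW a p Ω u := by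
  intro α hα
  obtain ⟨u', h1, h2⟩ := hu α hα
  exact ⟨u', h1.mono h, h2.mono_measure (Measure.restrict_mono h le_rfl)⟩

theorem IsTestFunction.memW (hψ : IsTestFunction Ω ψ) (a : Fin N → ℕ) (p : ℝ)
    (U : Set (EuclideanSpace ℝ (Fin N))) : MemW a p U ψ := fun α _ =>
  ⟨_, hasWeakDeriv_of_contDiff hψ.smooth U α, ((hψ.pderiv α).memLp _).restrict U⟩

theorem MemW.weakDeriv_add (hU : IsOpen U) (hu : MemW a p U u) (hv : MemW a p U v)
    (hα : α ∈ lowIdx a) :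
    weakDeriv U α (u + v) =ᵐ[volume.restrict U] weakDeriv U α u + weakDeriv U α v :=
  ((hu.hasWeakDeriv hα).add (hv.hasWeakDeriv hα)).weakDeriv_ae_eq hU

theorem MemW.weakDeriv_sub (hU : IsOpen U) (hu : MemW a p U u) (hv : MemW a p U v)
    (hα : α ∈ lowIdx a) :
    weakDeriv U α (u - v) =ᵐ[volume.restrict U] weakDeriv U α u - weakDeriv U α v :=
  ((hu.hasWeakDeriv hα).sub (hv.hasWeakDeriv hα)).weakDeriv_ae_eq hU

theorem weakDeriv_of_contDiff (hU : IsOpen U) (hu : ContDiff ℝ ∞ u) (α : Fin N → ℕ) :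
    weakDeriv U α u =ᵐ[volume.restrict U] pderiv α u :=
  (hasWeakDeriv_of_contDiff hu U α).weakDeriv_ae_eq hU

/-- Almost everywhere equality of `ℝ^{n × m}` valued functions, from that of the columns. -/
theorem gradSpace_ae_eq {μ : Measure (EuclideanSpace ℝ (Fin N))}
    {f g : EuclideanSpace ℝ (Fin N) → GradSpace a n}
    (h : ∀ α : topIdx a, (fun x => f x α) =ᵐ[μ] fun x => g x α) : f =ᵐ[μ] g := by
  have h' := eventually_countable_forall.2 h
  filter_upwards [h'] with x hx
  ext α : 1
  exact hx α

theorem MemW.aGrad_add (hU : IsOpen U) (hu : MemW a p U u) (hv : MemW a p U v) :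
    aGrad a U (u + v) =ᵐ[volume.restrict U] aGrad a U u + aGrad a U v :=
  gradSpace_ae_eq fun α => hu.weakDeriv_add hU hv (topIdx_subset_lowIdx a α.2)

theorem MemW.aGrad_sub (hU : IsOpen U) (hu : MemW a p U u) (hv : MemW a p U v) :
    aGrad a U (u - v) =ᵐ[volume.restrict U] aGrad a U u - aGrad a U v :=
  gradSpace_ae_eq fun α => hu.weakDeriv_sub hU hv (topIdx_subset_lowIdx a α.2)

theorem aGrad_of_contDiff (hU : IsOpen U) (hu : ContDiff ℝ ∞ u) :
    aGrad a U u =ᵐ[volume.restrict U] smoothAGrad a u :=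
  gradSpace_ae_eq fun α => weakDeriv_of_contDiff hU hu α

theorem MemW.memLp_aGrad (hU : IsOpen U) (hu : MemW a p U u) :
    MemLp (aGrad a U u) (ENNReal.ofReal p) (volume.restrict U) :=
  MemLp.of_eval_piLp fun α => hu.memLp_weakDeriv hU (topIdx_subset_lowIdx a α.2)

theorem continuous_smoothAGrad (hu : ContDiff ℝ ∞ u) : Continuous (smoothAGrad a u) :=
  (PiLp.continuous_toLp 2 _).comp
    (continuous_pi fun α : topIdx a => (contDiff_pderiv hu (α : Fin N → ℕ)).continuous)

theorem smoothAGrad_add (hu : ContDiff ℝ ∞ u) (hv : ContDiff ℝ ∞ v)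
    (x : EuclideanSpace ℝ (Fin N)) :
    smoothAGrad a (u + v) x = smoothAGrad a u x + smoothAGrad a v x := by
  ext α : 1
  exact congrFun (pderiv_add hu hv _) x

theorem smoothAGrad_sub (hu : ContDiff ℝ ∞ u) (hv : ContDiff ℝ ∞ v)
    (x : EuclideanSpace ℝ (Fin N)) :
    smoothAGrad a (u - v) x = smoothAGrad a u x - smoothAGrad a v x := by
  ext α : 1
  exact congrFun (pderiv_sub hu hv _) x

theorem smoothAGrad_const_smul (hu : ContDiff ℝ ∞ u) (c : ℝ) (x : EuclideanSpace ℝ (Fin N)) :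
    smoothAGrad a (c • u) x = c • smoothAGrad a u x := by
  ext α : 1
  exact congrFun (pderiv_const_smul hu c _) x

theorem smoothAGrad_zero (x : EuclideanSpace ℝ (Fin N)) :
    smoothAGrad a (0 : EuclideanSpace ℝ (Fin N) → EuclideanSpace ℝ (Fin n)) x = 0 := by
  ext α : 1
  exact congrFun (pderiv_zero _) x

theorem smoothAGrad_congr_nhds (hu : ContDiff ℝ ∞ u) (hv : ContDiff ℝ ∞ v)
    {x : EuclideanSpace ℝ (Fin N)} (h : u =ᶠ[𝓝 x] v) :
    smoothAGrad a u x = smoothAGrad a v x := by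
  ext α : 1
  exact (pderiv_congr_nhds hu hv h _).eq_of_nhds

theorem IsTestFunction.smoothAGrad_eq_zero (hψ : IsTestFunction U ψ)
    {x : EuclideanSpace ℝ (Fin N)} (hx : x ∉ U) : smoothAGrad a ψ x = 0 := by
  ext α : 1
  exact (hψ.pderiv _).eq_zero_of_notMem hx

theorem IsTestFunction.exists_norm_smoothAGrad_le (hψ : IsTestFunction U ψ) (a : Fin N → ℕ) :
    ∃ K : ℝ, 0 ≤ K ∧ ∀ x, ‖smoothAGrad a ψ x‖ ≤ K := by
  have hc : HasCompactSupport (smoothAGrad a ψ) := by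
    refine HasCompactSupport.of_support_subset_isCompact hψ.compact fun x hx => ?_
    by_contra h
    exact hx ((IsTestFunction.mk hψ.smooth hψ.compact subset_rfl).smoothAGrad_eq_zero h)
  obtain ⟨K, hK⟩ := hc.exists_bound_of_continuous (continuous_smoothAGrad hψ.smooth)
  exact ⟨K, (norm_nonneg _).trans (hK 0), hK⟩

theorem MemW.aGrad_add_test (hU : IsOpen U) (hu : MemW a p U u) (hψ : IsTestFunction Ω ψ) :
    aGrad a U (u + ψ) =ᵐ[volume.restrict U] aGrad a U u + smoothAGrad a ψ :=
  (hu.aGrad_add hU (hψ.memW a p U)).trans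
    (EventuallyEq.rfl.add (aGrad_of_contDiff hU hψ.smooth))

theorem norm_gradSpace_le_sum (X : GradSpace a n) : ‖X‖ ≤ ∑ α, ‖X α‖ := by
  rw [PiLp.norm_eq_of_L2]
  refine Real.sqrt_le_iff.2 ⟨Finset.sum_nonneg fun α _ => norm_nonneg _, ?_⟩
  exact Finset.sum_sq_le_sq_sum_of_nonneg fun α _ => norm_nonneg _

theorem eLpNorm_gradSpace_le_sum {μ : Measure (EuclideanSpace ℝ (Fin N))} (hq : 1 ≤ q)
    {f : EuclideanSpace ℝ (Fin N) → GradSpace a n}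
    (hf : ∀ α, AEStronglyMeasurable (fun x => f x α) μ) :
    eLpNorm f (ENNReal.ofReal q) μ ≤ ∑ α, eLpNorm (fun x => f x α) (ENNReal.ofReal q) μ := by
  calc eLpNorm f (ENNReal.ofReal q) μ
      ≤ eLpNorm (∑ α, fun x => ‖f x α‖) (ENNReal.ofReal q) μ := by
        refine eLpNorm_mono fun x => ?_
        rw [Finset.sum_apply, Real.norm_of_nonneg (Finset.sum_nonneg fun α _ => norm_nonneg _)]
        exact norm_gradSpace_le_sum (f x)
    _ ≤ ∑ α, eLpNorm (fun x => ‖f x α‖) (ENNReal.ofReal q) μ :=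
        eLpNorm_sum_le (fun α _ => (hf α).norm) (one_le_ofReal hq)
    _ = _ := Finset.sum_congr rfl fun α _ => eLpNorm_norm _

theorem sum_topIdx_le_sum_lowIdx (f : (Fin N → ℕ) → ℝ≥0∞) :
    ∑ α : topIdx a, f α ≤ ∑ α ∈ lowIdx a, f α := by
  rw [Finset.sum_coe_sort (topIdx a) f]
  exact Finset.sum_le_sum_of_subset (topIdx_subset_lowIdx a)

theorem MemW.eLpNorm_aGrad_le_wNorm (hU : IsOpen U) (hq : 1 ≤ q) (hu : MemW a p U u) :
    eLpNorm (aGrad a U u) (ENNReal.ofReal q) (volume.restrict U) ≤ wNorm a q U u :=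
  (eLpNorm_gradSpace_le_sum hq
      fun α => (hu.memLp_weakDeriv hU (topIdx_subset_lowIdx a α.2)).1).trans
    (sum_topIdx_le_sum_lowIdx fun α => eLpNorm (weakDeriv U α u) (ENNReal.ofReal q)
      (volume.restrict U))

theorem memWZero_zero (hU : IsOpen U) :
    MemWZero a p U (0 : EuclideanSpace ℝ (Fin N) → EuclideanSpace ℝ (Fin n)) := by
  have hz := IsTestFunction.zero (V := EuclideanSpace ℝ (Fin n)) U
  refine ⟨hz.memW a p U, fun ε hε => ⟨0, hz, ?_⟩⟩
  rw [sub_zero, wNorm, Finset.sum_eq_zero]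
  · exact hε
  · intro α _
    rw [eLpNorm_congr_ae (weakDeriv_of_contDiff hU hz.smooth α), pderiv_zero, eLpNorm_zero]

theorem MemWZero.add_test (hφ : MemWZero a p U φ) (hψ : IsTestFunction U ψ) :
    MemWZero a p U (φ + ψ) := by
  refine ⟨hφ.1.add (hψ.memW a p U), fun ε hε => ?_⟩
  obtain ⟨χ, h1, h2⟩ := hφ.2 ε hε
  refine ⟨χ + ψ, h1.add hψ, ?_⟩
  rwa [add_sub_add_right_eq_sub]

theorem mem_dirichletClass_self (hΩ : IsOpen Ω) : g ∈ dirichletClass a p Ω g :=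
  ⟨0, memWZero_zero hΩ, by simp⟩

theorem add_test_mem_dirichletClass (hu : u ∈ dirichletClass a p Ω g) (hψ : IsTestFunction Ω ψ) :
    u + ψ ∈ dirichletClass a p Ω g := by
  obtain ⟨φ, hφ, rfl⟩ := hu
  exact ⟨φ + ψ, hφ.add_test hψ, add_assoc _ _ _⟩

theorem memW_of_mem_dirichletClass (hg : MemW a p Set.univ g) (hu : u ∈ dirichletClass a p Ω g) :
    MemW a p Ω u := by
  obtain ⟨φ, hφ, rfl⟩ := hu
  exact (hg.mono (Set.subset_univ Ω)).add hφ.1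

theorem isFiniteMeasure_restrict_of_isBounded (hΩ : Bornology.IsBounded Ω) :
    IsFiniteMeasure (volume.restrict Ω) :=
  ⟨by simpa using hΩ.measure_lt_top⟩

/-- On a set of finite measure the `L^q` norm is bounded by a multiple of the `L^p` norm,
`q ≤ p`. -/
theorem exists_eLpNorm_le_eLpNorm {W : Type*} [NormedAddCommGroup W] (hΩ : Bornology.IsBounded Ω)
    (hq : 1 ≤ q) (hqp : q ≤ p) :
    ∃ K : ℝ≥0∞, K ≠ ⊤ ∧ ∀ f : EuclideanSpace ℝ (Fin N) → W,
      AEStronglyMeasurable f (volume.restrict Ω) →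
      eLpNorm f (ENNReal.ofReal q) (volume.restrict Ω) ≤
        K * eLpNorm f (ENNReal.ofReal p) (volume.restrict Ω) := by
  have hfin := isFiniteMeasure_restrict_of_isBounded hΩ
  have h0 : 0 ≤ 1 / (ENNReal.ofReal q).toReal - 1 / (ENNReal.ofReal p).toReal := by
    rw [ENNReal.toReal_ofReal (by linarith), ENNReal.toReal_ofReal (by linarith), sub_nonneg]
    exact one_div_le_one_div_of_le (by linarith) hqp
  refine ⟨_, ENNReal.rpow_ne_top_of_nonneg h0 (measure_ne_top (volume.restrict Ω) Set.univ),
    fun f hf => ?_⟩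
  rw [mul_comm]
  exact eLpNorm_le_eLpNorm_mul_rpow_measure_univ (ENNReal.ofReal_le_ofReal hqp) hf

theorem IsTestFunction.eLpNorm_smoothAGrad_restrict (hΩ : IsOpen Ω) (hψ : IsTestFunction Ω ψ)
    (r : ℝ≥0∞) :
    eLpNorm (smoothAGrad a ψ) r (volume.restrict Ω) = eLpNorm (smoothAGrad a ψ) r volume := by
  rw [← eLpNorm_indicator_eq_eLpNorm_restrict hΩ.measurableSet]
  congr 1
  funext x
  by_cases hx : x ∈ Ω
  · simp [hx]
  · simp [hx, hψ.smoothAGrad_eq_zero hx]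

/-- In `W₀^{a,p}(Ω)` the `L^q` norm of the `a`-gradient controls the norm of `W^{a,q}(Ω)`. -/
theorem MemWZero.exists_eLpNorm_weakDeriv_le (hN : 1 ≤ N) (ha : ∀ i, 1 ≤ a i) (hq : 1 ≤ q)
    (hqp : q ≤ p) (hΩ : IsOpen Ω) (hb : Bornology.IsBounded Ω) (hα : α ∈ lowIdx a) :
    ∃ C : ℝ, ∀ φ : EuclideanSpace ℝ (Fin N) → EuclideanSpace ℝ (Fin n), MemWZero a p Ω φ →
      eLpNorm (weakDeriv Ω α φ) (ENNReal.ofReal q) (volume.restrict Ω) ≤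
        ENNReal.ofReal C * eLpNorm (aGrad a Ω φ) (ENNReal.ofReal q) (volume.restrict Ω) := by
  obtain ⟨C, hC⟩ := exists_eLpNorm_pderiv_le_smoothAGrad (n := n) hN hq ha hb hα
  obtain ⟨K, hK, hKle⟩ := exists_eLpNorm_le_eLpNorm (W := EuclideanSpace ℝ (Fin n)) hb hq hqp
  refine ⟨C, fun φ hφ => ?_⟩
  set μ := volume.restrict Ω with hμ
  have h1q := one_le_ofReal hq
  set K' : ℝ≥0∞ := K + ENNReal.ofReal C * K with hK'
  have hK't : K' ≠ ⊤ := by finiteness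
  -- The inequality for test functions is applied to an approximation of `φ` in `W^{a,p}`. Since `Ω`
  -- is bounded, the `L^q` errors are at most `K ε`, so the total error is linear in `ε`.
  have key : ∀ ε : ℝ≥0∞, 0 < ε → eLpNorm (weakDeriv Ω α φ) (ENNReal.ofReal q) μ ≤
      ENNReal.ofReal C * eLpNorm (aGrad a Ω φ) (ENNReal.ofReal q) μ + K' * ε := by
    intro ε hε
    obtain ⟨ψ, hψ, hlt⟩ := hφ.2 ε hε
    have hψW := hψ.memW a p Ω
    have hd : MemW a p Ω (φ - ψ) := hφ.1.sub hψW
    have hm : ∀ β ∈ lowIdx a, AEStronglyMeasurable (weakDeriv Ω β (φ - ψ)) μ := fun β hβ =>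
      (hd.memLp_weakDeriv hΩ hβ).1
    have hsum : ∑ β ∈ lowIdx a, eLpNorm (weakDeriv Ω β (φ - ψ)) (ENNReal.ofReal q) μ ≤ K * ε := by
      calc _ ≤ ∑ β ∈ lowIdx a, K * eLpNorm (weakDeriv Ω β (φ - ψ)) (ENNReal.ofReal p) μ :=
            Finset.sum_le_sum fun β hβ => hKle _ (hm β hβ)
        _ = K * wNorm a p Ω (φ - ψ) := by rw [← Finset.mul_sum]; rfl
        _ ≤ K * ε := by gcongr
    have h1 : eLpNorm (weakDeriv Ω α (φ - ψ)) (ENNReal.ofReal q) μ ≤ K * ε :=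
      (Finset.single_le_sum (f := fun β => eLpNorm (weakDeriv Ω β (φ - ψ)) (ENNReal.ofReal q) μ)
        (fun β _ => zero_le) hα).trans hsum
    have h2 : eLpNorm (aGrad a Ω (φ - ψ)) (ENNReal.ofReal q) μ ≤ K * ε :=
      (hd.eLpNorm_aGrad_le_wNorm hΩ hq).trans hsum
    have hφeq : φ = (φ - ψ) + ψ := by simp
    have h3 : weakDeriv Ω α φ =ᵐ[μ] weakDeriv Ω α (φ - ψ) + pderiv α ψ := by
      conv_lhs => rw [hφeq]
      exact (hd.weakDeriv_add hΩ hψW hα).trans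
        (EventuallyEq.rfl.add (weakDeriv_of_contDiff hΩ hψ.smooth α))
    have h4 : smoothAGrad a ψ =ᵐ[μ] aGrad a Ω φ - aGrad a Ω (φ - ψ) := by
      have h5 := hd.aGrad_add_test hΩ hψ
      rw [← hφeq] at h5
      filter_upwards [h5] with x hx
      simp [hx]
    have h6 : eLpNorm (smoothAGrad a ψ) (ENNReal.ofReal q) μ ≤
        eLpNorm (aGrad a Ω φ) (ENNReal.ofReal q) μ + K * ε := by
      rw [eLpNorm_congr_ae h4]
      exact (eLpNorm_sub_le (hφ.1.memLp_aGrad hΩ).1 (hd.memLp_aGrad hΩ).1 h1q).trans (by gcongr)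
    calc eLpNorm (weakDeriv Ω α φ) (ENNReal.ofReal q) μ
        ≤ eLpNorm (weakDeriv Ω α (φ - ψ)) (ENNReal.ofReal q) μ +
          eLpNorm (pderiv α ψ) (ENNReal.ofReal q) μ := by
          rw [eLpNorm_congr_ae h3]
          exact eLpNorm_add_le (hm α hα)
            (contDiff_pderiv hψ.smooth α).continuous.aestronglyMeasurable h1q
      _ ≤ K * ε + eLpNorm (pderiv α ψ) (ENNReal.ofReal q) volume := by
          gcongr
          exact Measure.restrict_le_self
      _ ≤ K * ε + ENNReal.ofReal C * eLpNorm (smoothAGrad a ψ) (ENNReal.ofReal q) μ := by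
          rw [hμ, hψ.eLpNorm_smoothAGrad_restrict hΩ]
          gcongr
          exact hC ψ hψ
      _ ≤ K * ε + ENNReal.ofReal C *
          (eLpNorm (aGrad a Ω φ) (ENNReal.ofReal q) μ + K * ε) := by gcongr
      _ = _ := by rw [hK']; ring
  refine ENNReal.le_of_forall_pos_le_add fun ε hε _ => ?_
  have hpos : 0 < (ε : ℝ≥0∞) / (K' + 1) := ENNReal.div_pos (by simpa using hε.ne') (by finiteness)
  refine (key _ hpos).trans ?_
  gcongr
  calc K' * ((ε : ℝ≥0∞) / (K' + 1)) ≤ (K' + 1) * ((ε : ℝ≥0∞) / (K' + 1)) := by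
        gcongr
        exact le_self_add
    _ = ε := ENNReal.mul_div_cancel (by simp) (by finiteness)

/-- The estimate on `W₀^{a,p}` is applied to `u - g`, and the datum `g` goes into the constant `B`.
It turns bounds on `gradNorm` into bounds in `W^{a,q}(Ω)`. -/
theorem exists_wNorm_le_gradNorm (hN : 1 ≤ N) (ha : ∀ i, 1 ≤ a i) (hq : 1 ≤ q)
    (hqp : q ≤ p) (hΩ : IsOpen Ω) (hb : Bornology.IsBounded Ω) (hg : MemW a p Set.univ g) :
    ∃ A B : ℝ≥0∞, A ≠ ⊤ ∧ B ≠ ⊤ ∧ ∀ u ∈ dirichletClass a p Ω g,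
      wNorm a q Ω u ≤ A * ENNReal.ofReal (gradNorm a q Ω u) + B := by
  have hfin := isFiniteMeasure_restrict_of_isBounded hb
  have hgΩ : MemW a p Ω g := hg.mono (Set.subset_univ Ω)
  have h1q := one_le_ofReal hq
  have hqp' := ENNReal.ofReal_le_ofReal hqp
  have hC : ∀ α, ∃ C : ℝ, α ∈ lowIdx a →
      ∀ φ : EuclideanSpace ℝ (Fin N) → EuclideanSpace ℝ (Fin n), MemWZero a p Ω φ →
      eLpNorm (weakDeriv Ω α φ) (ENNReal.ofReal q) (volume.restrict Ω) ≤
        ENNReal.ofReal C * eLpNorm (aGrad a Ω φ) (ENNReal.ofReal q) (volume.restrict Ω) := by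
    intro α
    by_cases hα : α ∈ lowIdx a
    · obtain ⟨C, hC⟩ := MemWZero.exists_eLpNorm_weakDeriv_le (n := n) hN ha hq hqp hΩ hb hα
      exact ⟨C, fun _ => hC⟩
    · exact ⟨0, fun h => absurd h hα⟩
  choose C hC using hC
  set μ := volume.restrict Ω with hμ
  set G := eLpNorm (aGrad a Ω g) (ENNReal.ofReal q) μ with hG
  have hGt : G ≠ ⊤ := ((hgΩ.memLp_aGrad hΩ).mono_exponent hqp').2.ne
  refine ⟨∑ α ∈ lowIdx a, ENNReal.ofReal (C α),
    ∑ α ∈ lowIdx a, (eLpNorm (weakDeriv Ω α g) (ENNReal.ofReal q) μ + ENNReal.ofReal (C α) * G),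
    ENNReal.sum_ne_top.2 fun α _ => ENNReal.ofReal_ne_top, ?_, fun u hu => ?_⟩
  · refine ENNReal.sum_ne_top.2 fun α hα => ?_
    have h1 := ((hgΩ.memLp_weakDeriv hΩ hα).mono_exponent hqp').2.ne
    finiteness
  · have huW := memW_of_mem_dirichletClass hg hu
    have hgr : ENNReal.ofReal (gradNorm a q Ω u) =
        eLpNorm (aGrad a Ω u) (ENNReal.ofReal q) μ :=
      ENNReal.ofReal_toReal ((huW.memLp_aGrad hΩ).mono_exponent hqp').2.ne
    obtain ⟨φ, hφ, hu'⟩ := hu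
    rw [hgr, wNorm, Finset.sum_mul, ← Finset.sum_add_distrib]
    refine Finset.sum_le_sum fun α hα => ?_
    have h1 : eLpNorm (aGrad a Ω φ) (ENNReal.ofReal q) μ ≤
        eLpNorm (aGrad a Ω u) (ENNReal.ofReal q) μ + G := by
      have h2 : φ = u - g := by rw [hu']; simp
      rw [h2, eLpNorm_congr_ae (huW.aGrad_sub hΩ hgΩ)]
      exact eLpNorm_sub_le (huW.memLp_aGrad hΩ).1 (hgΩ.memLp_aGrad hΩ).1 h1q
    calc eLpNorm (weakDeriv Ω α u) (ENNReal.ofReal q) μ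
        ≤ eLpNorm (weakDeriv Ω α g) (ENNReal.ofReal q) μ +
          eLpNorm (weakDeriv Ω α φ) (ENNReal.ofReal q) μ := by
          rw [hu', eLpNorm_congr_ae (hgΩ.weakDeriv_add hΩ hφ.1 hα)]
          exact eLpNorm_add_le (hgΩ.memLp_weakDeriv hΩ hα).1 (hφ.1.memLp_weakDeriv hΩ hα).1 h1q
      _ ≤ eLpNorm (weakDeriv Ω α g) (ENNReal.ofReal q) μ + ENNReal.ofReal (C α) *
          (eLpNorm (aGrad a Ω u) (ENNReal.ofReal q) μ + G) := by
          gcongr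
          exact (hC α hα φ hφ).trans (by gcongr)
      _ = _ := by ring

end SobolevClasses

/-! ### Consequences of coercivity -/

section Coercivity

variable {N n : ℕ} {a : Fin N → ℕ} {p q : ℝ} {Ω : Set (EuclideanSpace ℝ (Fin N))}
  {F : GradSpace a n → ℝ} {u g : EuclideanSpace ℝ (Fin N) → EuclideanSpace ℝ (Fin n)}

theorem IsMeanCoercive.isCoercive (hq : 1 ≤ q) (h : IsMeanCoercive a p q F Ω g) :
    IsCoercive a p q F Ω g := by
  obtain ⟨C₁, C₂, hC₁, _, h⟩ := h
  intro u hu hlim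
  refine tendsto_atTop_mono (fun j => h (u j) (hu j)) ?_
  refine tendsto_atTop_add_const_right _ _ (Tendsto.const_mul_atTop hC₁ ?_)
  exact (tendsto_rpow_atTop (by linarith)).comp hlim

/-- Whether or not the infimum is `-∞`, it lies strictly below the energy of `g` plus one, and hence
so do all but finitely many energies. -/
theorem IsMinimisingSeq.bddAbove_energy {u : ℕ → EuclideanSpace ℝ (Fin N) →
    EuclideanSpace ℝ (Fin n)} (hΩ : IsOpen Ω) (hu : IsMinimisingSeq a p F Ω g u) :
    BddAbove (Set.range fun j => energy a F Ω (u j)) := by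
  have hlt : (⨅ v ∈ dirichletClass a p Ω g, (energy a F Ω v : EReal)) <
      ((energy a F Ω g + 1 : ℝ) : EReal) := by
    refine (iInf₂_le g (mem_dirichletClass_self hΩ)).trans_lt ?_
    exact_mod_cast lt_add_one _
  have h1 := hu.2.eventually (eventually_lt_nhds hlt)
  refine IsBoundedUnder.bddAbove_range ⟨energy a F Ω g + 1, ?_⟩
  rw [eventually_map]
  filter_upwards [h1] with j hj
  exact_mod_cast hj.le

theorem IsCoercive.minimisingSeqsBounded (hN : 1 ≤ N) (ha : ∀ i, 1 ≤ a i) (hq : 1 ≤ q)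
    (hqp : q ≤ p) (hΩ : IsOpen Ω) (hb : Bornology.IsBounded Ω) (hg : MemW a p Set.univ g)
    (h : IsCoercive a p q F Ω g) : MinimisingSeqsBounded a p q F Ω g := by
  intro u hu
  obtain ⟨E, hE⟩ := hu.bddAbove_energy hΩ
  obtain ⟨M, hM⟩ : ∃ M : ℝ, ∀ j, gradNorm a q Ω (u j) ≤ M := by
    by_contra! hcon
    -- The indices `k j` need not increase: coercivity applies to any sequence in the Dirichlet
    -- class.
    choose k hk using fun j : ℕ => hcon j
    have h1 : Tendsto (fun j => gradNorm a q Ω (u (k j))) atTop atTop :=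
      tendsto_atTop_mono (fun j => (hk j).le) tendsto_natCast_atTop_atTop
    have h2 := h (fun j => u (k j)) (fun j => hu.1 (k j)) h1
    obtain ⟨j, hj⟩ := (h2.eventually (eventually_gt_atTop E)).exists
    exact absurd (hE ⟨k j, rfl⟩) (not_le.2 hj)
  obtain ⟨A, B, hA, hB, hAB⟩ := exists_wNorm_le_gradNorm hN ha hq hqp hΩ hb hg
  refine ⟨(A * ENNReal.ofReal M + B).toReal, fun j => ?_⟩
  rw [ENNReal.ofReal_toReal (by finiteness)]
  refine (hAB (u j) (hu.1 j)).trans ?_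
  gcongr
  exact hM j

theorem gradNorm_rpow (hq : 1 ≤ q) (hqp : q ≤ p) (hΩ : IsOpen Ω) (hb : Bornology.IsBounded Ω)
    (hu : MemW a p Ω u) : gradNorm a q Ω u ^ q = ∫ x in Ω, ‖aGrad a Ω u x‖ ^ q := by
  have := isFiniteMeasure_restrict_of_isBounded hb
  rw [integral_norm_rpow_eq hq ((hu.memLp_aGrad hΩ).mono_exponent (ENNReal.ofReal_le_ofReal hqp))]
  rfl

theorem rpow_norm_le_rpow_norm_add_one {W : Type*} [NormedAddCommGroup W] (hq : 1 ≤ q)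
    (hqp : q ≤ p) (X : W) : ‖X‖ ^ q ≤ ‖X‖ ^ p + 1 := by
  rcases le_total ‖X‖ 1 with h | h
  · have h1 : ‖X‖ ^ q ≤ 1 := Real.rpow_le_one (norm_nonneg _) h (by linarith)
    have h2 : 0 ≤ ‖X‖ ^ p := by positivity
    linarith
  · have := Real.rpow_le_rpow_of_exponent_le h hqp
    linarith

/-- Subtracting a multiple of `|X|^q` preserves `p`-growth. -/
theorem growth_sub_rpow {W : Type*} [NormedAddCommGroup W] (hq : 1 ≤ q) (hqp : q ≤ p)
    {F : W → ℝ} {C : ℝ} (hC : ∀ X, |F X| ≤ C * (‖X‖ ^ p + 1)) (c : ℝ) (X : W) :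
    |F X - c * ‖X‖ ^ q| ≤ (C + |c|) * (‖X‖ ^ p + 1) := by
  have h1 : |c * ‖X‖ ^ q| ≤ |c| * (‖X‖ ^ p + 1) := by
    rw [abs_mul, abs_of_nonneg (by positivity : 0 ≤ ‖X‖ ^ q)]
    gcongr
    exact rpow_norm_le_rpow_norm_add_one hq hqp X
  have h2 := abs_sub (F X) (c * ‖X‖ ^ q)
  have h3 := hC X
  linarith

theorem continuous_norm_rpow {W : Type*} [NormedAddCommGroup W] (hq : 1 ≤ q) :
    Continuous fun X : W => ‖X‖ ^ q :=
  continuous_norm.rpow_const fun _ => Or.inr (by linarith)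

end Coercivity

/-! ### The unit ball as a Lipschitz set -/

section LipschitzBall

variable {N : ℕ}

theorem abs_sqrt_one_sub_sq_sub_le {r s : ℝ} (hr0 : 0 ≤ r) (hr : r ≤ 1 / 2) (hs0 : 0 ≤ s)
    (hs : s ≤ 1 / 2) : |√(1 - r ^ 2) - √(1 - s ^ 2)| ≤ |r - s| := by
  have h1 : 1 / 2 ≤ √(1 - r ^ 2) := Real.le_sqrt_of_sq_le (by nlinarith)
  have h2 : 1 / 2 ≤ √(1 - s ^ 2) := Real.le_sqrt_of_sq_le (by nlinarith)
  have e1 := Real.sq_sqrt (by nlinarith : 0 ≤ 1 - r ^ 2)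
  have e2 := Real.sq_sqrt (by nlinarith : 0 ≤ 1 - s ^ 2)
  set A := √(1 - r ^ 2)
  set B := √(1 - s ^ 2)
  have h3 : (A - B) * (A + B) = (s - r) * (r + s) := by nlinarith
  have h4 : |A - B| * (A + B) = |r - s| * (r + s) := by
    rw [← abs_of_nonneg (by linarith : 0 ≤ A + B), ← abs_mul, h3, abs_mul,
      abs_of_nonneg (by linarith : 0 ≤ r + s), abs_sub_comm]
  nlinarith [abs_nonneg (A - B), abs_nonneg (r - s)]

/-- Near a boundary point `x` the ball lies above the graph of `-√(1 - ‖w‖²)` in the direction `-x`.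
Truncating `‖w‖` at `1 / 2` makes this function globally Lipschitz and does not change it near `w =
0`. -/
theorem isBoundedLipschitz_ball :
    IsBoundedLipschitz (Metric.ball (0 : EuclideanSpace ℝ (Fin N)) 1) where
  bounded := Metric.isBounded_ball
  isOpen := Metric.isOpen_ball
  lipschitz := by
    intro x hx
    rw [frontier_ball _ one_ne_zero, mem_sphere_zero_iff_norm] at hx
    set r : EuclideanSpace ℝ (Fin N) → ℝ := fun w => min ‖w‖ (1 / 2) with hr
    refine ⟨-x, by simpa using hx, 1, fun w => -√(1 - r w ^ 2), ?_, ?_⟩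
    · refine LipschitzWith.of_dist_le_mul fun w z => ?_
      have h1 : |√(1 - r w ^ 2) - √(1 - r z ^ 2)| ≤ |r w - r z| :=
        abs_sqrt_one_sub_sq_sub_le (le_min (norm_nonneg _) (by norm_num)) (min_le_right _ _)
          (le_min (norm_nonneg _) (by norm_num)) (min_le_right _ _)
      have h2 : |r w - r z| ≤ |‖w‖ - ‖z‖| := by
        have := abs_min_sub_min_le_max ‖w‖ (1 / 2) ‖z‖ (1 / 2)
        simpa [hr] using this
      rw [Real.dist_eq, dist_eq_norm, NNReal.coe_one, one_mul, neg_sub_neg, abs_sub_comm]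
      exact h1.trans (h2.trans (abs_norm_sub_norm_le w z))
    · have hxx : inner ℝ (-x) x = -1 := by
        rw [inner_neg_left, real_inner_self_eq_norm_sq, hx]; norm_num
      have hc : Continuous fun y : EuclideanSpace ℝ (Fin N) => inner ℝ (-x) y := by fun_prop
      have ht : ∀ᶠ y in 𝓝 x, inner ℝ (-x) y < 0 :=
        hc.continuousAt.eventually (eventually_lt_nhds (by beta_reduce; rw [hxx]; norm_num))
      have hw : ∀ᶠ y in 𝓝 x, ‖y - inner ℝ (-x) y • (-x)‖ < 1 / 2 := by
        have hc2 : Continuous fun y : EuclideanSpace ℝ (Fin N) =>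
            ‖y - inner ℝ (-x) y • (-x)‖ := by fun_prop
        refine hc2.continuousAt.eventually (eventually_lt_nhds ?_)
        beta_reduce
        rw [hxx]; simp
      filter_upwards [ht, hw] with y hty hwy
      set t := inner ℝ (-x) y with htdef
      set w := y - t • (-x) with hwdef
      have horth : inner ℝ (-x) w = 0 := by
        rw [hwdef, inner_sub_right, inner_smul_right, real_inner_self_eq_norm_sq, norm_neg, hx]
        simp [htdef]
      have hnorm : ‖y‖ ^ 2 = ‖w‖ ^ 2 + t ^ 2 := by
        have h1 : y = w + t • (-x) := by rw [hwdef]; abel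
        conv_lhs => rw [h1]
        rw [norm_add_sq_real, inner_smul_right, real_inner_comm, horth, norm_smul, norm_neg, hx]
        simp
      have hrw : r w = ‖w‖ := min_eq_left hwy.le
      have h1w : 0 ≤ 1 - ‖w‖ ^ 2 := by nlinarith [norm_nonneg w]
      rw [mem_ball_zero_iff, hrw, neg_lt, Real.lt_sqrt (by linarith)]
      constructor
      · intro h
        have : ‖y‖ ^ 2 < 1 := by nlinarith [norm_nonneg y]
        nlinarith
      · intro h
        have : ‖y‖ ^ 2 < 1 := by nlinarith
        nlinarith [norm_nonneg y]

end LipschitzBall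

/-! ### Anisotropic scaling -/

section Scaling

variable {N n : ℕ} {a : Fin N → ℕ} {t : ℝ}

/-- The side lengths `t^{1/a_i}` of the anisotropic dilation. -/
def aScale (a : Fin N → ℕ) (t : ℝ) (i : Fin N) : ℝ := t ^ ((a i : ℝ)⁻¹)

theorem aScale_pos (ht : 0 < t) (i : Fin N) : 0 < aScale a t i := Real.rpow_pos_of_pos ht _

/-- The anisotropic box with centre `c` and half side lengths `t^{1/a_i}`. -/
def aBox (a : Fin N → ℕ) (c : EuclideanSpace ℝ (Fin N)) (t : ℝ) :
    Set (EuclideanSpace ℝ (Fin N)) := {x | ∀ i, |x i - c i| < aScale a t i}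

theorem mem_aBox {c x : EuclideanSpace ℝ (Fin N)} :
    x ∈ aBox a c t ↔ ∀ i, |x i - c i| < aScale a t i := Iff.rfl

theorem mem_unitCube {x : EuclideanSpace ℝ (Fin N)} : x ∈ unitCube N ↔ ∀ i, |x i| < 1 := Iff.rfl

theorem aBox_eq_preimage (c : EuclideanSpace ℝ (Fin N)) (t : ℝ) :
    aBox a c t = WithLp.ofLp ⁻¹' (Set.univ.pi fun i =>
      Set.Ioo (c i - aScale a t i) (c i + aScale a t i)) := by
  ext x
  simp only [mem_aBox, Set.mem_preimage, Set.mem_univ_pi, Set.mem_Ioo, abs_lt]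
  refine forall_congr' fun i => ?_
  constructor <;> rintro ⟨h1, h2⟩ <;> constructor <;> linarith

theorem volume_ofLp_preimage {s : Set (Fin N → ℝ)} (hs : MeasurableSet s) :
    volume ((WithLp.ofLp : EuclideanSpace ℝ (Fin N) → Fin N → ℝ) ⁻¹' s) = volume s :=
  (PiLp.volume_preserving_ofLp (Fin N)).measure_preimage hs.nullMeasurableSet

theorem volume_aBox (c : EuclideanSpace ℝ (Fin N)) (t : ℝ) :
    volume (aBox a c t) = ∏ i, ENNReal.ofReal (2 * aScale a t i) := by
  rw [aBox_eq_preimage, volume_ofLp_preimage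
    (MeasurableSet.univ_pi fun i => measurableSet_Ioo), Real.volume_pi_Ioo]
  refine Finset.prod_congr rfl fun i _ => ?_
  congr 1
  ring

theorem measureReal_aBox (ht : 0 < t) (c : EuclideanSpace ℝ (Fin N)) :
    volume.real (aBox a c t) = ∏ i, 2 * aScale a t i := by
  rw [measureReal_def, volume_aBox, ENNReal.toReal_prod]
  refine Finset.prod_congr rfl fun i _ => ENNReal.toReal_ofReal ?_
  have := aScale_pos (a := a) ht i
  positivity

theorem measureReal_aBox_pos (ht : 0 < t) (c : EuclideanSpace ℝ (Fin N)) :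
    0 < volume.real (aBox a c t) := by
  rw [measureReal_aBox ht]
  exact Finset.prod_pos fun i _ => mul_pos two_pos (aScale_pos ht i)

theorem isOpen_aBox (c : EuclideanSpace ℝ (Fin N)) (t : ℝ) : IsOpen (aBox a c t) := by
  rw [aBox_eq_preimage]
  exact (isOpen_set_pi Set.finite_univ fun i _ => isOpen_Ioo).preimage
    (PiLp.continuous_ofLp 2 _)

theorem volume_aBox_ne_top (c : EuclideanSpace ℝ (Fin N)) (t : ℝ) : volume (aBox a c t) ≠ ⊤ := by
  rw [volume_aBox]
  exact ENNReal.prod_ne_top fun i _ => ENNReal.ofReal_ne_top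

theorem aBox_zero_one (a : Fin N → ℕ) : aBox a 0 1 = unitCube N := by
  ext x
  simp [mem_aBox, mem_unitCube, aScale]

theorem tendsto_aScale (ha : ∀ i, 1 ≤ a i) (i : Fin N) :
    Tendsto (fun t => aScale a t i) (𝓝[>] 0) (𝓝 0) := by
  have hpos : (0 : ℝ) < (a i : ℝ)⁻¹ := by
    have := ha i
    positivity
  have h : ContinuousAt (fun t : ℝ => t ^ ((a i : ℝ)⁻¹)) 0 :=
    Real.continuousAt_rpow_const 0 _ (Or.inr hpos.le)
  have h2 := h.tendsto
  rw [Real.zero_rpow hpos.ne'] at h2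
  exact h2.mono_left nhdsWithin_le_nhds

/-- The rescaling `x ↦ t φ((x_i - c_i) / t^{1/a_i})` of a bump `φ` to the box `aBox a c t`. -/
def scaledBump (a : Fin N → ℕ) (c : EuclideanSpace ℝ (Fin N)) (t : ℝ)
    (φ : EuclideanSpace ℝ (Fin N) → EuclideanSpace ℝ (Fin n)) :
    EuclideanSpace ℝ (Fin N) → EuclideanSpace ℝ (Fin n) :=
  t • (φ ∘ diagAffine (WithLp.toLp 2 fun i => -(c i * (aScale a t i)⁻¹))
    fun i => (aScale a t i)⁻¹)

/-- The affine change of coordinates mapping `aBox a c t` onto the unit cube. -/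
def boxChart (a : Fin N → ℕ) (c : EuclideanSpace ℝ (Fin N)) (t : ℝ) :
    EuclideanSpace ℝ (Fin N) → EuclideanSpace ℝ (Fin N) :=
  diagAffine (WithLp.toLp 2 fun i => -(c i * (aScale a t i)⁻¹)) fun i => (aScale a t i)⁻¹

theorem boxChart_apply (c x : EuclideanSpace ℝ (Fin N)) (t : ℝ) (i : Fin N) :
    boxChart a c t x i = (x i - c i) / aScale a t i := by
  simp only [boxChart, diagAffine_apply]
  rw [div_eq_mul_inv]
  ring

/-- `boxChart` as a homeomorphism. -/
def boxHomeo (a : Fin N → ℕ) (c : EuclideanSpace ℝ (Fin N)) {t : ℝ} (ht : 0 < t) :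
    EuclideanSpace ℝ (Fin N) ≃ₜ EuclideanSpace ℝ (Fin N) where
  toFun := boxChart a c t
  invFun := diagAffine c (aScale a t)
  left_inv x := by
    ext i
    have := (aScale_pos (a := a) ht i).ne'
    rw [diagAffine_apply, boxChart_apply]
    field_simp
    ring
  right_inv x := by
    ext i
    have := (aScale_pos (a := a) ht i).ne'
    rw [boxChart_apply, diagAffine_apply]
    field_simp
    ring
  continuous_toFun := (contDiff_diagAffine _ _).continuous
  continuous_invFun := (contDiff_diagAffine _ _).continuous

theorem boxChart_preimage_unitCube (ht : 0 < t) (c : EuclideanSpace ℝ (Fin N)) :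
    boxChart a c t ⁻¹' unitCube N = aBox a c t := by
  ext x
  rw [Set.mem_preimage, mem_unitCube, mem_aBox]
  refine forall_congr' fun i => ?_
  have := aScale_pos (a := a) ht i
  rw [boxChart_apply, abs_div, abs_of_pos this, div_lt_one this]

theorem IsTestFunction.scaledBump {φ : EuclideanSpace ℝ (Fin N) → EuclideanSpace ℝ (Fin n)}
    (hφ : IsTestFunction (unitCube N) φ) (ht : 0 < t) (c : EuclideanSpace ℝ (Fin N)) :
    IsTestFunction (aBox a c t) (MixedSmoothness.scaledBump a c t φ) := by
  refine IsTestFunction.const_smul (f := φ ∘ boxChart a c t) ?_ t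
  refine ⟨hφ.smooth.comp (contDiff_diagAffine _ _), ?_, ?_⟩
  · exact hφ.compact.comp_homeomorph (boxHomeo a c ht)
  · have h1 : tsupport (φ ∘ boxChart a c t) = boxChart a c t ⁻¹' tsupport φ :=
      tsupport_comp_eq_preimage φ (boxHomeo a c ht)
    rw [h1, ← boxChart_preimage_unitCube ht]
    exact Set.preimage_mono hφ.support

theorem prod_aScale_inv_pow (ht : 0 < t) {α : Fin N → ℕ} (hα : weight a α = 1) :
    ∏ i, (aScale a t i)⁻¹ ^ α i = t⁻¹ := by
  have h1 : ∑ i, (α i : ℝ) / a i = 1 := by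
    have : ((weight a α : ℚ) : ℝ) = 1 := by exact_mod_cast hα
    simpa [weight] using this
  calc ∏ i, (aScale a t i)⁻¹ ^ α i = ∏ i, t ^ (-((α i : ℝ) / a i)) := by
        refine Finset.prod_congr rfl fun i _ => ?_
        rw [aScale, ← Real.rpow_neg ht.le, ← Real.rpow_natCast, ← Real.rpow_mul ht.le]
        congr 1
        rw [div_eq_inv_mul]
        ring
    _ = t⁻¹ := by
        rw [← Real.rpow_sum_of_pos ht, Finset.sum_neg_distrib, h1, Real.rpow_neg_one]

/-- A derivative of weight one of the rescaled function picks up the factor `t⁻¹`, which the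
prefactor `t` cancels. At every scale the `a`-gradient takes the same values, merely transported by
the chart. -/
theorem smoothAGrad_scaledBump (ha : ∀ i, 1 ≤ a i)
    {φ : EuclideanSpace ℝ (Fin N) → EuclideanSpace ℝ (Fin n)} (hφ : ContDiff ℝ ∞ φ) (ht : 0 < t)
    (c x : EuclideanSpace ℝ (Fin N)) :
    smoothAGrad a (scaledBump a c t φ) x = smoothAGrad a φ (boxChart a c t x) := by
  ext α : 1
  change pderiv (α : Fin N → ℕ) (scaledBump a c t φ) x = pderiv (α : Fin N → ℕ) φ _
  rw [scaledBump, pderiv_const_smul (hφ.comp (contDiff_diagAffine _ _)),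
    pderiv_comp_diagAffine hφ, prod_aScale_inv_pow ht ((mem_topIdx ha).1 α.2), smul_smul,
    mul_inv_cancel₀ ht.ne', one_smul]
  rfl

/-- The linear part of `boxChart`. -/
def diagLinearEquiv (s : Fin N → ℝ) (hs : ∀ i, s i ≠ 0) :
    EuclideanSpace ℝ (Fin N) ≃ₗ[ℝ] EuclideanSpace ℝ (Fin N) where
  toFun x := WithLp.toLp 2 fun i => s i * x i
  invFun x := WithLp.toLp 2 fun i => (s i)⁻¹ * x i
  left_inv x := by ext i; simp [hs i]
  right_inv x := by ext i; simp [hs i]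
  map_add' x y := by ext i; simp [mul_add]
  map_smul' c x := by ext i; simp; ring

/-- The value of `κ` is irrelevant: `setIntegral_comp_boxChart` recovers it by comparing the volumes
of the box and the cube. -/
theorem exists_map_boxChart (ht : 0 < t) (c : EuclideanSpace ℝ (Fin N)) :
    ∃ κ : ℝ≥0∞, volume.map (boxChart a c t) = κ • volume := by
  set s : Fin N → ℝ := fun i => (aScale a t i)⁻¹ with hs
  have hs0 : ∀ i, s i ≠ 0 := fun i => inv_ne_zero (aScale_pos ht i).ne'
  set L := (diagLinearEquiv s hs0 : EuclideanSpace ℝ (Fin N) →ₗ[ℝ] EuclideanSpace ℝ (Fin N))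
    with hL
  set b : EuclideanSpace ℝ (Fin N) := WithLp.toLp 2 fun i => -(c i * (aScale a t i)⁻¹) with hb
  have hdet : LinearMap.det L ≠ 0 := (diagLinearEquiv s hs0).isUnit_det'.ne_zero
  have h1 : boxChart a c t = (fun y => b + y) ∘ L := by
    funext x; ext i; rfl
  refine ⟨ENNReal.ofReal |(LinearMap.det L)⁻¹|, ?_⟩
  rw [h1, ← Measure.map_map (measurable_const_add b)
    L.continuous_of_finiteDimensional.measurable,
    Measure.map_linearMap_addHaar_eq_smul_addHaar _ hdet, Measure.map_smul,
    map_add_left_eq_self]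

theorem measurableSet_unitCube (N : ℕ) : MeasurableSet (unitCube N) := by
  rw [← aBox_zero_one (fun _ => 1)]
  exact (isOpen_aBox _ _).measurableSet

theorem measureReal_unitCube_pos (N : ℕ) : 0 < volume.real (unitCube N) := by
  rw [← aBox_zero_one (fun _ => 1)]
  exact measureReal_aBox_pos one_pos _

/-- Averages over the unit cube as integrals over an anisotropic box. -/
theorem setIntegral_comp_boxChart (ht : 0 < t) (c : EuclideanSpace ℝ (Fin N))
    (H : EuclideanSpace ℝ (Fin N) → ℝ) :
    ∫ x in aBox a c t, H (boxChart a c t x) =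
      volume.real (aBox a c t) * ⨍ x in unitCube N, H x := by
  obtain ⟨κ, hκ⟩ := exists_map_boxChart (a := a) ht c
  have hemb : MeasurableEmbedding (boxChart a c t) := (boxHomeo a c ht).measurableEmbedding
  have h1 := hemb.setIntegral_map (μ := volume) H (unitCube N)
  rw [boxChart_preimage_unitCube ht, hκ, Measure.restrict_smul, integral_smul_measure] at h1
  have h2 : volume.real (aBox a c t) = κ.toReal * volume.real (unitCube N) := by
    have h3 := hemb.map_apply volume (unitCube N)
    rw [boxChart_preimage_unitCube ht, hκ] at h3
    rw [measureReal_def, ← h3, Measure.smul_apply, smul_eq_mul, ENNReal.toReal_mul,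
      measureReal_def]
  rw [← h1, h2, setAverage_eq, smul_eq_mul, smul_eq_mul]
  have := (measureReal_unitCube_pos N).ne'
  field_simp

theorem setIntegral_smoothAGrad_scaledBump (ha : ∀ i, 1 ≤ a i)
    {φ : EuclideanSpace ℝ (Fin N) → EuclideanSpace ℝ (Fin n)} (hφ : ContDiff ℝ ∞ φ) (ht : 0 < t)
    (c : EuclideanSpace ℝ (Fin N)) (G : GradSpace a n → ℝ) (X : GradSpace a n) :
    ∫ x in aBox a c t, G (X + smoothAGrad a (scaledBump a c t φ) x) =
      volume.real (aBox a c t) * ⨍ x in unitCube N, G (X + smoothAGrad a φ x) := by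
  simp only [smoothAGrad_scaledBump ha hφ ht]
  exact setIntegral_comp_boxChart ht c fun y => G (X + smoothAGrad a φ y)

theorem integrableOn_comp_smoothAGrad {G : GradSpace a n → ℝ} (hG : Continuous G)
    {φ : EuclideanSpace ℝ (Fin N) → EuclideanSpace ℝ (Fin n)} {U : Set (EuclideanSpace ℝ (Fin N))}
    (hφ : IsTestFunction U φ) (X : GradSpace a n) {A : Set (EuclideanSpace ℝ (Fin N))}
    (hA : volume A ≠ ⊤) : IntegrableOn (fun x => G (X + smoothAGrad a φ x)) A := by
  obtain ⟨K, _, hK⟩ := hφ.exists_norm_smoothAGrad_le a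
  obtain ⟨M, hM⟩ := (isCompact_closedBall (0 : GradSpace a n) (‖X‖ + K)).exists_bound_of_continuousOn
    hG.continuousOn
  have : IsFiniteMeasure (volume.restrict A) := ⟨by simpa using hA.lt_top⟩
  refine Integrable.of_bound (hG.comp (continuous_const.add
    (continuous_smoothAGrad hφ.smooth))).aestronglyMeasurable M (Eventually.of_forall fun x => ?_)
  refine hM _ ?_
  rw [mem_closedBall_zero_iff]
  exact (norm_add_le _ _).trans (by gcongr; exact hK x)

/-- A bump can be replaced by one that is active only on a small fraction `θ` of the cube. -/
theorem exists_scaled_test (hN : 1 ≤ N) (ha : ∀ i, 1 ≤ a i) {θ₀ : ℝ} (hθ₀ : 0 < θ₀) :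
    ∃ t θ : ℝ, 0 < t ∧ 0 < θ ∧ θ ≤ θ₀ ∧ aBox a 0 t ⊆ unitCube N ∧
      ∀ φ : EuclideanSpace ℝ (Fin N) → EuclideanSpace ℝ (Fin n), IsTestFunction (unitCube N) φ →
      ∀ G : GradSpace a n → ℝ, Continuous G → ∀ X : GradSpace a n,
        ⨍ x in unitCube N, G (X + smoothAGrad a (scaledBump a 0 t φ) x) =
          G X + θ * ((⨍ x in unitCube N, G (X + smoothAGrad a φ x)) - G X) := by
  have hQ := measureReal_unitCube_pos N
  have hlim : Tendsto (fun t => (∏ i, 2 * aScale a t i) / volume.real (unitCube N))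
      (𝓝[>] 0) (𝓝 0) := by
    have h1 : Tendsto (fun t => ∏ i, 2 * aScale a t i) (𝓝[>] 0) (𝓝 (∏ _i : Fin N, 2 * (0 : ℝ))) :=
      tendsto_finsetProd _ fun i _ => (tendsto_aScale ha i).const_mul 2
    have h2 : (∏ _i : Fin N, 2 * (0 : ℝ)) = 0 := by
      simp [Nat.one_le_iff_ne_zero.1 hN]
    rw [h2] at h1
    simpa using h1.div_const (volume.real (unitCube N))
  have hsub : ∀ᶠ t in 𝓝[>] (0 : ℝ), t ≤ 1 :=
    (eventually_le_nhds one_pos).filter_mono nhdsWithin_le_nhds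
  obtain ⟨t, ⟨h1, h2⟩, ht⟩ := ((hlim.eventually (eventually_le_nhds hθ₀)).and hsub
    |>.and self_mem_nhdsWithin).exists
  have ht : 0 < t := ht
  rw [← measureReal_aBox ht 0] at h1
  have hbox : aBox a 0 t ⊆ unitCube N := by
    rw [← aBox_zero_one a]
    intro x hx i
    refine (hx i).trans_le ?_
    exact Real.rpow_le_rpow ht.le h2 (by positivity)
  -- `θ` is the volume fraction of the box. Inside the box the old average is reproduced, and in the
  -- rest of the cube the integrand is the constant `G X`.
  refine ⟨t, volume.real (aBox a 0 t) / volume.real (unitCube N), ht,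
    div_pos (measureReal_aBox_pos ht 0) hQ, h1, hbox, fun φ hφ G hG X => ?_⟩
  have hb := hφ.scaledBump (a := a) ht 0
  have hQt : volume (unitCube N) ≠ ⊤ := by
    rw [← aBox_zero_one a]; exact volume_aBox_ne_top _ _
  have hintg := integrableOn_comp_smoothAGrad hG hb X hQt
  have hsplit := setIntegral_sdiff (isOpen_aBox (a := a) 0 t).measurableSet hintg hbox
  have hout : ∫ x in unitCube N \ aBox a 0 t, G (X + smoothAGrad a (scaledBump a 0 t φ) x) =
      (volume.real (unitCube N) - volume.real (aBox a 0 t)) * G X := by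
    rw [setIntegral_congr_fun (g := fun _ => G X)
      ((measurableSet_unitCube N).diff (isOpen_aBox (a := a) 0 t).measurableSet)
      (fun x hx => by simp only [hb.smoothAGrad_eq_zero hx.2, add_zero]), setIntegral_const,
      smul_eq_mul, measureReal_sdiff hbox (isOpen_aBox (a := a) 0 t).measurableSet]
  rw [hout, setIntegral_smoothAGrad_scaledBump ha hφ.smooth ht] at hsplit
  rw [setAverage_eq, smul_eq_mul]
  rw [eq_sub_iff_add_eq] at hsplit
  rw [← hsplit]
  field_simp
  ring

end Scaling

/-! ### Bumps on an anisotropic grid -/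

section Grid

variable {N n : ℕ} {a : Fin N → ℕ} {t : ℝ}

/-- The index of the cell of the anisotropic grid that contains `x`. -/
def gridIdx (a : Fin N → ℕ) (t : ℝ) (x : EuclideanSpace ℝ (Fin N)) : Fin N → ℤ :=
  fun i => ⌊x i / (2 * aScale a t i)⌋

/-- The centre of a cell of the anisotropic grid. -/
def gridCentre (a : Fin N → ℕ) (t : ℝ) (k : Fin N → ℤ) : EuclideanSpace ℝ (Fin N) :=
  WithLp.toLp 2 fun i => (2 * k i + 1) * aScale a t i

/-- The (half open) cells of the anisotropic grid. -/
def gridCell (a : Fin N → ℕ) (t : ℝ) (k : Fin N → ℤ) : Set (EuclideanSpace ℝ (Fin N)) :=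
  {x | gridIdx a t x = k}

theorem mem_gridCell {k : Fin N → ℤ} {x : EuclideanSpace ℝ (Fin N)} :
    x ∈ gridCell a t k ↔ gridIdx a t x = k := Iff.rfl

theorem mem_gridCell_iff (ht : 0 < t) {k : Fin N → ℤ} {x : EuclideanSpace ℝ (Fin N)} :
    x ∈ gridCell a t k ↔
      ∀ i, k i * (2 * aScale a t i) ≤ x i ∧ x i < (k i + 1) * (2 * aScale a t i) := by
  rw [mem_gridCell, funext_iff]
  refine forall_congr' fun i => ?_
  have h := mul_pos two_pos (aScale_pos (a := a) ht i)
  rw [gridIdx, Int.floor_eq_iff, le_div_iff₀ h, div_lt_iff₀ h]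

theorem gridCell_eq_preimage (ht : 0 < t) (k : Fin N → ℤ) :
    gridCell a t k = WithLp.ofLp ⁻¹' (Set.univ.pi fun i =>
      Set.Ico (k i * (2 * aScale a t i)) ((k i + 1) * (2 * aScale a t i))) := by
  ext x
  simp only [mem_gridCell_iff ht, Set.mem_preimage, Set.mem_univ_pi, Set.mem_Ico]

theorem measurableSet_gridCell (ht : 0 < t) (k : Fin N → ℤ) :
    MeasurableSet (gridCell a t k) := by
  rw [gridCell_eq_preimage ht]
  exact (MeasurableSet.univ_pi fun i => measurableSet_Ico).preimage
    (PiLp.continuous_ofLp 2 _).measurable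

theorem volume_gridCell (ht : 0 < t) (k : Fin N → ℤ) :
    volume (gridCell a t k) = volume (aBox a (gridCentre a t k) t) := by
  rw [gridCell_eq_preimage ht, volume_ofLp_preimage
    (MeasurableSet.univ_pi fun i => measurableSet_Ico), Real.volume_pi_Ico, volume_aBox]
  refine Finset.prod_congr rfl fun i _ => ?_
  congr 1
  ring

/-- The open box is the interior of the half open cell and has the same volume. The cells partition
space exactly, while the boxes carry the bumps. -/
theorem aBox_gridCentre_subset (ht : 0 < t) (k : Fin N → ℤ) :
    aBox a (gridCentre a t k) t ⊆ gridCell a t k := by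
  intro x hx
  rw [mem_gridCell_iff ht]
  intro i
  have h := abs_lt.1 (hx i)
  simp only [gridCentre] at h
  constructor <;> nlinarith [h.1, h.2]

theorem gridCentre_mem_gridCell (ht : 0 < t) (k : Fin N → ℤ) :
    gridCentre a t k ∈ gridCell a t k :=
  aBox_gridCentre_subset ht k fun i => by simpa using aScale_pos ht i

theorem dist_le_of_mem_gridCell (ht : 0 < t) {k : Fin N → ℤ} {x y : EuclideanSpace ℝ (Fin N)}
    (hx : x ∈ gridCell a t k) (hy : y ∈ gridCell a t k) :
    dist x y ≤ ∑ i, 2 * aScale a t i := by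
  rw [dist_eq_norm, EuclideanSpace.norm_eq]
  have h : ∀ i, ‖(x - y) i‖ ≤ 2 * aScale a t i := by
    intro i
    have h1 := (mem_gridCell_iff ht).1 hx i
    have h2 := (mem_gridCell_iff ht).1 hy i
    rw [PiLp.sub_apply, Real.norm_eq_abs, abs_le]
    constructor <;> nlinarith [h1.1, h1.2, h2.1, h2.2]
  refine (Real.sqrt_le_iff.2 ⟨Finset.sum_nonneg fun i _ => norm_nonneg _, ?_⟩).trans
    (Finset.sum_le_sum fun i _ => h i)
  exact Finset.sum_sq_le_sq_sum_of_nonneg fun i _ => norm_nonneg _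

theorem tendsto_sum_aScale (ha : ∀ i, 1 ≤ a i) :
    Tendsto (fun t => ∑ i, 2 * aScale a t i) (𝓝[>] 0) (𝓝 0) := by
  simpa using tendsto_finsetSum Finset.univ fun i _ => (tendsto_aScale ha i).const_mul 2

theorem disjoint_gridCell {k l : Fin N → ℤ} (h : k ≠ l) :
    Disjoint (gridCell a t k) (gridCell a t l) :=
  Set.disjoint_left.2 fun _ hx hy => h (hx.symm.trans hy)

theorem finite_gridCell_subset (ht : 0 < t) {Ω : Set (EuclideanSpace ℝ (Fin N))}
    (hb : Bornology.IsBounded Ω) : {k | gridCell a t k ⊆ Ω}.Finite := by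
  obtain ⟨r, hr⟩ := hb.exists_norm_le
  refine (Set.finite_Icc (fun i => ⌊-r / (2 * aScale a t i)⌋)
    fun i => ⌊r / (2 * aScale a t i)⌋).subset fun k hk => ?_
  have hc := gridCentre_mem_gridCell (a := a) ht k
  have hn := hr _ (hk hc)
  rw [← mem_gridCell.1 hc]
  have h : ∀ i, |gridCentre a t k i| ≤ r := fun i => (PiLp.norm_apply_le _ i).trans hn
  constructor <;> intro i <;> refine Int.floor_le_floor ?_ <;>
    refine div_le_div_of_nonneg_right ?_ (mul_pos two_pos (aScale_pos ht i)).le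
  · exact (abs_le.1 (h i)).1
  · exact (abs_le.1 (h i)).2

theorem measurable_gridIdx : Measurable (gridIdx a t) := by
  refine measurable_pi_lambda _ fun i => Int.measurable_floor.comp ?_
  fun_prop

/-- The sum of the bumps `σ k`, rescaled to the cells `k ∈ T` of the grid. -/
def gridBump (a : Fin N → ℕ) (t : ℝ) (T : Finset (Fin N → ℤ))
    (σ : (Fin N → ℤ) → EuclideanSpace ℝ (Fin N) → EuclideanSpace ℝ (Fin n)) :
    EuclideanSpace ℝ (Fin N) → EuclideanSpace ℝ (Fin n) :=
  ∑ k ∈ T, scaledBump a (gridCentre a t k) t (σ k)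

variable {T : Finset (Fin N → ℤ)}
  {σ : (Fin N → ℤ) → EuclideanSpace ℝ (Fin N) → EuclideanSpace ℝ (Fin n)}

theorem isTestFunction_gridBump (ht : 0 < t) (hσ : ∀ k, IsTestFunction (unitCube N) (σ k))
    {Ω : Set (EuclideanSpace ℝ (Fin N))} (hT : ∀ k ∈ T, gridCell a t k ⊆ Ω) :
    IsTestFunction Ω (gridBump a t T σ) :=
  IsTestFunction.sum T fun k hk => ((hσ k).scaledBump ht _).mono
    ((aBox_gridCentre_subset ht k).trans (hT k hk))

theorem smoothAGrad_gridBump (ht : 0 < t) (hσ : ∀ k, IsTestFunction (unitCube N) (σ k))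
    (x : EuclideanSpace ℝ (Fin N)) :
    smoothAGrad a (gridBump a t T σ) x =
      ∑ k ∈ T, smoothAGrad a (scaledBump a (gridCentre a t k) t (σ k)) x := by
  ext α : 1
  have h1 := pderiv_sum T (f := fun k => scaledBump a (gridCentre a t k) t (σ k))
    (fun k _ => ((hσ k).scaledBump (a := a) ht _).smooth) (α : Fin N → ℕ)
  have h2 : (∑ k ∈ T, smoothAGrad a (scaledBump a (gridCentre a t k) t (σ k)) x) α =
      ∑ k ∈ T, pderiv (α : Fin N → ℕ) (scaledBump a (gridCentre a t k) t (σ k)) x := by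
    rw [WithLp.ofLp_sum, Finset.sum_apply]
    rfl
  rw [h2, ← Finset.sum_apply, ← h1]
  rfl

theorem smoothAGrad_gridBump_of_mem (ht : 0 < t) (hσ : ∀ k, IsTestFunction (unitCube N) (σ k))
    {k : Fin N → ℤ} (hk : k ∈ T) {x : EuclideanSpace ℝ (Fin N)} (hx : x ∈ gridCell a t k) :
    smoothAGrad a (gridBump a t T σ) x =
      smoothAGrad a (scaledBump a (gridCentre a t k) t (σ k)) x := by
  rw [smoothAGrad_gridBump ht hσ]
  refine Finset.sum_eq_single_of_mem k hk fun l _ hl => ?_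
  refine ((hσ l).scaledBump ht _).smoothAGrad_eq_zero fun hxl => ?_
  exact Set.disjoint_left.1 (disjoint_gridCell hl) (aBox_gridCentre_subset ht l hxl) hx

theorem smoothAGrad_gridBump_of_notMem (ht : 0 < t) (hσ : ∀ k, IsTestFunction (unitCube N) (σ k))
    {x : EuclideanSpace ℝ (Fin N)} (hx : ∀ k ∈ T, x ∉ aBox a (gridCentre a t k) t) :
    smoothAGrad a (gridBump a t T σ) x = 0 := by
  rw [smoothAGrad_gridBump ht hσ]
  exact Finset.sum_eq_zero fun k hk => ((hσ k).scaledBump ht _).smoothAGrad_eq_zero (hx k hk)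

theorem norm_smoothAGrad_gridBump_le (ha : ∀ i, 1 ≤ a i) (ht : 0 < t)
    (hσ : ∀ k, IsTestFunction (unitCube N) (σ k)) {K : ℝ} (hK0 : 0 ≤ K)
    (hK : ∀ k x, ‖smoothAGrad a (σ k) x‖ ≤ K) (x : EuclideanSpace ℝ (Fin N)) :
    ‖smoothAGrad a (gridBump a t T σ) x‖ ≤ K := by
  by_cases hx : ∃ k ∈ T, x ∈ aBox a (gridCentre a t k) t
  · obtain ⟨k, hk, hxk⟩ := hx
    rw [smoothAGrad_gridBump_of_mem ht hσ hk (aBox_gridCentre_subset ht k hxk),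
      smoothAGrad_scaledBump ha (hσ k).smooth ht]
    exact hK _ _
  · push Not at hx
    rw [smoothAGrad_gridBump_of_notMem ht hσ hx, norm_zero]
    exact hK0

/-- The change of the energy of a field constant on grid cells when bumps are inserted. -/
theorem setIntegral_gridBump_sub (ha : ∀ i, 1 ≤ a i) (ht : 0 < t)
    (hσ : ∀ k, IsTestFunction (unitCube N) (σ k)) {Ω : Set (EuclideanSpace ℝ (Fin N))}
    (hΩ : IsOpen Ω) (hT : ∀ k ∈ T, gridCell a t k ⊆ Ω) {G : GradSpace a n → ℝ}
    (hG : Continuous G) (X : (Fin N → ℤ) → GradSpace a n) :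
    ∫ x in Ω, (G (X (gridIdx a t x) + smoothAGrad a (gridBump a t T σ) x) -
        G (X (gridIdx a t x))) =
      ∑ k ∈ T, volume.real (gridCell a t k) *
        ((⨍ x in unitCube N, G (X k + smoothAGrad a (σ k) x)) - G (X k)) := by
  set B : (Fin N → ℤ) → Set (EuclideanSpace ℝ (Fin N)) := fun k => aBox a (gridCentre a t k) t
    with hB
  have hBm : ∀ k, MeasurableSet (B k) := fun k => (isOpen_aBox _ _).measurableSet
  have hsub : (⋃ k ∈ T, B k) ⊆ Ω :=
    Set.iUnion₂_subset fun k hk => (aBox_gridCentre_subset ht k).trans (hT k hk)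
  have heq : ∀ k ∈ T, Set.EqOn (fun x => G (X (gridIdx a t x) +
      smoothAGrad a (gridBump a t T σ) x) - G (X (gridIdx a t x)))
      (fun x => G (X k + smoothAGrad a (scaledBump a (gridCentre a t k) t (σ k)) x) - G (X k))
      (B k) := by
    intro k hk x hx
    have hx' := aBox_gridCentre_subset ht k hx
    simp only [mem_gridCell.1 hx', smoothAGrad_gridBump_of_mem ht hσ hk hx']
  have hintg : ∀ k, IntegrableOn
      (fun x => G (X k + smoothAGrad a (scaledBump a (gridCentre a t k) t (σ k)) x)) (B k) :=
    fun k => integrableOn_comp_smoothAGrad hG ((hσ k).scaledBump (a := a) ht _) _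
      (volume_aBox_ne_top _ _)
  have hconst : ∀ k, IntegrableOn (fun _ => G (X k)) (B k) := fun k =>
    integrableOn_const (volume_aBox_ne_top _ _)
  -- Off the disjoint boxes every bump vanishes and so does the integrand; on each box scaling turns
  -- the integral into an average over the cube.
  rw [setIntegral_eq_of_subset_of_forall_sdiff_eq_zero hΩ.measurableSet hsub fun x hx => ?_,
    integral_biUnion_finset T (fun k _ => hBm k) ?_ fun k hk =>
      (integrableOn_congr_fun (heq k hk) (hBm k)).2 ((hintg k).sub (hconst k))]
  · refine Finset.sum_congr rfl fun k hk => ?_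
    rw [setIntegral_congr_fun (hBm k) (heq k hk), integral_sub (hintg k) (hconst k),
      setIntegral_smoothAGrad_scaledBump ha (hσ k).smooth ht, setIntegral_const, smul_eq_mul,
      measureReal_def, measureReal_def, volume_gridCell ht, ← mul_sub]
  · intro k _ l _ hkl
    exact (disjoint_gridCell hkl).mono (aBox_gridCentre_subset ht k) (aBox_gridCentre_subset ht l)
  · rw [smoothAGrad_gridBump_of_notMem ht hσ, add_zero, sub_self]
    intro k hk hxk
    exact hx.2 (Set.mem_iUnion₂.2 ⟨k, hk, hxk⟩)

end Grid

/-! ### Inserting bumps into an `L^p` field -/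

section Insertion

variable {N n : ℕ} {a : Fin N → ℕ} {p : ℝ} {Ω : Set (EuclideanSpace ℝ (Fin N))}

theorem measureReal_one_le_norm_le {W : Type*} [NormedAddCommGroup W] {Y : Type*}
    [MeasurableSpace Y] {μ : Measure Y} (hp : 1 ≤ p) {f : Y → W}
    (hf : AEStronglyMeasurable f μ) {ε : ℝ} (hε : 0 < ε)
    (h : eLpNorm f (ENNReal.ofReal p) μ ≤ ENNReal.ofReal (ε ^ p⁻¹)) :
    μ.real {x | 1 ≤ ‖f x‖} ≤ ε := by
  have hp0 : 0 < p := by linarith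
  have h1 := mul_meas_ge_le_pow_eLpNorm' μ (p := ENNReal.ofReal p) (by simpa using hp0)
    ENNReal.ofReal_ne_top hf 1
  rw [ENNReal.one_rpow, one_mul, ENNReal.toReal_ofReal hp0.le] at h1
  have h2 : {x | 1 ≤ ‖f x‖} = {x | 1 ≤ ‖f x‖ₑ} := by
    ext x
    simp [← ofReal_norm, ENNReal.one_le_ofReal]
  rw [h2]
  refine ENNReal.toReal_le_of_le_ofReal hε.le (h1.trans ?_)
  calc eLpNorm f (ENNReal.ofReal p) μ ^ p ≤ ENNReal.ofReal (ε ^ p⁻¹) ^ p := by gcongr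
    _ = ENNReal.ofReal ε := by
      rw [ENNReal.ofReal_rpow_of_pos (by positivity), ← Real.rpow_mul hε.le,
        inv_mul_cancel₀ hp0.ne', Real.rpow_one]

/-- An `L^p` field is approximated by fields that are constant on the cells of a fine grid; most
of a given bounded open set is covered by cells contained in it. -/
theorem exists_grid_approx (ha : ∀ i, 1 ≤ a i) (hp : 1 ≤ p) (hΩ : IsOpen Ω)
    (hb : Bornology.IsBounded Ω) {v : EuclideanSpace ℝ (Fin N) → GradSpace a n}
    (hv : MemLp v (ENNReal.ofReal p) (volume.restrict Ω)) {δ ε : ℝ} (hδ : 0 < δ) (hε : 0 < ε) :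
    ∃ t : ℝ, 0 < t ∧ ∃ X : (Fin N → ℤ) → GradSpace a n,
      MemLp (fun x => X (gridIdx a t x)) (ENNReal.ofReal p) (volume.restrict Ω) ∧
      eLpNorm ((fun x => X (gridIdx a t x)) - v) (ENNReal.ofReal p) (volume.restrict Ω) ≤
        ENNReal.ofReal δ ∧
      ∃ K ⊆ Ω, MeasurableSet K ∧ volume.real (Ω \ K) ≤ ε ∧
        ∀ x ∈ K, gridCell a t (gridIdx a t x) ⊆ Ω := by
  have hfin := isFiniteMeasure_restrict_of_isBounded hb
  have hp1 := one_le_ofReal hp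
  have hpt : ENNReal.ofReal p ≠ ⊤ := ENNReal.ofReal_ne_top
  have hvol : volume Ω ≠ ⊤ := hb.measure_lt_top.ne
  have hδ2 : ENNReal.ofReal (δ / 2) ≠ 0 := (ENNReal.ofReal_pos.2 (half_pos hδ)).ne'
  have hv' : MemLp (Ω.indicator v) (ENNReal.ofReal p) volume :=
    (memLp_indicator_iff_restrict hΩ.measurableSet).2 hv
  -- The cell values will be those of a continuous, compactly supported approximation `f` at the
  -- cell centres; uniform continuity of `f` controls the error on a fine mesh.
  obtain ⟨f, hfc, hfv, hfcont, hfL⟩ := hv'.exists_hasCompactSupport_eLpNorm_sub_le hpt hδ2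
  have hfv' : eLpNorm (f - v) (ENNReal.ofReal p) (volume.restrict Ω) ≤ ENNReal.ofReal (δ / 2) := by
    refine le_trans (le_of_eq ?_) ((eLpNorm_mono_measure _ (Measure.restrict_le_self (s := Ω))).trans hfv)
    rw [eLpNorm_sub_comm]
    refine eLpNorm_congr_ae ?_
    filter_upwards [ae_restrict_mem hΩ.measurableSet] with x hx
    simp [hx]
  set A : ℝ := ((volume.restrict Ω) Set.univ ^ (ENNReal.ofReal p).toReal⁻¹).toReal with hA
  have hA0 : 0 ≤ A := ENNReal.toReal_nonneg
  obtain ⟨η, hη, hηA⟩ : ∃ η : ℝ, 0 < η ∧ A * η ≤ δ / 2 := by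
    refine ⟨δ / 2 / (A + 1), by positivity, ?_⟩
    rw [mul_div_assoc', div_le_iff₀ (by positivity)]
    nlinarith
  obtain ⟨ρ, hρ, hfρ⟩ := Metric.uniformContinuous_iff.1
    (hfc.uniformContinuous_of_continuous hfcont) η hη
  -- Inner regularity gives a compact set that misses little of `Ω`. A mesh below a thickening
  -- radius that stays in `Ω` keeps every cell meeting this set inside `Ω`.
  obtain ⟨K, hKΩ, hKc, hKε⟩ := hΩ.measurableSet.exists_isCompact_sdiff_lt hvol
    (ε := ENNReal.ofReal ε) (by simpa using hε)
  obtain ⟨r, hr, hrΩ⟩ := hKc.exists_cthickening_subset_open hΩ hKΩ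
  obtain ⟨t, hmesh, ht⟩ := (((tendsto_sum_aScale ha).eventually
    (eventually_lt_nhds (lt_min hρ hr))).and self_mem_nhdsWithin).exists
  have ht : 0 < t := ht
  have hmem : ∀ x, x ∈ gridCell a t (gridIdx a t x) := fun x => rfl
  refine ⟨t, ht, fun k => f (gridCentre a t k), ?_, ?_, K, hKΩ, hKc.measurableSet, ?_, ?_⟩
  · obtain ⟨M, hM⟩ := hfc.exists_bound_of_continuous hfcont
    refine MemLp.of_bound ?_ M (Eventually.of_forall fun x => hM _)
    exact (measurable_of_countable (fun k => f (gridCentre a t k))).comp measurable_gridIdx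
      |>.aestronglyMeasurable
  · have h1 : eLpNorm ((fun x => f (gridCentre a t (gridIdx a t x))) - f) (ENNReal.ofReal p)
        (volume.restrict Ω) ≤ ENNReal.ofReal (δ / 2) := by
      refine (eLpNorm_le_of_ae_bound (C := η) (Eventually.of_forall fun x => ?_)).trans ?_
      · rw [Pi.sub_apply, ← dist_eq_norm]
        refine (hfρ ((dist_le_of_mem_gridCell ht (gridCentre_mem_gridCell ht _)
          (hmem x)).trans_lt (hmesh.trans_le (min_le_left _ _)))).le
      · rw [← ENNReal.ofReal_toReal (a := (volume.restrict Ω) Set.univ ^ _) (by finiteness),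
          ← ENNReal.ofReal_mul hA0]
        exact ENNReal.ofReal_le_ofReal hηA
    have h2 : (fun x => f (gridCentre a t (gridIdx a t x))) - v =
        ((fun x => f (gridCentre a t (gridIdx a t x))) - f) + (f - v) := by abel
    have hm : AEStronglyMeasurable (fun x => f (gridCentre a t (gridIdx a t x)))
        (volume.restrict Ω) :=
      (measurable_of_countable (fun k => f (gridCentre a t k))).comp measurable_gridIdx
        |>.aestronglyMeasurable
    rw [h2]
    refine (eLpNorm_add_le (hm.sub hfcont.aestronglyMeasurable)
      (hfcont.aestronglyMeasurable.sub hv.1) hp1).trans ((add_le_add h1 hfv').trans ?_)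
    rw [← ENNReal.ofReal_add (by positivity) (by positivity), add_halves]
  · exact ENNReal.toReal_le_of_le_ofReal hε.le hKε.le
  · intro x hx y hy
    refine hrΩ (Metric.mem_cthickening_of_dist_le y x r K hx ?_)
    exact (dist_le_of_mem_gridCell ht hy (hmem x)).trans (hmesh.le.trans (min_le_right _ _))

/-- Bumps `τ X`, which change the mean values of the functions `G i` at `X` by at most `κ i`, can
be inserted into an `L^p` field `v` on most of the set where `‖v‖` is not large. -/
theorem exists_test_insertion (ha : ∀ i, 1 ≤ a i) (hp : 1 ≤ p) (hΩ : IsOpen Ω)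
    (hb : Bornology.IsBounded Ω) {v : EuclideanSpace ℝ (Fin N) → GradSpace a n}
    (hv : MemLp v (ENNReal.ofReal p) (volume.restrict Ω)) {G : Fin 2 → GradSpace a n → ℝ}
    (hG : ∀ i, Continuous (G i)) {C : Fin 2 → ℝ} (hC : ∀ i, 0 < C i)
    (hgrowth : ∀ i X, |G i X| ≤ C i * (‖X‖ ^ p + 1)) {R K : ℝ} (hK0 : 0 ≤ K)
    {τ : GradSpace a n → EuclideanSpace ℝ (Fin N) → EuclideanSpace ℝ (Fin n)}
    (hτ : ∀ X, IsTestFunction (unitCube N) (τ X)) (hτR : ∀ X, R < ‖X‖ → τ X = 0)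
    (hτK : ∀ X x, ‖smoothAGrad a (τ X) x‖ ≤ K) {κ : Fin 2 → ℝ}
    (hκ : ∀ i X, ‖X‖ ≤ R → ⨍ x in unitCube N, G i (X + smoothAGrad a (τ X) x) ≤ G i X + κ i)
    {ε : ℝ} (hε : 0 < ε) :
    ∃ ψ : EuclideanSpace ℝ (Fin N) → EuclideanSpace ℝ (Fin n), IsTestFunction Ω ψ ∧
      ∃ m : ℝ, (volume.restrict Ω).real {x | ‖v x‖ ≤ R - 1} - ε ≤ m ∧ m ≤ volume.real Ω ∧
        0 ≤ m ∧ ∀ i, ∫ x in Ω, G i (v x + smoothAGrad a ψ x) ≤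
          (∫ x in Ω, G i (v x)) + κ i * m + ε := by
  have hfin := isFiniteMeasure_restrict_of_isBounded hb
  have hvol : volume Ω ≠ ⊤ := hb.measure_lt_top.ne
  have hε2 : 0 < ε / 2 := by positivity
  choose δ hδ hnem using fun i =>
    exists_integral_abs_sub_le hp (hG i) (hC i) (hgrowth i) K hv hε2
  have hε3 : 0 < (ε / 2) ^ p⁻¹ := by positivity
  -- Two of the bounds on `w - v` serve the two superposition estimates. The third feeds Chebyshev's
  -- inequality: `‖w - v‖ < 1` off a set of measure `ε / 2`, which accounts for `R - 1` in place of
  -- `R`.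
  obtain ⟨t, ht, X, hXL, hXv, A, hAΩ, hAm, hAε, hAcell⟩ := exists_grid_approx ha hp hΩ hb hv
    (lt_min (lt_min (hδ 0) (hδ 1)) hε3) hε2
  set w : EuclideanSpace ℝ (Fin N) → GradSpace a n := fun x => X (gridIdx a t x) with hw
  have hδi : ∀ i, eLpNorm (w - v) (ENNReal.ofReal p) (volume.restrict Ω) ≤
      ENNReal.ofReal (δ i) := by
    intro i
    refine hXv.trans (ENNReal.ofReal_le_ofReal ((min_le_left _ _).trans ?_))
    fin_cases i
    · exact min_le_left _ _
    · exact min_le_right _ _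
  have hcheb := measureReal_one_le_norm_le hp (hXL.1.sub hv.1) hε2
    (hXv.trans (ENNReal.ofReal_le_ofReal (min_le_right _ _)))
  set T := (finite_gridCell_subset (a := a) ht hb).toFinset with hTdef
  have hT : ∀ k ∈ T, gridCell a t k ⊆ Ω := fun k hk => (Set.Finite.mem_toFinset _).1 hk
  have hσ : ∀ k, IsTestFunction (unitCube N) (τ (X k)) := fun k => hτ _
  set ψ := gridBump a t T (fun k => τ (X k)) with hψdef
  have hψ : IsTestFunction Ω ψ := isTestFunction_gridBump ht hσ hT
  have hψK : ∀ x, ‖smoothAGrad a ψ x‖ ≤ K :=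
    norm_smoothAGrad_gridBump_le ha ht hσ hK0 fun k => hτK _
  -- Only these cells can carry a nonzero bump; `m` is their total volume.
  set T' := T.filter fun k => ‖X k‖ ≤ R with hT'
  set m := ∑ k ∈ T', volume.real (gridCell a t k) with hm
  have hcelltop : ∀ k, volume (gridCell a t k) ≠ ⊤ := fun k => by
    rw [volume_gridCell ht]; exact volume_aBox_ne_top _ _
  have hmU : m = volume.real (⋃ k ∈ T', gridCell a t k) :=
    (measureReal_biUnion_finset (fun k _ l _ hkl => disjoint_gridCell hkl)
      (fun k _ => measurableSet_gridCell ht k) (fun k _ => hcelltop k)).symm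
  have hUsub : (⋃ k ∈ T', gridCell a t k) ⊆ Ω :=
    Set.iUnion₂_subset fun k hk => hT k (Finset.mem_filter.1 hk).1
  refine ⟨ψ, hψ, m, ?_, ?_, ?_, fun i => ?_⟩
  · have hsub : {x | ‖v x‖ ≤ R - 1} ⊆ {x | 1 ≤ ‖w x - v x‖} ∪ (Aᶜ ∪
        ⋃ k ∈ T', gridCell a t k) := by
      intro x hx
      by_cases h1 : 1 ≤ ‖w x - v x‖
      · exact Or.inl h1
      by_cases h2 : x ∈ A
      · refine Or.inr (Or.inr (Set.mem_iUnion₂.2 ⟨gridIdx a t x, ?_, rfl⟩))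
        refine Finset.mem_filter.2 ⟨(Set.Finite.mem_toFinset _).2 (hAcell x h2), ?_⟩
        have h3 : ‖w x‖ ≤ ‖w x - v x‖ + ‖v x‖ := by
          simpa using norm_add_le (w x - v x) (v x)
        have hx' : ‖v x‖ ≤ R - 1 := hx
        change ‖w x‖ ≤ R
        linarith [not_le.1 h1]
      · exact Or.inr (Or.inl h2)
    have h1 := (measureReal_mono (μ := volume.restrict Ω) hsub).trans
      ((measureReal_union_le _ _).trans (add_le_add_right (measureReal_union_le _ _) _))
    have h2 : (volume.restrict Ω).real Aᶜ = volume.real (Ω \ A) := by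
      rw [measureReal_restrict_apply hAm.compl, Set.inter_comm, Set.sdiff_eq]
    have h3 : (volume.restrict Ω).real (⋃ k ∈ T', gridCell a t k) ≤ m := by
      rw [hmU]
      exact ENNReal.toReal_mono (measure_ne_top_of_subset hUsub hvol) (Measure.restrict_apply_le _ _)
    have h4 : (volume.restrict Ω).real {x | 1 ≤ ‖w x - v x‖} ≤ ε / 2 := hcheb
    linarith
  · rw [hmU]
    exact measureReal_mono hUsub hvol
  · exact Finset.sum_nonneg fun k _ => measureReal_nonneg
  · have hZ : MemLp (smoothAGrad a ψ) (ENNReal.ofReal p) (volume.restrict Ω) :=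
      MemLp.of_bound (continuous_smoothAGrad hψ.smooth).aestronglyMeasurable K
        (Eventually.of_forall hψK)
    -- The fields `v` and `w` are compared with the bumps and without them, at cost `ε / 2` each.
    -- The uniformity in the shift is essential: `ψ` depends on the grid, which depends on `δ`.
    have h1 := hnem i w (smoothAGrad a ψ) hXL hZ.1 hψK (hδi i)
    have h2 := hnem i w 0 hXL aestronglyMeasurable_zero (by simpa using hK0) (hδi i)
    simp only [Pi.zero_apply, add_zero] at h2
    have hint1 : Integrable (fun x => G i (w x + smoothAGrad a ψ x)) (volume.restrict Ω) :=
      integrable_comp_of_growth hp (hG i) (hgrowth i) (hXL.add hZ)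
    have hint2 : Integrable (fun x => G i (w x)) (volume.restrict Ω) :=
      integrable_comp_of_growth hp (hG i) (hgrowth i) hXL
    have h3 := setIntegral_gridBump_sub ha ht hσ hΩ hT (hG i) X
    have h3' : ∫ x in Ω, (G i (w x + smoothAGrad a ψ x) - G i (w x)) =
      ∑ k ∈ T, volume.real (gridCell a t k) *
        ((⨍ x in unitCube N, G i (X k + smoothAGrad a (τ (X k)) x)) - G i (X k)) := h3
    rw [integral_sub hint1 hint2] at h3'
    have hQ : volume (unitCube N) ≠ ⊤ := by
      rw [← aBox_zero_one a]; exact volume_aBox_ne_top _ _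
    have hQ0 : volume (unitCube N) ≠ 0 := fun h0 => by
      have := measureReal_unitCube_pos N
      simp [measureReal_def, h0] at this
    have h4 : ∑ k ∈ T, volume.real (gridCell a t k) *
        ((⨍ x in unitCube N, G i (X k + smoothAGrad a (τ (X k)) x)) - G i (X k)) ≤ κ i * m := by
      rw [hm, Finset.mul_sum, hT', Finset.sum_filter]
      refine Finset.sum_le_sum fun k _ => ?_
      split_ifs with hk
      · rw [mul_comm (κ i)]
        exact mul_le_mul_of_nonneg_left (by linarith [hκ i (X k) hk]) measureReal_nonneg
      · have h5 : ⨍ x in unitCube N, G i (X k + smoothAGrad a (τ (X k)) x) = G i (X k) := by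
          simp only [hτR _ (not_le.1 hk), smoothAGrad_zero, add_zero]
          exact setAverage_const hQ0 hQ _
        rw [h5, sub_self, mul_zero]
    have h6 := abs_le.1 h1
    have h7 := abs_le.1 h2
    linarith [h6.1, h7.2]

end Insertion

/-! ### Minimising sequences and gradient bounds -/

section Minimising

variable {N n : ℕ} {a : Fin N → ℕ} {p q : ℝ} {Ω : Set (EuclideanSpace ℝ (Fin N))}
  {F : GradSpace a n → ℝ} {g : EuclideanSpace ℝ (Fin N) → EuclideanSpace ℝ (Fin n)}
  {u : ℕ → EuclideanSpace ℝ (Fin N) → EuclideanSpace ℝ (Fin n)}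

theorem isMinimisingSeq_of_tendsto {i : ℝ} (hi : ∀ v ∈ dirichletClass a p Ω g, i ≤ energy a F Ω v)
    (hu : ∀ j, u j ∈ dirichletClass a p Ω g)
    (hlim : Tendsto (fun j => energy a F Ω (u j)) atTop (𝓝 i)) :
    IsMinimisingSeq a p F Ω g u := by
  have h1 : Tendsto (fun j => (energy a F Ω (u j) : EReal)) atTop (𝓝 (i : EReal)) :=
    (continuous_coe_real_ereal.tendsto i).comp hlim
  have h2 : (⨅ v ∈ dirichletClass a p Ω g, (energy a F Ω v : EReal)) = i :=
    le_antisymm (ge_of_tendsto' h1 fun j => iInf₂_le (u j) (hu j))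
      (le_iInf₂ fun v hv => by exact_mod_cast hi v hv)
  exact ⟨hu, by rwa [h2]⟩

theorem isMinimisingSeq_of_tendsto_atBot (hu : ∀ j, u j ∈ dirichletClass a p Ω g)
    (hlim : Tendsto (fun j => energy a F Ω (u j)) atTop atBot) :
    IsMinimisingSeq a p F Ω g u := by
  have h1 : Tendsto (fun j => (energy a F Ω (u j) : EReal)) atTop (𝓝 ⊥) :=
    EReal.tendsto_coe_nhds_bot_iff.2 hlim
  have h2 : (⨅ v ∈ dirichletClass a p Ω g, (energy a F Ω v : EReal)) = ⊥ :=
    le_antisymm (ge_of_tendsto' h1 fun j => iInf₂_le (u j) (hu j)) bot_le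
  exact ⟨hu, by rwa [h2]⟩

theorem MinimisingSeqsBounded.exists_gradNorm_rpow_le (hq : 1 ≤ q) (hΩ : IsOpen Ω)
    (hg : MemW a p Set.univ g) (h : MinimisingSeqsBounded a p q F Ω g)
    (hu : IsMinimisingSeq a p F Ω g u) : ∃ M : ℝ, ∀ j, gradNorm a q Ω (u j) ^ q ≤ M := by
  obtain ⟨M, hM⟩ := h u hu
  refine ⟨(max M 0) ^ q, fun j => ?_⟩
  refine Real.rpow_le_rpow ENNReal.toReal_nonneg ?_ (by linarith)
  have h1 := ((memW_of_mem_dirichletClass hg (hu.1 j)).eLpNorm_aGrad_le_wNorm hΩ hq).trans (hM j)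
  exact ENNReal.toReal_le_of_le_ofReal (le_max_right _ _)
    (h1.trans (ENNReal.ofReal_le_ofReal (le_max_left _ _)))

theorem energy_add_test (hΩ : IsOpen Ω) {w ψ : EuclideanSpace ℝ (Fin N) → EuclideanSpace ℝ (Fin n)}
    (hw : MemW a p Ω w) (hψ : IsTestFunction Ω ψ) :
    energy a F Ω (w + ψ) = ∫ x in Ω, F (aGrad a Ω w x + smoothAGrad a ψ x) := by
  refine integral_congr_ae ?_
  filter_upwards [hw.aGrad_add_test hΩ hψ] with x hx
  rw [hx, Pi.add_apply]

theorem energy_sub_rpow (hp : 1 ≤ p) (hq : 1 ≤ q) (hqp : q ≤ p) (hF : Continuous F) {C : ℝ}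
    (hgrowth : ∀ X, |F X| ≤ C * (‖X‖ ^ p + 1)) (hΩ : IsOpen Ω) (hb : Bornology.IsBounded Ω)
    {w : EuclideanSpace ℝ (Fin N) → EuclideanSpace ℝ (Fin n)} (hw : MemW a p Ω w) (c : ℝ) :
    energy a (fun X => F X - c * ‖X‖ ^ q) Ω w =
      energy a F Ω w - c * gradNorm a q Ω w ^ q := by
  have := isFiniteMeasure_restrict_of_isBounded hb
  have hL := hw.memLp_aGrad hΩ
  rw [gradNorm_rpow hq hqp hΩ hb hw, energy, energy, ← integral_const_mul]
  exact integral_sub (integrable_comp_of_growth hp hF hgrowth hL)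
    ((integrable_norm_rpow_of_memLp hq
      (hL.mono_exponent (ENNReal.ofReal_le_ofReal hqp))).const_mul c)

/-- A bound for the `L^q` norm of the gradient bounds the gradient itself on half of `Ω`. -/
theorem exists_half_le_measureReal_norm_le (hq : 1 ≤ q) (hqp : q ≤ p) (hΩ : IsOpen Ω)
    (hb : Bornology.IsBounded Ω) (hne : Ω.Nonempty) (M : ℝ) :
    ∃ R : ℝ, 1 ≤ R ∧ ∀ w : EuclideanSpace ℝ (Fin N) → EuclideanSpace ℝ (Fin n), MemW a p Ω w →
      gradNorm a q Ω w ^ q ≤ M →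
      volume.real Ω / 2 ≤ (volume.restrict Ω).real {x | ‖aGrad a Ω w x‖ ≤ R - 1} := by
  have hfin := isFiniteMeasure_restrict_of_isBounded hb
  have hV : 0 < volume.real Ω :=
    ENNReal.toReal_pos (hΩ.measure_pos volume hne).ne' hb.measure_lt_top.ne
  -- Chosen so that Markov's inequality leaves at most half of `Ω` with `‖∇_a w‖^q ≥ ρ`; since `ρ ≥
  -- 1`, the points with `‖∇_a w‖ > ρ` are among these.
  set ρ : ℝ := 1 + 2 * |M| / volume.real Ω with hρ
  have hρ1 : 1 ≤ ρ := by
    rw [hρ]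
    have : 0 ≤ 2 * |M| / volume.real Ω := by positivity
    linarith
  refine ⟨ρ + 1, by linarith, fun w hw hM => ?_⟩
  have hL := (hw.memLp_aGrad hΩ).mono_exponent (ENNReal.ofReal_le_ofReal hqp)
  rw [gradNorm_rpow hq hqp hΩ hb hw] at hM
  have h1 := mul_meas_ge_le_integral_of_nonneg (μ := volume.restrict Ω)
    (f := fun x => ‖aGrad a Ω w x‖ ^ q) (Eventually.of_forall fun x => by positivity)
    (integrable_norm_rpow_of_memLp hq hL) ρ
  have hsub : Set.univ ⊆ {x | ρ ≤ ‖aGrad a Ω w x‖ ^ q} ∪ {x | ‖aGrad a Ω w x‖ ≤ ρ + 1 - 1} := by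
    intro x _
    rcases le_or_gt ‖aGrad a Ω w x‖ ρ with h | h
    · right
      simpa using h
    · left
      exact h.le.trans (Real.self_le_rpow_of_one_le (hρ1.trans h.le) hq)
  have h2 := (measureReal_mono (μ := volume.restrict Ω) hsub).trans (measureReal_union_le _ _)
  have h3 : (volume.restrict Ω).real Set.univ = volume.real Ω := by simp [measureReal_def]
  have h4 : (volume.restrict Ω).real {x | ρ ≤ ‖aGrad a Ω w x‖ ^ q} ≤ volume.real Ω / 2 := by
    have h5 : ρ * (volume.real Ω / 2) = volume.real Ω / 2 + |M| := by
      rw [hρ]; field_simp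
    have h6 : ρ * (volume.restrict Ω).real {x | ρ ≤ ‖aGrad a Ω w x‖ ^ q} ≤
        ρ * (volume.real Ω / 2) := by
      refine (h1.trans hM).trans ?_
      rw [h5]
      linarith [le_abs_self M]
    exact le_of_mul_le_mul_left h6 (by linarith)
  linarith

theorem volume_unitCube_ne_top (N : ℕ) : volume (unitCube N) ≠ ⊤ := by
  rw [← aBox_zero_one fun _ => 1]
  exact volume_aBox_ne_top _ _

theorem volume_unitCube_ne_zero (N : ℕ) : volume (unitCube N) ≠ 0 := fun h => by
  have := measureReal_unitCube_pos N
  simp [measureReal_def, h] at this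

theorem setAverage_mono_unitCube {f h : EuclideanSpace ℝ (Fin N) → ℝ}
    (hf : IntegrableOn f (unitCube N)) (hh : IntegrableOn h (unitCube N)) (hle : ∀ x, f x ≤ h x) :
    ⨍ x in unitCube N, f x ≤ ⨍ x in unitCube N, h x := by
  rw [setAverage_eq, setAverage_eq]
  exact mul_le_mul_of_nonneg_left (setIntegral_mono hf hh hle) (inv_nonneg.2 measureReal_nonneg)

theorem setAverage_le_of_le_unitCube {f : EuclideanSpace ℝ (Fin N) → ℝ} {B : ℝ}
    (hf : IntegrableOn f (unitCube N)) (hle : ∀ x, f x ≤ B) : ⨍ x in unitCube N, f x ≤ B :=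
  (setAverage_mono_unitCube hf (integrableOn_const (volume_unitCube_ne_top N)) hle).trans
    (setAverage_const (volume_unitCube_ne_zero N) (volume_unitCube_ne_top N) B).le

/-- By this continuity a test function that violates quasiconvexity at a point also violates it at
all nearby points. -/
theorem continuous_setAverage_smoothAGrad {G : GradSpace a n → ℝ} (hG : Continuous G)
    {φ : EuclideanSpace ℝ (Fin N) → EuclideanSpace ℝ (Fin n)} {U : Set (EuclideanSpace ℝ (Fin N))}
    (hφ : IsTestFunction U φ) :
    Continuous fun X => ⨍ x in unitCube N, G (X + smoothAGrad a φ x) := by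
  obtain ⟨K, _, hK⟩ := hφ.exists_norm_smoothAGrad_le a
  simp only [setAverage_eq, smul_eq_mul]
  refine continuous_const.mul (continuous_iff_continuousAt.2 fun X => ?_)
  obtain ⟨B, hB⟩ := (isCompact_closedBall (0 : GradSpace a n)
    (‖X‖ + 1 + K)).exists_bound_of_continuousOn hG.continuousOn
  refine continuousAt_of_dominated (bound := fun _ => B)
    (Eventually.of_forall fun Y => ?_) ?_
    (integrableOn_const (volume_unitCube_ne_top N)) (Eventually.of_forall fun x => ?_)
  · exact (hG.comp (continuous_const.add
      (continuous_smoothAGrad hφ.smooth))).aestronglyMeasurable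
  · filter_upwards [Metric.ball_mem_nhds X one_pos] with Y hY
    refine Eventually.of_forall fun x => hB _ ?_
    rw [mem_closedBall_zero_iff]
    refine (norm_add_le _ _).trans (add_le_add ?_ (hK x))
    rw [mem_ball_iff_norm] at hY
    have := norm_add_le (Y - X) X
    rw [sub_add_cancel] at this
    linarith
  · fun_prop

end Minimising

/-! ### Uniform violation of quasiconvexity, and a lower bound for the energy -/

section Necessity

variable {N n : ℕ} {a : Fin N → ℕ} {p q : ℝ} {Ω : Set (EuclideanSpace ℝ (Fin N))}
  {F : GradSpace a n → ℝ} {g : EuclideanSpace ℝ (Fin N) → EuclideanSpace ℝ (Fin n)}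

/-- Failure of quasiconvexity at every point is uniform on compact sets. -/
theorem exists_uniform_gap {G : GradSpace a n → ℝ} (hG : Continuous G)
    (hnot : ∀ X, ¬ IsQuasiconvexAt a G X) {S : Set (GradSpace a n)} (hS : IsCompact S) :
    ∃ δ K : ℝ, 0 < δ ∧ 0 ≤ K ∧ ∀ X ∈ S,
      ∃ φ : EuclideanSpace ℝ (Fin N) → EuclideanSpace ℝ (Fin n), IsTestFunction (unitCube N) φ ∧
        (∀ x, ‖smoothAGrad a φ x‖ ≤ K) ∧
        ⨍ x in unitCube N, G (X + smoothAGrad a φ x) ≤ G X - δ := by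
  -- By compactness it suffices to treat a neighbourhood of one point; there a single test function
  -- works with half of its gap.
  refine hS.induction_on (p := fun S => ∃ δ K : ℝ, 0 < δ ∧ 0 ≤ K ∧ ∀ X ∈ S,
      ∃ φ : EuclideanSpace ℝ (Fin N) → EuclideanSpace ℝ (Fin n), IsTestFunction (unitCube N) φ ∧
        (∀ x, ‖smoothAGrad a φ x‖ ≤ K) ∧
        ⨍ x in unitCube N, G (X + smoothAGrad a φ x) ≤ G X - δ) ?_ ?_ ?_ ?_
  · exact ⟨1, 0, one_pos, le_rfl, by simp⟩
  · rintro s t hst ⟨δ, K, hδ, hK, h⟩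
    exact ⟨δ, K, hδ, hK, fun X hX => h X (hst hX)⟩
  · rintro s t ⟨δ, K, hδ, hK, h⟩ ⟨δ', K', hδ', hK', h'⟩
    refine ⟨min δ δ', max K K', lt_min hδ hδ', le_max_of_le_left hK, ?_⟩
    rintro X (hX | hX)
    · obtain ⟨φ, h1, h2, h3⟩ := h X hX
      exact ⟨φ, h1, fun x => (h2 x).trans (le_max_left _ _),
        h3.trans (sub_le_sub_left (min_le_left _ _) _)⟩
    · obtain ⟨φ, h1, h2, h3⟩ := h' X hX
      exact ⟨φ, h1, fun x => (h2 x).trans (le_max_right _ _),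
        h3.trans (sub_le_sub_left (min_le_right _ _) _)⟩
  · intro X _
    have h := hnot X
    simp only [IsQuasiconvexAt, not_forall, not_le] at h
    obtain ⟨φ, hφ, hlt⟩ := h
    obtain ⟨K, hK, hφK⟩ := hφ.exists_norm_smoothAGrad_le a
    set δ := (G X - ⨍ x in unitCube N, G (X + smoothAGrad a φ x)) / 2 with hδ
    have hδ0 : 0 < δ := by rw [hδ]; linarith
    have hcont : Continuous fun Y => G Y - ⨍ x in unitCube N, G (Y + smoothAGrad a φ x) :=
      hG.sub (continuous_setAverage_smoothAGrad hG hφ)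
    refine ⟨_, mem_nhdsWithin_of_mem_nhds (hcont.continuousAt.eventually
      (eventually_gt_nhds (show δ < _ by linarith))), δ, K, hδ0, hK, fun Y hY => ?_⟩
    have hY : δ < G Y - ⨍ x in unitCube N, G (Y + smoothAGrad a φ x) := hY
    exact ⟨φ, hφ, hφK, by linarith⟩

/-- If the energy is unbounded below, some minimising sequence is unbounded. -/
theorem MinimisingSeqsBounded.exists_energy_lower_bound (ha : ∀ i, 1 ≤ a i) (hp : 1 ≤ p)
    (hq : 1 ≤ q) (hqp : q ≤ p) (hF : Continuous F) {C : ℝ} (hC : 0 < C)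
    (hgrowth : ∀ X, |F X| ≤ C * (‖X‖ ^ p + 1)) (hΩ : IsOpen Ω) (hb : Bornology.IsBounded Ω)
    (hne : Ω.Nonempty) (hg : MemW a p Set.univ g)
    {Z : EuclideanSpace ℝ (Fin N) → EuclideanSpace ℝ (Fin n)} (hZ : IsTestFunction (unitCube N) Z)
    (hZ0 : 0 < ⨍ x in unitCube N, ‖smoothAGrad a Z x‖ ^ q)
    (h : MinimisingSeqsBounded a p q F Ω g) :
    ∃ m : ℝ, ∀ w ∈ dirichletClass a p Ω g, m ≤ energy a F Ω w := by
  by_contra! hcon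
  have hfin := isFiniteMeasure_restrict_of_isBounded hb
  have hV : 0 < volume.real Ω :=
    ENNReal.toReal_pos (hΩ.measure_pos volume hne).ne' hb.measure_lt_top.ne
  set V := volume.real Ω with hVdef
  -- Otherwise there would be, for every `M`, a competitor with energy at most `-M` and gradient
  -- beyond `M`; together they would form an unbounded minimising sequence.
  obtain ⟨M, hM⟩ : ∃ M : ℕ, ∀ w ∈ dirichletClass a p Ω g, energy a F Ω w ≤ -M →
      gradNorm a q Ω w ^ q ≤ M := by
    by_contra! hM
    choose u hu hE hD using hM
    have hlim : Tendsto (fun j => energy a F Ω (u j)) atTop atBot :=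
      tendsto_atBot_mono hE (tendsto_neg_atTop_atBot.comp tendsto_natCast_atTop_atTop)
    obtain ⟨B, hB⟩ := h.exists_gradNorm_rpow_le hq hΩ hg (isMinimisingSeq_of_tendsto_atBot hu hlim)
    obtain ⟨j, hj⟩ := exists_nat_gt B
    linarith [hB j, hD j]
  obtain ⟨R, hR1, hR⟩ := exists_half_le_measureReal_norm_le (a := a) (n := n) hq hqp hΩ hb hne M
  set z := ⨍ x in unitCube N, ‖smoothAGrad a Z x‖ ^ q with hz
  set T : ℝ := 2 ^ (q - 1) with hT
  have hT0 : 0 < T := by positivity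
  set Λ : ℝ := (M + 2) / (V / 4) with hΛ
  have hΛ0 : 0 ≤ Λ := by positivity
  have hRq : 0 ≤ R ^ q := by positivity
  -- `s` is so large that adding `s • Z` raises the mean of `‖·‖^q` by `Λ` at every `X` with `‖X‖ ≤
  -- R`. `Λ` is such that doing this on a quarter of `Ω` adds `M + 2` to the integral.
  obtain ⟨s, hs1, hs⟩ : ∃ s : ℝ, 1 ≤ s ∧ T * (2 * R ^ q + Λ) ≤ s * z := by
    refine ⟨1 + T * (2 * R ^ q + Λ) / z, ?_, ?_⟩
    · have : 0 ≤ T * (2 * R ^ q + Λ) / z := by positivity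
      linarith
    · rw [add_mul, div_mul_cancel₀ _ hZ0.ne']
      linarith
  have hsZ : IsTestFunction (unitCube N) (s • Z) := hZ.const_smul s
  obtain ⟨K, hK0, hK⟩ := hsZ.exists_norm_smoothAGrad_le a
  obtain ⟨B, hB⟩ := (isCompact_closedBall (0 : GradSpace a n) (R + K)).exists_bound_of_continuousOn
    hF.continuousOn
  have hQt := volume_unitCube_ne_top N
  have hcq := continuous_norm_rpow (W := GradSpace a n) hq
  have hκ1 : ∀ X : GradSpace a n, ‖X‖ ≤ R →
      ⨍ x in unitCube N, F (X + smoothAGrad a (s • Z) x) ≤ F X + 2 * B := by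
    intro X hX
    have h1 : ⨍ x in unitCube N, F (X + smoothAGrad a (s • Z) x) ≤ B := by
      refine setAverage_le_of_le_unitCube (integrableOn_comp_smoothAGrad hF hsZ X hQt) fun x => ?_
      refine (le_abs_self _).trans (hB _ ?_)
      rw [mem_closedBall_zero_iff]
      exact (norm_add_le _ _).trans (add_le_add hX (hK x))
    have h2 := (abs_le.1 (hB X (by rw [mem_closedBall_zero_iff]; linarith))).1
    linarith
  have hκ2 : ∀ X : GradSpace a n, ‖X‖ ≤ R →
      ‖X‖ ^ q + Λ ≤ ⨍ x in unitCube N, ‖X + smoothAGrad a (s • Z) x‖ ^ q := by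
    intro X hX
    have hXR : ‖X‖ ^ q ≤ R ^ q := by gcongr
    have hi1 := integrableOn_comp_smoothAGrad hcq hsZ X hQt
    have hi0 := integrableOn_comp_smoothAGrad hcq hZ 0 hQt
    simp only [zero_add] at hi0
    have h1 : ⨍ x in unitCube N, s ^ q * ‖smoothAGrad a Z x‖ ^ q ≤
        ⨍ x in unitCube N, T * (‖X + smoothAGrad a (s • Z) x‖ ^ q + R ^ q) := by
      refine setAverage_mono_unitCube (hi0.const_mul _)
        ((hi1.add (integrableOn_const hQt)).const_mul _) fun x => ?_
      have h2 := rpow_norm_add_le hq (X + smoothAGrad a (s • Z) x) (-X)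
      rw [norm_neg, add_neg_cancel_comm, smoothAGrad_const_smul hZ.smooth, norm_smul,
        Real.norm_of_nonneg (by linarith), Real.mul_rpow (by linarith) (norm_nonneg _)] at h2
      rw [smoothAGrad_const_smul hZ.smooth]
      refine h2.trans ?_
      gcongr
    have h3 : ⨍ x in unitCube N, s ^ q * ‖smoothAGrad a Z x‖ ^ q = s ^ q * z := by
      rw [hz, setAverage_eq, setAverage_eq, integral_const_mul, smul_eq_mul, smul_eq_mul]
      ring
    have h4 : ⨍ x in unitCube N, T * (‖X + smoothAGrad a (s • Z) x‖ ^ q + R ^ q) =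
        T * ((⨍ x in unitCube N, ‖X + smoothAGrad a (s • Z) x‖ ^ q) + R ^ q) := by
      have hc := integrableOn_const (C := R ^ q) hQt
      rw [setAverage_eq, setAverage_eq, integral_const_mul, integral_add hi1 hc, setIntegral_const,
        smul_eq_mul, smul_eq_mul, smul_eq_mul]
      have := (measureReal_unitCube_pos N).ne'
      field_simp
    rw [h3, h4] at h1
    have h5 : s * z ≤ s ^ q * z :=
      mul_le_mul_of_nonneg_right (Real.self_le_rpow_of_one_le hs1 hq) hZ0.le
    have h6 := le_of_mul_le_mul_left (hs.trans (h5.trans h1)) hT0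
    linarith
  -- The bumps cost at most `|2 * B| * V + 1`, so from this level the energy stays at most `-M`
  -- after the insertion.
  obtain ⟨w, hw, hwE⟩ := hcon (-(M + |2 * B| * V + 1))
  have hBV : 0 ≤ |2 * B| * V := by positivity
  have hwW := memW_of_mem_dirichletClass hg hw
  have hwM := hM w hw (by linarith)
  classical
  -- Insertion yields only upper bounds; the minus sign in the second function turns its bound into
  -- growth of the gradient.
  obtain ⟨ψ, hψ, m, hm1, hm2, hm0, hfinal⟩ := exists_test_insertion ha hp hΩ hb
    (hwW.memLp_aGrad hΩ) (G := ![F, fun X => -‖X‖ ^ q]) (C := ![C, 1])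
    (by
      intro i
      fin_cases i
      · exact hF
      · exact hcq.neg)
    (by
      intro i
      fin_cases i
      · exact hC
      · exact one_pos)
    (by
      intro i X
      fin_cases i
      · exact hgrowth X
      · change |-‖X‖ ^ q| ≤ 1 * (‖X‖ ^ p + 1)
        rw [abs_neg, abs_of_nonneg (by positivity), one_mul]
        exact rpow_norm_le_rpow_norm_add_one hq hqp X)
    (R := R) hK0 (τ := fun X => if ‖X‖ ≤ R then s • Z else 0)
    (by
      intro X
      split_ifs
      · exact hsZ
      · exact IsTestFunction.zero _)
    (fun X hX => if_neg (not_le.2 hX))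
    (by
      intro X x
      split_ifs
      · exact hK x
      · rw [smoothAGrad_zero, norm_zero]
        exact hK0)
    (κ := ![2 * B, -Λ])
    (by
      intro i X hX
      simp only [if_pos hX]
      fin_cases i
      · exact hκ1 X hX
      · change ⨍ x in unitCube N, -‖X + smoothAGrad a (s • Z) x‖ ^ q ≤ -‖X‖ ^ q + -Λ
        have h1 := hκ2 X hX
        rw [setAverage_eq] at h1 ⊢
        rw [integral_neg, smul_neg]
        linarith)
    (lt_min one_pos (show 0 < V / 4 by positivity))
  have hm4 : V / 4 ≤ m := by
    have := hR w hwW hwM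
    linarith [min_le_right 1 (V / 4)]
  have hε1 := min_le_left 1 (V / 4)
  have hnew := add_test_mem_dirichletClass hw hψ
  have hE : energy a F Ω (w + ψ) ≤ energy a F Ω w + 2 * B * m + min 1 (V / 4) := by
    rw [energy_add_test hΩ hwW hψ]
    exact hfinal 0
  have hD : gradNorm a q Ω w ^ q + Λ * m - min 1 (V / 4) ≤ gradNorm a q Ω (w + ψ) ^ q := by
    have h1 := hfinal 1
    change ∫ x in Ω, -‖aGrad a Ω w x + smoothAGrad a ψ x‖ ^ q ≤
      (∫ x in Ω, -‖aGrad a Ω w x‖ ^ q) + -Λ * m + _ at h1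
    have h2 := energy_add_test (F := fun X => ‖X‖ ^ q) hΩ hwW hψ
    rw [integral_neg, integral_neg, ← h2, ← gradNorm_rpow hq hqp hΩ hb hwW] at h1
    have h3 := gradNorm_rpow hq hqp hΩ hb (memW_of_mem_dirichletClass hg hnew)
    rw [h3]
    change _ ≤ energy a (fun X => ‖X‖ ^ q) Ω (w + ψ)
    linarith
  have hBm : 2 * B * m ≤ |2 * B| * V :=
    mul_le_mul (le_abs_self _) hm2 hm0 (abs_nonneg _)
  have hcontr := hM (w + ψ) hnew (by linarith)
  have hΛm : (M : ℝ) + 2 ≤ Λ * m := by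
    calc (M : ℝ) + 2 = Λ * (V / 4) := by rw [hΛ]; field_simp
      _ ≤ Λ * m := by gcongr
  have hD0 : 0 ≤ gradNorm a q Ω w ^ q := Real.rpow_nonneg ENNReal.toReal_nonneg _
  linarith

end Necessity

/-! ### From bounded minimising sequences to quasiconvexity at a point -/

section Necessity

variable {N n : ℕ} {a : Fin N → ℕ} {p q : ℝ} {Ω : Set (EuclideanSpace ℝ (Fin N))}
  {F : GradSpace a n → ℝ} {g : EuclideanSpace ℝ (Fin N) → EuclideanSpace ℝ (Fin n)}

/-- If `F - c |·|^q` is nowhere quasiconvex, the functional `I - c ‖∇_a u‖_q^q` can be decreased by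
a fixed amount at the cost of increasing `‖∇_a u‖_q^q` by at most one. -/
theorem exists_decrease (hN : 1 ≤ N) (ha : ∀ i, 1 ≤ a i) (hp : 1 ≤ p)
    (hq : 1 ≤ q) (hqp : q ≤ p) (hF : Continuous F) {C : ℝ} (hC : 0 < C)
    (hgrowth : ∀ X, |F X| ≤ C * (‖X‖ ^ p + 1)) (hΩ : IsOpen Ω) (hb : Bornology.IsBounded Ω)
    (hne : Ω.Nonempty) (hg : MemW a p Set.univ g) {c : ℝ}
    (hnot : ∀ X, ¬ IsQuasiconvexAt a (fun X => F X - c * ‖X‖ ^ q) X) (M : ℝ) :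
    ∃ d : ℝ, 0 < d ∧ ∀ w ∈ dirichletClass a p Ω g, gradNorm a q Ω w ^ q ≤ M →
      ∃ w' ∈ dirichletClass a p Ω g, gradNorm a q Ω w' ^ q ≤ gradNorm a q Ω w ^ q + 1 ∧
        energy a F Ω w' - c * gradNorm a q Ω w' ^ q ≤
          energy a F Ω w - c * gradNorm a q Ω w ^ q - d := by
  have hfin := isFiniteMeasure_restrict_of_isBounded hb
  have hV : 0 < volume.real Ω :=
    ENNReal.toReal_pos (hΩ.measure_pos volume hne).ne' hb.measure_lt_top.ne
  set V := volume.real Ω with hVdef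
  have hcq := continuous_norm_rpow (W := GradSpace a n) hq
  have hQt := volume_unitCube_ne_top N
  set G : GradSpace a n → ℝ := fun X => F X - c * ‖X‖ ^ q with hGdef
  have hG : Continuous G := hF.sub (continuous_const.mul hcq)
  obtain ⟨R, hR1, hR⟩ := exists_half_le_measureReal_norm_le (a := a) (n := n) hq hqp hΩ hb hne M
  obtain ⟨δ, K, hδ, hK0, hgap⟩ := exists_uniform_gap hG hnot
    (isCompact_closedBall (0 : GradSpace a n) R)
  choose! φ hφ hφK hφgap using hgap
  set Λ : ℝ := (R + K) ^ q + 1 with hΛ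
  have hΛ0 : 0 < Λ := by positivity
  -- Bumps active on a fraction `θ` of the cube gain `θ δ` and raise the mean of `‖·‖^q` by at most
  -- `θ Λ`. This `θ₀` limits the total rise over `Ω` to `1 / 2`.
  obtain ⟨t, θ, ht, hθ, hθle, hbox, hscale⟩ := exists_scaled_test (a := a) (n := n) hN ha
    (show 0 < 1 / (2 * Λ * V) by positivity)
  have hκ1 : ∀ X : GradSpace a n, ‖X‖ ≤ R →
      ⨍ x in unitCube N, G (X + smoothAGrad a (scaledBump a 0 t (φ X)) x) ≤ G X + -(θ * δ) := by
    intro X hX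
    have hX' := mem_closedBall_zero_iff.2 hX
    rw [hscale (φ X) (hφ X hX') G hG X]
    have := mul_le_mul_of_nonneg_left
      (sub_le_iff_le_add'.2 ((hφgap X hX').trans_eq (sub_eq_add_neg _ _))) hθ.le
    linarith
  have hκ2 : ∀ X : GradSpace a n, ‖X‖ ≤ R →
      ⨍ x in unitCube N, ‖X + smoothAGrad a (scaledBump a 0 t (φ X)) x‖ ^ q ≤
        ‖X‖ ^ q + θ * Λ := by
    intro X hX
    have hX' := mem_closedBall_zero_iff.2 hX
    rw [hscale (φ X) (hφ X hX') (fun Y => ‖Y‖ ^ q) hcq X]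
    have h1 : ⨍ x in unitCube N, ‖X + smoothAGrad a (φ X) x‖ ^ q ≤ (R + K) ^ q := by
      refine setAverage_le_of_le_unitCube
        (integrableOn_comp_smoothAGrad hcq (hφ X hX') X hQt) fun x => ?_
      gcongr
      exact (norm_add_le _ _).trans (add_le_add hX (hφK X hX' x))
    have h2 : 0 ≤ ‖X‖ ^ q := by positivity
    have h3 : (⨍ x in unitCube N, ‖X + smoothAGrad a (φ X) x‖ ^ q) - ‖X‖ ^ q ≤ Λ := by
      rw [hΛ]; linarith
    have := mul_le_mul_of_nonneg_left h3 hθ.le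
    linarith
  -- In turn: the rise of the gradient integral stays below one, the bumps cover volume `m ≥ V / 4`,
  -- and half of the gain `θ δ V / 4` survives.
  set ε : ℝ := min (1 / 2) (min (V / 4) (θ * δ * V / 8)) with hε
  have hε0 : 0 < ε := by positivity
  have hε1 : ε ≤ 1 / 2 := min_le_left _ _
  have hε2 : ε ≤ V / 4 := (min_le_right _ _).trans (min_le_left _ _)
  have hε3 : ε ≤ θ * δ * V / 8 := (min_le_right _ _).trans (min_le_right _ _)
  refine ⟨θ * δ * V / 8, by positivity, fun w hw hwM => ?_⟩
  have hwW := memW_of_mem_dirichletClass hg hw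
  classical
  obtain ⟨ψ, hψ, m, hm1, hm2, hm0, hfinal⟩ := exists_test_insertion ha hp hΩ hb
    (hwW.memLp_aGrad hΩ) (G := ![G, fun X => ‖X‖ ^ q]) (C := ![C + |c|, 1])
    (by
      intro i
      fin_cases i
      · exact hG
      · exact hcq)
    (by
      intro i
      fin_cases i
      · change 0 < C + |c|
        positivity
      · exact one_pos)
    (by
      intro i X
      fin_cases i
      · exact growth_sub_rpow hq hqp hgrowth c X
      · change |‖X‖ ^ q| ≤ 1 * (‖X‖ ^ p + 1)
        rw [abs_of_nonneg (by positivity), one_mul]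
        exact rpow_norm_le_rpow_norm_add_one hq hqp X)
    (R := R) hK0 (τ := fun X => if ‖X‖ ≤ R then scaledBump a 0 t (φ X) else 0)
    (by
      intro X
      split_ifs with hX
      · exact ((hφ X (mem_closedBall_zero_iff.2 hX)).scaledBump ht 0).mono hbox
      · exact IsTestFunction.zero _)
    (fun X hX => if_neg (not_le.2 hX))
    (by
      intro X x
      split_ifs with hX
      · have hX' := mem_closedBall_zero_iff.2 hX
        rw [smoothAGrad_scaledBump ha (hφ X hX').smooth ht]
        exact hφK X hX' _
      · rw [smoothAGrad_zero, norm_zero]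
        exact hK0)
    (κ := ![-(θ * δ), θ * Λ])
    (by
      intro i X hX
      simp only [if_pos hX]
      fin_cases i
      · exact hκ1 X hX
      · exact hκ2 X hX)
    hε0
  have hm4 : V / 4 ≤ m := by
    have := hR w hwW hwM
    linarith
  have hnew := add_test_mem_dirichletClass hw hψ
  have hnewW := memW_of_mem_dirichletClass hg hnew
  refine ⟨w + ψ, hnew, ?_, ?_⟩
  · have h1 : energy a (fun X => ‖X‖ ^ q) Ω (w + ψ) ≤
        energy a (fun X => ‖X‖ ^ q) Ω w + θ * Λ * m + ε := by
      rw [energy_add_test hΩ hwW hψ]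
      exact hfinal 1
    rw [gradNorm_rpow hq hqp hΩ hb hnewW, gradNorm_rpow hq hqp hΩ hb hwW]
    refine h1.trans ?_
    have h2 : θ * Λ * m ≤ 1 / 2 := by
      calc θ * Λ * m ≤ 1 / (2 * Λ * V) * Λ * V := by gcongr
        _ = 1 / 2 := by field_simp
    unfold energy
    linarith
  · have h1 : energy a G Ω (w + ψ) ≤ energy a G Ω w + -(θ * δ) * m + ε := by
      rw [energy_add_test hΩ hwW hψ]
      exact hfinal 0
    rw [hGdef, energy_sub_rpow hp hq hqp hF hgrowth hΩ hb hnewW,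
      energy_sub_rpow hp hq hqp hF hgrowth hΩ hb hwW] at h1
    have h2 : θ * δ * (V / 4) ≤ θ * δ * m := by gcongr
    linarith

/-- If `F - c |·|^q` is nowhere quasiconvex and the energy is bounded below, then every
competitor can be replaced by one with large gradient and nearly the same energy. -/
theorem exists_large_gradNorm (hN : 1 ≤ N) (ha : ∀ i, 1 ≤ a i) (hp : 1 ≤ p)
    (hq : 1 ≤ q) (hqp : q ≤ p) (hF : Continuous F) {C : ℝ} (hC : 0 < C)
    (hgrowth : ∀ X, |F X| ≤ C * (‖X‖ ^ p + 1)) (hΩ : IsOpen Ω) (hb : Bornology.IsBounded Ω)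
    (hne : Ω.Nonempty) (hg : MemW a p Set.univ g) {c : ℝ} (hc : 0 < c)
    (hnot : ∀ X, ¬ IsQuasiconvexAt a (fun X => F X - c * ‖X‖ ^ q) X) {m₀ : ℝ}
    (hm₀ : ∀ w ∈ dirichletClass a p Ω g, m₀ ≤ energy a F Ω w) (M : ℝ)
    {w : EuclideanSpace ℝ (Fin N) → EuclideanSpace ℝ (Fin n)} (hw : w ∈ dirichletClass a p Ω g) :
    ∃ u ∈ dirichletClass a p Ω g, M < gradNorm a q Ω u ^ q ∧
      energy a F Ω u ≤ energy a F Ω w + c * (|M| + 1) := by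
  rcases lt_or_ge M (gradNorm a q Ω w ^ q) with hlt | hwM
  · exact ⟨w, hw, hlt, by have : 0 ≤ c * (|M| + 1) := by positivity
                          linarith⟩
  -- By `hcon` the level `M` cannot be crossed cheaply, so the steps of `exists_decrease` never
  -- leave the region where the gradient is bounded by `M`. They would lower the energy without
  -- limit, against `hm₀`.
  by_contra! hcon
  obtain ⟨d, hd, hdec⟩ := exists_decrease hN ha hp hq hqp hF hC hgrowth hΩ hb hne hg hnot M
  have hD0 : ∀ v : EuclideanSpace ℝ (Fin N) → EuclideanSpace ℝ (Fin n),
      0 ≤ gradNorm a q Ω v ^ q := fun v => Real.rpow_nonneg ENNReal.toReal_nonneg _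
  have hstep : ∀ k : ℕ, ∃ v ∈ dirichletClass a p Ω g, gradNorm a q Ω v ^ q ≤ M ∧
      energy a F Ω v - c * gradNorm a q Ω v ^ q ≤
        energy a F Ω w - c * gradNorm a q Ω w ^ q - k * d := by
    intro k
    induction k with
    | zero => exact ⟨w, hw, hwM, by simp⟩
    | succ k ih =>
      obtain ⟨v, hv, hvM, hvE⟩ := ih
      obtain ⟨v', hv', hvD', hvE'⟩ := hdec v hv hvM
      refine ⟨v', hv', ?_, by push_cast; linarith⟩
      by_contra! hlt
      have h1 := hcon v' hv' hlt
      have h2 : c * gradNorm a q Ω v' ^ q ≤ c * (|M| + 1) := by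
        gcongr
        linarith [le_abs_self M]
      have h3 : 0 ≤ c * gradNorm a q Ω w ^ q := mul_nonneg hc.le (hD0 w)
      have h4 : 0 ≤ k * d := by positivity
      linarith
  obtain ⟨k, hk⟩ := exists_nat_gt ((energy a F Ω w - m₀ + c * |M|) / d)
  rw [div_lt_iff₀ hd] at hk
  obtain ⟨v, hv, hvM, hvE⟩ := hstep k
  have h1 := hm₀ v hv
  have h2 : c * gradNorm a q Ω v ^ q ≤ c * |M| := by
    gcongr
    exact hvM.trans (le_abs_self M)
  have h3 : 0 ≤ c * gradNorm a q Ω w ^ q := mul_nonneg hc.le (hD0 w)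
  linarith

/-- Boundedness of minimising sequences implies quasiconvexity of `F - c |·|^q` at some point. -/
theorem MinimisingSeqsBounded.exists_isQuasiconvexAt (hN : 1 ≤ N) (ha : ∀ i, 1 ≤ a i) (hp : 1 ≤ p)
    (hq : 1 ≤ q) (hqp : q ≤ p) (hF : Continuous F) {C : ℝ} (hC : 0 < C)
    (hgrowth : ∀ X, |F X| ≤ C * (‖X‖ ^ p + 1)) (hΩ : IsOpen Ω) (hb : Bornology.IsBounded Ω)
    (hne : Ω.Nonempty) (hg : MemW a p Set.univ g) (h : MinimisingSeqsBounded a p q F Ω g) :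
    ∃ c : ℝ, 0 < c ∧ ∃ X₀ : GradSpace a n,
      IsQuasiconvexAt a (fun X => F X - c * ‖X‖ ^ q) X₀ := by
  by_contra! hnot
  have hcq := continuous_norm_rpow (W := GradSpace a n) hq
  -- Failure at `X = 0` for one value of `c` provides a test function whose `a`-gradient is not
  -- almost everywhere zero, since otherwise equality would hold.
  have hZ := hnot 1 one_pos 0
  simp only [IsQuasiconvexAt, not_forall, not_le] at hZ
  obtain ⟨Z, hZ, hZlt⟩ := hZ
  have hZ0 : 0 < ⨍ x in unitCube N, ‖smoothAGrad a Z x‖ ^ q := by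
    have hintg := integrableOn_comp_smoothAGrad hcq hZ 0 (volume_unitCube_ne_top N)
    simp only [zero_add] at hintg
    have hnn : 0 ≤ᵐ[volume.restrict (unitCube N)] fun x => ‖smoothAGrad a Z x‖ ^ q :=
      Eventually.of_forall fun x => by positivity
    have h0 : 0 ≤ ∫ x in unitCube N, ‖smoothAGrad a Z x‖ ^ q := integral_nonneg_of_ae hnn
    rw [setAverage_eq, smul_eq_mul]
    refine mul_pos (inv_pos.2 (measureReal_unitCube_pos N)) (h0.lt_of_ne' fun h1 => ?_)
    have h2 := (integral_eq_zero_iff_of_nonneg_ae hnn hintg).1 h1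
    refine hZlt.ne ?_
    rw [setAverage_eq, integral_congr_ae (g := fun _ => F 0 - 1 * ‖(0 : GradSpace a n)‖ ^ q),
      ← setAverage_eq, setAverage_const (volume_unitCube_ne_zero N) (volume_unitCube_ne_top N)]
    filter_upwards [h2] with x hx
    have hx0 : smoothAGrad a Z x = 0 :=
      norm_eq_zero.1 ((Real.rpow_eq_zero (norm_nonneg _) (by linarith)).1 hx)
    rw [hx0, add_zero]
  obtain ⟨m₀, hm₀⟩ := h.exists_energy_lower_bound ha hp hq hqp hF hC hgrowth hΩ hb hne hg hZ hZ0
  set S := energy a F Ω '' dirichletClass a p Ω g with hS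
  have hSne : S.Nonempty := ⟨_, g, mem_dirichletClass_self hΩ, rfl⟩
  have hSb : BddBelow S := ⟨m₀, by rintro _ ⟨w, hw, rfl⟩; exact hm₀ w hw⟩
  have hlow : ∀ w ∈ dirichletClass a p Ω g, sInf S ≤ energy a F Ω w := fun w hw =>
    csInf_le hSb ⟨w, hw, rfl⟩
  have hu : ∀ j : ℕ, ∃ u ∈ dirichletClass a p Ω g, (j : ℝ) < gradNorm a q Ω u ^ q ∧
      energy a F Ω u ≤ sInf S + 2 * (1 / ((j : ℝ) + 1)) := by
    intro j
    have hj : (0 : ℝ) < 1 / ((j : ℝ) + 1) := by positivity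
    obtain ⟨_, ⟨w, hw, rfl⟩, hwlt⟩ := exists_lt_of_csInf_lt hSne (lt_add_of_pos_right (sInf S) hj)
    -- With `c = (j + 1)⁻²` and `M = j` the cost `c (|M| + 1)` is `1 / (j + 1)`, the same as the
    -- allowed distance of `w` from the infimum.
    have hc : (0 : ℝ) < 1 / ((j : ℝ) + 1) / ((j : ℝ) + 1) := by positivity
    obtain ⟨u, hu, hju, huE⟩ := exists_large_gradNorm hN ha hp hq hqp hF hC hgrowth hΩ hb hne hg hc
      (hnot _ hc) hm₀ j hw
    refine ⟨u, hu, hju, ?_⟩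
    rw [abs_of_nonneg (by positivity : (0 : ℝ) ≤ j), div_mul_cancel₀ _ (by positivity)] at huE
    linarith
  choose u huc hu1 hu2 using hu
  have hlim : Tendsto (fun j => energy a F Ω (u j)) atTop (𝓝 (sInf S)) := by
    refine tendsto_of_tendsto_of_tendsto_of_le_of_le tendsto_const_nhds ?_
      (fun j => hlow _ (huc j)) hu2
    simpa using (tendsto_one_div_add_atTop_nhds_zero_nat.const_mul (2 : ℝ)).const_add (sInf S)
  obtain ⟨B, hB⟩ := h.exists_gradNorm_rpow_le hq hΩ hg (isMinimisingSeq_of_tendsto hlow huc hlim)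
  obtain ⟨j, hj⟩ := exists_nat_gt B
  linarith [hB j, hu1 j]

end Necessity

/-! ### From quasiconvexity at a point to mean coercivity -/

section Sufficiency

variable {N n : ℕ} {a : Fin N → ℕ} {p q : ℝ} {Ω : Set (EuclideanSpace ℝ (Fin N))}
  {F : GradSpace a n → ℝ} {g : EuclideanSpace ℝ (Fin N) → EuclideanSpace ℝ (Fin n)}

/-- Quasiconvexity with test functions on an anisotropic box instead of the unit cube. -/
theorem IsQuasiconvexAt.le_setIntegral_aBox (ha : ∀ i, 1 ≤ a i) {G : GradSpace a n → ℝ}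
    {X₀ : GradSpace a n} (h : IsQuasiconvexAt a G X₀) {t : ℝ} (ht : 0 < t)
    {ψ : EuclideanSpace ℝ (Fin N) → EuclideanSpace ℝ (Fin n)} (hψ : IsTestFunction (aBox a 0 t) ψ) :
    volume.real (aBox a 0 t) * G X₀ ≤ ∫ x in aBox a 0 t, G (X₀ + smoothAGrad a ψ x) := by
  set e := (boxHomeo a (0 : EuclideanSpace ℝ (Fin N)) ht).symm with he
  have hsm : ContDiff ℝ ∞ e := contDiff_diagAffine _ _
  have hφ : IsTestFunction (unitCube N) (t⁻¹ • (ψ ∘ e)) := by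
    refine IsTestFunction.const_smul ⟨hψ.smooth.comp hsm, hψ.compact.comp_homeomorph e, ?_⟩ _
    rw [tsupport_comp_eq_preimage ψ e]
    intro x hx
    have h1 := hψ.support hx
    rw [← boxChart_preimage_unitCube ht] at h1
    have h2 : boxChart a 0 t (e x) = x :=
      (boxHomeo a (0 : EuclideanSpace ℝ (Fin N)) ht).apply_symm_apply x
    rwa [Set.mem_preimage, h2] at h1
  have hψeq : scaledBump a 0 t (t⁻¹ • (ψ ∘ e)) = ψ := by
    funext x
    have h2 : e (boxChart a 0 t x) = x :=
      (boxHomeo a (0 : EuclideanSpace ℝ (Fin N)) ht).symm_apply_apply x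
    change t • t⁻¹ • ψ (e (boxChart a 0 t x)) = ψ x
    rw [h2, smul_smul, mul_inv_cancel₀ ht.ne', one_smul]
  have h3 := setIntegral_smoothAGrad_scaledBump ha hφ.smooth ht 0 G X₀
  rw [hψeq] at h3
  rw [h3]
  exact mul_le_mul_of_nonneg_left (h _ hφ) measureReal_nonneg

theorem exists_closedBall_subset_aBox (ha : ∀ i, 1 ≤ a i) (r : ℝ) :
    ∃ t : ℝ, 0 < t ∧ Metric.closedBall (0 : EuclideanSpace ℝ (Fin N)) r ⊆ aBox a 0 t := by
  set b : ℝ := |r| + 1 with hb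
  have hb1 : 1 ≤ b := by linarith [abs_nonneg r]
  have hb0 : 0 < b := by linarith
  -- Each half side `t^{1/a_i}` is then a power of `b ≥ 1` with exponent at least one, and `b > r`.
  refine ⟨b ^ (∑ i, a i), by positivity, fun x hx i => ?_⟩
  have hai : (0 : ℝ) < a i := by exact_mod_cast ha i
  have h1 : (1 : ℝ) ≤ ((∑ i, a i : ℕ) : ℝ) * (a i : ℝ)⁻¹ := by
    rw [← div_eq_mul_inv, one_le_div hai]
    exact_mod_cast Finset.single_le_sum (f := a) (fun j _ => Nat.zero_le _) (Finset.mem_univ i)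
  have h2 : |x i| ≤ r := (PiLp.norm_apply_le x i).trans (mem_closedBall_zero_iff.1 hx)
  rw [PiLp.zero_apply, sub_zero, aScale, ← Real.rpow_natCast, ← Real.rpow_mul hb0.le]
  calc |x i| < b := by linarith [le_abs_self r]
    _ ≤ _ := Real.self_le_rpow_of_one_le hb1 h1

/-- The point is that `D` does not depend on `f`. The Leibniz rule involves only `∂^β` with `β ≤ α`,
whose weight is at most one, and these are within distance one of the derivatives of `g`. -/
theorem exists_eLpNorm_cutoff_le (ha : ∀ i, 1 ≤ a i) (hp : 1 ≤ p) (hg : MemW a p Set.univ g)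
    {η : EuclideanSpace ℝ (Fin N) → ℝ} (hη : IsTestFunction Set.univ η)
    {P : EuclideanSpace ℝ (Fin N) → EuclideanSpace ℝ (Fin n)} (hP : ContDiff ℝ ∞ P)
    {B : Set (EuclideanSpace ℝ (Fin N))} (hB : Bornology.IsBounded B) :
    ∃ D : ℝ≥0∞, D ≠ ⊤ ∧ ∀ f : EuclideanSpace ℝ (Fin N) → EuclideanSpace ℝ (Fin n),
      ContDiff ℝ ∞ f → (∀ β ∈ lowIdx a, eLpNorm (pderiv β f - weakDeriv Set.univ β g)
        (ENNReal.ofReal p) volume ≤ 1) →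
      eLpNorm (smoothAGrad a fun y => η y • (f - P) y) (ENNReal.ofReal p)
        (volume.restrict B) ≤ D := by
  have hp1 := one_le_ofReal hp
  have hfin := isFiniteMeasure_restrict_of_isBounded hB
  choose C hC0 hC using fun α : topIdx a =>
    exists_norm_pderiv_smul_le (V := EuclideanSpace ℝ (Fin n)) (α : Fin N → ℕ) η hη
  have hlow : ∀ α : topIdx a, ∀ β ∈ Finset.Iic (α : Fin N → ℕ), β ∈ lowIdx a := fun α β hβ =>
    (mem_lowIdx ha).2 ((weight_mono (Finset.mem_Iic.1 hβ)).trans ((mem_topIdx ha).1 α.2).le)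
  have hgL : ∀ β ∈ lowIdx a, MemLp (weakDeriv Set.univ β g) (ENNReal.ofReal p) volume := by
    intro β hβ
    have := hg.memLp_weakDeriv isOpen_univ hβ
    rwa [Measure.restrict_univ] at this
  have hPL : ∀ β, eLpNorm (pderiv β P) (ENNReal.ofReal p) (volume.restrict B) ≠ ⊤ := by
    intro β
    have hcont := (contDiff_pderiv hP β).continuous
    obtain ⟨M, hM⟩ := hB.isCompact_closure.exists_bound_of_continuousOn hcont.continuousOn
    have hae : ∀ᵐ x ∂volume.restrict B, ‖pderiv β P x‖ ≤ M := by
      refine ae_mono (Measure.restrict_mono_set volume subset_closure) ?_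
      exact (ae_restrict_iff' isClosed_closure.measurableSet).2 (Eventually.of_forall hM)
    exact (MemLp.of_bound hcont.aestronglyMeasurable M hae).2.ne
  refine ⟨∑ α : topIdx a, ENNReal.ofReal (C α) * ∑ β ∈ Finset.Iic (α : Fin N → ℕ),
    (1 + eLpNorm (weakDeriv Set.univ β g) (ENNReal.ofReal p) volume +
      eLpNorm (pderiv β P) (ENNReal.ofReal p) (volume.restrict B)), ?_, fun f hf hfg => ?_⟩
  · refine ENNReal.sum_ne_top.2 fun α _ => ENNReal.mul_ne_top ENNReal.ofReal_ne_top
      (ENNReal.sum_ne_top.2 fun β hβ => ?_)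
    have h1 := (hgL β (hlow α β hβ)).2.ne
    have h2 := hPL β
    finiteness
  · have hsm : ContDiff ℝ ∞ fun y => η y • (f - P) y := hη.smooth.smul (hf.sub hP)
    refine (eLpNorm_gradSpace_le_sum hp fun α =>
      (contDiff_pderiv hsm (α : Fin N → ℕ)).continuous.aestronglyMeasurable).trans
      (Finset.sum_le_sum fun α _ => ?_)
    have hm : ∀ β : Fin N → ℕ, AEStronglyMeasurable (pderiv β (f - P)) (volume.restrict B) :=
      fun β => (contDiff_pderiv (hf.sub hP) β).continuous.aestronglyMeasurable
    have h1 : eLpNorm (pderiv (α : Fin N → ℕ) fun y => η y • (f - P) y) (ENNReal.ofReal p)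
        (volume.restrict B) ≤ ENNReal.ofReal (C α) *
        eLpNorm (∑ β ∈ Finset.Iic (α : Fin N → ℕ), fun x => ‖pderiv β (f - P) x‖)
          (ENNReal.ofReal p) (volume.restrict B) := by
      refine eLpNorm_le_mul_eLpNorm_of_ae_le_mul (Eventually.of_forall fun x => ?_) _
      rw [Finset.sum_apply, Real.norm_of_nonneg (Finset.sum_nonneg fun β _ => norm_nonneg _)]
      exact hC α (f - P) (hf.sub hP) x
    refine h1.trans (mul_le_mul_right ((eLpNorm_sum_le (fun β _ => (hm β).norm) hp1).trans
      (Finset.sum_le_sum fun β hβ => ?_)) _)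
    rw [eLpNorm_norm, pderiv_sub hf hP]
    refine (eLpNorm_sub_le (contDiff_pderiv hf β).continuous.aestronglyMeasurable
      (contDiff_pderiv hP β).continuous.aestronglyMeasurable hp1).trans (add_le_add_left ?_ _)
    refine (eLpNorm_mono_measure _ (Measure.restrict_le_self (s := B))).trans ?_
    have h2 := eLpNorm_add_le ((contDiff_pderiv hf β).continuous.aestronglyMeasurable.sub
      (hgL β (hlow α β hβ)).1) (hgL β (hlow α β hβ)).1 hp1
    rw [sub_add_cancel] at h2
    exact h2.trans (add_le_add_left (hfg β (hlow α β hβ)) _)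

/-- Approximation of a competitor by the sum of a test function and a smooth function close to
the boundary datum. -/
theorem exists_smooth_approx (hp : 1 ≤ p) (hΩ : IsOpen Ω) (hg : MemW a p Set.univ g)
    {u : EuclideanSpace ℝ (Fin N) → EuclideanSpace ℝ (Fin n)} (hu : u ∈ dirichletClass a p Ω g)
    {δ : ℝ} (hδ : 0 < δ) :
    ∃ φ f : EuclideanSpace ℝ (Fin N) → EuclideanSpace ℝ (Fin n), IsTestFunction Ω φ ∧
      ContDiff ℝ ∞ f ∧
      (∀ β ∈ lowIdx a, eLpNorm (pderiv β f - weakDeriv Set.univ β g)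
        (ENNReal.ofReal p) volume ≤ 1) ∧
      MemLp (smoothAGrad a φ + smoothAGrad a f) (ENNReal.ofReal p) (volume.restrict Ω) ∧
      eLpNorm (smoothAGrad a φ + smoothAGrad a f - aGrad a Ω u) (ENNReal.ofReal p)
        (volume.restrict Ω) ≤ ENNReal.ofReal δ := by
  have hp1 := one_le_ofReal hp
  have hgΩ := hg.mono (Set.subset_univ Ω)
  obtain ⟨ϕ, hϕ, rfl⟩ := hu
  have hδ2 : 0 < ENNReal.ofReal (δ / 2) := ENNReal.ofReal_pos.2 (half_pos hδ)
  obtain ⟨φ, hφ, hφlt⟩ := hϕ.2 _ hδ2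
  -- `δ / 2` is shared among the columns of the gradient; the summand `1` keeps the divisor nonzero.
  set k : ℝ≥0∞ := (Fintype.card (topIdx a) : ℝ≥0∞) + 1 with hk
  have hk0 : k ≠ 0 := by simp [hk]
  have hkt : k ≠ ⊤ := by simp [hk]
  obtain ⟨f, hf, hfg⟩ := hg.exists_contDiff_approx hp
    (ε := min 1 (ENNReal.ofReal (δ / 2) / k)) (lt_min one_pos (ENNReal.div_pos hδ2.ne' hkt))
  have hφL : MemLp (smoothAGrad a φ) (ENNReal.ofReal p) (volume.restrict Ω) :=
    MemLp.of_eval_piLp fun α => ((hφ.pderiv (α : Fin N → ℕ)).memLp _).restrict Ω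
  have hfL : MemLp (smoothAGrad a f) (ENNReal.ofReal p) (volume.restrict Ω) :=
    MemLp.of_eval_piLp fun α => (hfg α (topIdx_subset_lowIdx a α.2)).1.restrict Ω
  refine ⟨φ, f, hφ, hf, fun β hβ => (hfg β hβ).2.trans (min_le_left _ _), hφL.add hfL, ?_⟩
  have hφW := hφ.memW a p Ω
  have h1 : eLpNorm (aGrad a Ω ϕ - smoothAGrad a φ) (ENNReal.ofReal p) (volume.restrict Ω) ≤
      ENNReal.ofReal (δ / 2) := by
    have h2 : aGrad a Ω (ϕ - φ) =ᵐ[volume.restrict Ω] aGrad a Ω ϕ - smoothAGrad a φ :=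
      (hϕ.1.aGrad_sub hΩ hφW).trans (EventuallyEq.rfl.sub (aGrad_of_contDiff hΩ hφ.smooth))
    rw [← eLpNorm_congr_ae h2]
    exact ((hϕ.1.sub hφW).eLpNorm_aGrad_le_wNorm hΩ hp).trans hφlt.le
  have h3 : eLpNorm (smoothAGrad a f - aGrad a Ω g) (ENNReal.ofReal p) (volume.restrict Ω) ≤
      ENNReal.ofReal (δ / 2) := by
    have h4 : ∀ α : topIdx a, eLpNorm (fun x => (smoothAGrad a f - aGrad a Ω g) x α)
        (ENNReal.ofReal p) (volume.restrict Ω) ≤ ENNReal.ofReal (δ / 2) / k := by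
      intro α
      have hα := topIdx_subset_lowIdx a α.2
      have h5 : weakDeriv Ω (α : Fin N → ℕ) g =ᵐ[volume.restrict Ω]
          weakDeriv Set.univ (α : Fin N → ℕ) g :=
        ((hg.hasWeakDeriv hα).mono (Set.subset_univ Ω)).weakDeriv_ae_eq hΩ
      have h6 : (fun x => (smoothAGrad a f - aGrad a Ω g) x α) =ᵐ[volume.restrict Ω]
          pderiv (α : Fin N → ℕ) f - weakDeriv Set.univ (α : Fin N → ℕ) g := by
        filter_upwards [h5] with x hx
        change pderiv (α : Fin N → ℕ) f x - weakDeriv Ω (α : Fin N → ℕ) g x = _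
        rw [hx, Pi.sub_apply]
      rw [eLpNorm_congr_ae h6]
      exact (eLpNorm_mono_measure _ Measure.restrict_le_self).trans
        ((hfg α hα).2.trans (min_le_right _ _))
    have hmeas : ∀ α : topIdx a, AEStronglyMeasurable
        (fun x => (smoothAGrad a f - aGrad a Ω g) x α) (volume.restrict Ω) := fun α =>
      (contDiff_pderiv hf (α : Fin N → ℕ)).continuous.aestronglyMeasurable.sub
        (hgΩ.memLp_weakDeriv hΩ (topIdx_subset_lowIdx a α.2)).1
    refine (eLpNorm_gradSpace_le_sum hp hmeas).trans ((Finset.sum_le_sum fun α _ => h4 α).trans ?_)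
    rw [Finset.sum_const, Finset.card_univ, nsmul_eq_mul]
    calc (Fintype.card (topIdx a) : ℝ≥0∞) * (ENNReal.ofReal (δ / 2) / k)
        ≤ k * (ENNReal.ofReal (δ / 2) / k) := by
          gcongr
          exact le_self_add
      _ = _ := ENNReal.mul_div_cancel hk0 hkt
  have h7 : smoothAGrad a φ + smoothAGrad a f - aGrad a Ω (g + ϕ) =ᵐ[volume.restrict Ω]
      (smoothAGrad a f - aGrad a Ω g) - (aGrad a Ω ϕ - smoothAGrad a φ) := by
    filter_upwards [hgΩ.aGrad_add hΩ hϕ.1] with x hx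
    simp only [Pi.sub_apply, Pi.add_apply, hx]
    abel
  rw [eLpNorm_congr_ae h7]
  refine (eLpNorm_sub_le (hfL.1.sub (hgΩ.memLp_aGrad hΩ).1)
    ((hϕ.1.memLp_aGrad hΩ).1.sub hφL.1) hp1).trans ((add_le_add h3 h1).trans ?_)
  rw [← ENNReal.ofReal_add (by positivity) (by positivity), add_halves]

/-- Mean coercivity follows from a lower bound, uniform in `u`, for the energy of `F - c ‖·‖^q`.
Such a bound comes from testing quasiconvexity on a box with an extension of `u`, whose energy
outside `Ω` is bounded by the data. -/
theorem IsQuasiconvexAt.isMeanCoercive (ha : ∀ i, 1 ≤ a i) (hp : 1 ≤ p)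
    (hq : 1 ≤ q) (hqp : q ≤ p) (hF : Continuous F) {C : ℝ} (hC : 0 < C)
    (hgrowth : ∀ X, |F X| ≤ C * (‖X‖ ^ p + 1)) (hΩ : IsOpen Ω) (hb : Bornology.IsBounded Ω)
    (hg : MemW a p Set.univ g) {c : ℝ} (hc : 0 < c) {X₀ : GradSpace a n}
    (h : IsQuasiconvexAt a (fun X => F X - c * ‖X‖ ^ q) X₀) : IsMeanCoercive a p q F Ω g := by
  have hfin := isFiniteMeasure_restrict_of_isBounded hb
  set G : GradSpace a n → ℝ := fun X => F X - c * ‖X‖ ^ q with hGdef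
  have hG : Continuous G := hF.sub (continuous_const.mul (continuous_norm_rpow hq))
  set C' := C + |c| with hC'
  have hC'0 : 0 < C' := by positivity
  have hGg : ∀ X, |G X| ≤ C' * (‖X‖ ^ p + 1) := growth_sub_rpow hq hqp hgrowth c
  obtain ⟨r, hr0, hr⟩ := hb.exists_pos_norm_le
  obtain ⟨t, ht, hbox⟩ := exists_closedBall_subset_aBox ha (r + 2)
  set B := aBox a (0 : EuclideanSpace ℝ (Fin N)) t with hB
  have hBo : IsOpen B := isOpen_aBox _ _
  have hBt : volume B ≠ ⊤ := volume_aBox_ne_top _ _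
  have hBb : Bornology.IsBounded B := by
    refine (Metric.isBounded_closedBall (x := (0 : EuclideanSpace ℝ (Fin N)))
      (r := ∑ i, aScale a t i)).subset fun x hx => ?_
    rw [mem_closedBall_zero_iff, EuclideanSpace.norm_eq]
    refine (Real.sqrt_le_iff.2 ⟨Finset.sum_nonneg fun i _ => norm_nonneg _,
      Finset.sum_sq_le_sq_sum_of_nonneg fun i _ => norm_nonneg _⟩).trans
      (Finset.sum_le_sum fun i _ => ?_)
    have := hx i
    rw [PiLp.zero_apply, sub_zero] at this
    exact this.le
  have hBfin := isFiniteMeasure_restrict_of_isBounded hBb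
  let η : ContDiffBump (0 : EuclideanSpace ℝ (Fin N)) := ⟨r + 1, r + 2, by linarith, by linarith⟩
  have hηB : tsupport (η : EuclideanSpace ℝ (Fin N) → ℝ) ⊆ B := by
    rw [η.tsupport_eq]; exact hbox
  have hη : IsTestFunction Set.univ (η : EuclideanSpace ℝ (Fin N) → ℝ) :=
    ⟨η.contDiff, η.hasCompactSupport, Set.subset_univ _⟩
  have hΩr : Ω ⊆ Metric.ball 0 (r + 1) := fun x hx => by
    rw [mem_ball_zero_iff]
    linarith [hr x hx]
  have hΩB : Ω ⊆ B := hΩr.trans ((Metric.ball_subset_closedBall.trans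
    (Metric.closedBall_subset_closedBall (by linarith))).trans hbox)
  obtain ⟨P, hP, hPX⟩ := exists_smoothAGrad_eq_const ha X₀
  obtain ⟨D, hDt, hD⟩ := exists_eLpNorm_cutoff_le ha hp hg hη hP hBb
  set T : ℝ := 2 ^ (p - 1) with hT
  set E : ℝ := ∫ x in B, C' * (T * ‖X₀‖ ^ p + 1) with hE
  -- Quasiconvexity on the box, minus the error `1` of the smooth approximation, minus the bound for
  -- the energy on `B \ Ω`. None of these depends on `u`.
  set A : ℝ := volume.real B * G X₀ - 1 - E - C' * T * D.toReal ^ p with hA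
  have hmain : ∀ u ∈ dirichletClass a p Ω g, A ≤ energy a G Ω u := by
    intro u hu
    have huW := memW_of_mem_dirichletClass hg hu
    obtain ⟨δ, hδ, hnem⟩ := exists_integral_abs_sub_le hp hG hC'0 hGg 0
      (huW.memLp_aGrad hΩ) one_pos
    obtain ⟨φ, f, hφ, hf, hfg, hL, hclose⟩ := exists_smooth_approx hp hΩ hg hu hδ
    have hnear := hnem _ 0 hL aestronglyMeasurable_zero (by simp) hclose
    simp only [Pi.zero_apply, add_zero, Pi.add_apply] at hnear
    -- Near `Ω`, where `η = 1`, adding `κ` replaces the constant gradient `X₀` of `P` by that of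
    -- `f`; near the boundary of the box `κ` vanishes.
    set κ : EuclideanSpace ℝ (Fin N) → EuclideanSpace ℝ (Fin n) := fun y => η y • (f - P) y with hκ
    have hfP : ContDiff ℝ ∞ (f - P) := hf.sub hP
    have hκB : IsTestFunction B κ := ⟨hη.smooth.smul hfP, hη.compact.smul_right,
      (tsupport_smul_subset_left _ _).trans hηB⟩
    have hψ : IsTestFunction B (φ + κ) := (hφ.mono hΩB).add hκB
    have hqc := h.le_setIntegral_aBox ha ht hψ
    have hintB : IntegrableOn (fun x => G (X₀ + smoothAGrad a (φ + κ) x)) B :=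
      integrableOn_comp_smoothAGrad hG hψ X₀ hBt
    rw [← integral_inter_add_sdiff hΩ.measurableSet hintB,
      Set.inter_eq_self_of_subset_right hΩB] at hqc
    have hin : ∫ x in Ω, G (X₀ + smoothAGrad a (φ + κ) x) =
        ∫ x in Ω, G (smoothAGrad a φ x + smoothAGrad a f x) := by
      refine setIntegral_congr_fun hΩ.measurableSet fun x hx => ?_
      have h1 : κ =ᶠ[𝓝 x] f - P := by
        filter_upwards [Metric.isOpen_ball.mem_nhds (hΩr hx)] with y hy
        have : η y = 1 := η.one_of_mem_closedBall (Metric.ball_subset_closedBall hy)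
        simp only [hκ, this, one_smul]
      simp only [smoothAGrad_add hφ.smooth hκB.smooth,
        smoothAGrad_congr_nhds hκB.smooth hfP h1, smoothAGrad_sub hf hP, hPX]
      congr 1
      abel
    have hκint : IntegrableOn (fun x => ‖smoothAGrad a κ x‖ ^ p) B := by
      have := integrableOn_comp_smoothAGrad (continuous_norm_rpow (W := GradSpace a n) hp) hκB 0 hBt
      simpa only [zero_add] using this
    have hκL : MemLp (smoothAGrad a κ) (ENNReal.ofReal p) (volume.restrict B) :=
      MemLp.of_eval_piLp fun α => ((hκB.pderiv (α : Fin N → ℕ)).memLp _).restrict B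
    have hconst : IntegrableOn (fun _ : EuclideanSpace ℝ (Fin N) => C' * (T * ‖X₀‖ ^ p + 1)) B :=
      integrableOn_const hBt
    have hout : ∫ x in B \ Ω, G (X₀ + smoothAGrad a (φ + κ) x) ≤ E + C' * T * D.toReal ^ p := by
      calc ∫ x in B \ Ω, G (X₀ + smoothAGrad a (φ + κ) x)
          ≤ ∫ x in B \ Ω, (C' * (T * ‖X₀‖ ^ p + 1) + C' * T * ‖smoothAGrad a κ x‖ ^ p) := by
            refine setIntegral_mono_on (hintB.mono_set Set.sdiff_subset)
              ((hconst.add (hκint.const_mul _)).mono_set Set.sdiff_subset)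
              (hBo.measurableSet.diff hΩ.measurableSet) fun x hx => ?_
            rw [smoothAGrad_add hφ.smooth hκB.smooth, hφ.smoothAGrad_eq_zero hx.2, zero_add]
            have h1 := rpow_norm_add_le hp X₀ (smoothAGrad a κ x)
            have h2 := (le_abs_self _).trans (hGg (X₀ + smoothAGrad a κ x))
            have h3 := mul_le_mul_of_nonneg_left h1 hC'0.le
            refine h2.trans ?_
            rw [mul_add, mul_one]
            refine (add_le_add_left h3 _).trans (le_of_eq ?_)
            rw [hT]
            ring
        _ ≤ ∫ x in B, (C' * (T * ‖X₀‖ ^ p + 1) + C' * T * ‖smoothAGrad a κ x‖ ^ p) :=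
            setIntegral_mono_set (hconst.add (hκint.const_mul _))
              (Eventually.of_forall fun x => by simp only [Pi.zero_apply]; positivity)
              Set.sdiff_subset.eventuallyLE
        _ = E + C' * T * ∫ x in B, ‖smoothAGrad a κ x‖ ^ p := by
            rw [integral_add hconst (hκint.const_mul _), integral_const_mul (C' * T)]
        _ ≤ E + C' * T * D.toReal ^ p := by
            rw [integral_norm_rpow_eq hp hκL]
            gcongr
            exact hD f hf hfg
    rw [hin] at hqc
    have h1 := (abs_le.1 hnear).2
    have h2 : energy a G Ω u = ∫ x in Ω, G (aGrad a Ω u x) := rfl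
    linarith
  refine ⟨c, |A| + 1, hc, by positivity, fun u hu => ?_⟩
  have h1 := hmain u hu
  rw [hGdef, energy_sub_rpow hp hq hqp hF hgrowth hΩ hb (memW_of_mem_dirichletClass hg hu)] at h1
  linarith [neg_abs_le A]

end Sufficiency

end MixedSmoothness

end

/-! ### The equivalences -/

open MixedSmoothness in
theorem mainTheorem3 (N n : ℕ) (hN : 1 ≤ N) (a : Fin N → ℕ) (ha : ∀ i, 1 ≤ a i)
    (p q : ℝ) (hp : 1 < p) (hq : 1 ≤ q) (hqp : q ≤ p)
    (F : GradSpace a n → ℝ) (hF : Continuous F)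
    (hgrowth : ∃ C : ℝ, 0 < C ∧ ∀ X, |F X| ≤ C * (‖X‖ ^ p + 1)) :
    List.TFAE [
      ∀ Ω : Set (EuclideanSpace ℝ (Fin N)), IsBoundedLipschitz Ω →
        ∀ g : EuclideanSpace ℝ (Fin N) → EuclideanSpace ℝ (Fin n), MemW a p Set.univ g →
          IsCoercive a p q F Ω g,
      ∃ Ω : Set (EuclideanSpace ℝ (Fin N)), Ω.Nonempty ∧ IsBoundedLipschitz Ω ∧
        ∃ g : EuclideanSpace ℝ (Fin N) → EuclideanSpace ℝ (Fin n), MemW a p Set.univ g ∧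
          IsCoercive a p q F Ω g,
      ∀ Ω : Set (EuclideanSpace ℝ (Fin N)), IsBoundedLipschitz Ω →
        ∀ g : EuclideanSpace ℝ (Fin N) → EuclideanSpace ℝ (Fin n), MemW a p Set.univ g →
          IsMeanCoercive a p q F Ω g,
      ∃ Ω : Set (EuclideanSpace ℝ (Fin N)), Ω.Nonempty ∧ IsBoundedLipschitz Ω ∧
        ∃ g : EuclideanSpace ℝ (Fin N) → EuclideanSpace ℝ (Fin n), MemW a p Set.univ g ∧
          IsMeanCoercive a p q F Ω g,
      ∀ Ω : Set (EuclideanSpace ℝ (Fin N)), IsBoundedLipschitz Ω →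
        ∀ g : EuclideanSpace ℝ (Fin N) → EuclideanSpace ℝ (Fin n), MemW a p Set.univ g →
          MinimisingSeqsBounded a p q F Ω g,
      ∃ Ω : Set (EuclideanSpace ℝ (Fin N)), Ω.Nonempty ∧ IsBoundedLipschitz Ω ∧
        ∃ g : EuclideanSpace ℝ (Fin N) → EuclideanSpace ℝ (Fin n), MemW a p Set.univ g ∧
          MinimisingSeqsBounded a p q F Ω g,
      ∃ c : ℝ, 0 < c ∧ ∃ X₀ : GradSpace a n,
        IsQuasiconvexAt a (fun X => F X - c * ‖X‖ ^ q) X₀] := by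
  obtain ⟨C, hC, hgrowth⟩ := hgrowth
  have hball : (Metric.ball (0 : EuclideanSpace ℝ (Fin N)) 1).Nonempty := ⟨0, by simp⟩
  have hzero : MemW a p Set.univ
      (0 : EuclideanSpace ℝ (Fin N) → EuclideanSpace ℝ (Fin n)) :=
    (IsTestFunction.zero Set.univ).memW a p Set.univ
  -- The unit ball with zero boundary datum serves in each passage from all domains and data to some
  -- domain and datum.
  tfae_have 1 → 2 := fun h =>
    ⟨_, hball, isBoundedLipschitz_ball, 0, hzero, h _ isBoundedLipschitz_ball 0 hzero⟩
  tfae_have 3 → 4 := fun h =>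
    ⟨_, hball, isBoundedLipschitz_ball, 0, hzero, h _ isBoundedLipschitz_ball 0 hzero⟩
  tfae_have 5 → 6 := fun h =>
    ⟨_, hball, isBoundedLipschitz_ball, 0, hzero, h _ isBoundedLipschitz_ball 0 hzero⟩
  tfae_have 3 → 1 := fun h Ω hΩ g hg => (h Ω hΩ g hg).isCoercive hq
  tfae_have 1 → 5 := fun h Ω hΩ g hg =>
    (h Ω hΩ g hg).minimisingSeqsBounded hN ha hq hqp hΩ.isOpen hΩ.bounded hg
  tfae_have 4 → 2 := fun ⟨Ω, hne, hΩ, g, hg, h⟩ => ⟨Ω, hne, hΩ, g, hg, h.isCoercive hq⟩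
  tfae_have 2 → 6 := fun ⟨Ω, hne, hΩ, g, hg, h⟩ =>
    ⟨Ω, hne, hΩ, g, hg, h.minimisingSeqsBounded hN ha hq hqp hΩ.isOpen hΩ.bounded hg⟩
  tfae_have 6 → 7 := fun ⟨Ω, hne, hΩ, g, hg, h⟩ =>
    h.exists_isQuasiconvexAt hN ha hp.le hq hqp hF hC hgrowth hΩ.isOpen hΩ.bounded hne hg
  -- Quasiconvexity at a point refers to neither `Ω` nor `g`; through it a statement for one domain
  -- and datum becomes a statement for all.
  tfae_have 7 → 3 := fun ⟨c, hc, X₀, h⟩ Ω hΩ g hg =>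
    h.isMeanCoercive ha hp.le hq hqp hF hC hgrowth hΩ.isOpen hΩ.bounded hg hc
  tfae_finish
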